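/- Let $T>0$, let $\Sigma$ be a compact smooth $d$-dimensional manifold with (possibly empty) smooth boundary $\partial\Sigma$, $d\ge 1$, and let $M=[0,T]\times\Sigma$, $\Sigma_t=\{t\}\times\Sigma$, $\mathcal T_t=[0,t]\times\partial\Sigma$, $\mathcal T=\mathcal T_T$. Let $g_{ab}$ be a smooth Lorentz metric on $M$ of signature $(-,+,\dots,+)$, with Levi-Civita connection $\nabla_a$, such that every slice $\Sigma_t$ is spacelike and $\mathcal T$ is timelike; time is oriented so that $t$ increases to the future. Let $n^a$ be the future-directed unit normal field of the slices $\Sigma_t$ and $N^a$ the outward unit normal field of $\mathcal T$. Let $T^a$ be a smooth future-directed timelike vector field on $\mathcal T$, tangent to $\mathcal T$, with $g_{ab}T^aT^b=-1$, let $\alpha>0$ be a smooth function on $\mathcal T$, let $0<\rho<1$, and let $u^a$ be a smooth future-directed timelike vector field on $M$ with $$u^a|_{\mathcal T}=T^a+\delta N^a,\qquad \delta=(1-\rho)\,\frac{\alpha}{1+\alpha^2}.$$ Put $\mathcal A^a{}_{bc}=-u^ag_{bc}+\delta^a{}_bu_c+\delta^a{}_cu_b$, where $\delta^a{}_b$ is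 the Kronecker symbol. Then there is a constant $C\ge 1$, depending only on these data ($T$, $\Sigma$, $g$, $T^a$, $\alpha$, $\rho$, $u$), such that the following holds. Let $S$ be a function on $M$, $\phi_0$ (differentiable) and $\pi_0$ functions on $\Sigma$, and $G$ a function on $\mathcal T$, and let $V_a$ be a one-form of class $C^1$ on $M$ (up to the boundary) that solves the first-order reduced scalar wave problem $$g^{ab}\nabla_aV_b=S,\qquad \mathcal L_uV_b=\nabla_b(u^aV_a)\qquad\text{on }M,$$ $$n^bV_b|_{\Sigma_0}=\pi_0,\qquad \iota_0^*V=d\phi_0,\qquad \left[T^bV_b+\alpha N^bV_b\right]_{\mathcal T}=G,$$ where $\iota_0:\Sigma_0\to M$ is the inclusion. Then for all $0\le t\le T$ $$\int_{\Sigma_t}n_a\mathcal A^a{}_{bc}V^bV^c+\int_{\mathcal T_t}n_a\mathcal A^a{}_{bc}V^bV^c\;\le\;C\left[\int_{\Sigma_0}n_a\mathcal A^a{}_{bc}V^bV^c+\int_{\mathcal T_t}G^2+\int_0^t\Big(\int_{\Sigma_s}S^2\Big)ds\right],$$ the integrals over $\Sigma_s$ and $\mathcal T_t$ being taken with respect to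 the volume measures induced by $g$. -/

import Mathlib

open Set MeasureTheory Bundle
open scoped Manifold ContDiff Matrix

noncomputable section

namespace BoundaryWave

/-! ## Linear algebra of one tangent space `ℝ × ℝᵈ`, `d = n + 1`

A tangent vector of `ℝ × X` at `p = (t, x)` is a pair `(v⁰, v')`, where `v⁰ = dt(v)` and `v'` is
the coordinate vector of the `X`-component in the preferred chart of `X` at `x`. -/

/-- The model vector space of the spacetime `ℝ × X`, where `dim X = n + 1`. -/
abbrev Vec (n : ℕ) : Type := ℝ × EuclideanSpace ℝ (Fin (n + 1))

/-- Bilinear forms on `Vec n`. -/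
abbrev BilForm (n : ℕ) : Type := Vec n →L[ℝ] Vec n →L[ℝ] ℝ

/-- The standard basis of `ℝ × ℝᵈ`: `e₀ = (1, 0)` (the time direction) and
`eᵢ₊₁ = (0, i-th unit vector)`. -/
def stdVec (n : ℕ) (a : Fin (n + 2)) : Vec n :=
  Fin.cases (1, 0) (fun i => (0, EuclideanSpace.single i 1)) a

/-- The components of a vector in the basis `stdVec`. -/
def comp {n : ℕ} (v : Vec n) (a : Fin (n + 2)) : ℝ :=
  Fin.cases v.1 (fun i => v.2 i) a

/-- A symmetric bilinear form of Lorentz signature `(-, +, …, +)`. -/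
def IsLorentzForm {n : ℕ} (B : BilForm n) : Prop :=
  (∀ v w, B v w = B w v) ∧
    ∃ v₀, B v₀ v₀ < 0 ∧ ∀ w, B v₀ w = 0 → w ≠ 0 → 0 < B w w

/-- Timelike and future directed (the time coordinate `t` increases to the future). -/
def IsFutureTimelike {n : ℕ} (B : BilForm n) (v : Vec n) : Prop :=
  B v v < 0 ∧ 0 < v.1

/-- Raising an index: `sharp B η` is the vector `v` with `B v = η`. -/
def sharp {n : ℕ} (B : BilForm n) (η : Vec n →L[ℝ] ℝ) : Vec n :=
  ContinuousLinearMap.inverse B η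

/-- The covector `dt`. -/
def dtForm (n : ℕ) : Vec n →L[ℝ] ℝ :=
  ContinuousLinearMap.fst ℝ ℝ (EuclideanSpace ℝ (Fin (n + 1)))

/-- The covector `dx⁰`, where `x⁰ ≥ 0` is the coordinate of the half space whose vanishing
describes the boundary. -/
def dxForm (n : ℕ) : Vec n →L[ℝ] ℝ :=
  (EuclideanSpace.proj (0 : Fin (n + 1))).comp
    (ContinuousLinearMap.snd ℝ ℝ (EuclideanSpace ℝ (Fin (n + 1))))

/-- The future directed unit normal `n` of the time slice: the normalization of `-dt♯`
(see `futureNormal_spec`). -/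
def futureNormal {n : ℕ} (B : BilForm n) : Vec n :=
  -(Real.sqrt (-(sharp B (dtForm n)).1))⁻¹ • sharp B (dtForm n)

/-- At a boundary point, the outward unit normal `N` of the lateral boundary: the normalization of
`-(dx⁰)♯` (see `outwardNormal_spec`). -/
def outwardNormal {n : ℕ} (B : BilForm n) : Vec n :=
  -(Real.sqrt ((sharp B (dxForm n)).2 0))⁻¹ • sharp B (dxForm n)

/-- The symbol `𝒜ᵃ_{bc} = -uᵃ g_{bc} + δᵃ_b u_c + δᵃ_c u_b`, contracted with a covector `w_a` and
vectors `vᵇ`, `v'ᶜ`. -/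
def symbol {n : ℕ} (B : BilForm n) (u : Vec n) (w : Vec n →L[ℝ] ℝ) (v v' : Vec n) : ℝ :=
  -(w u) * B v v' + w v * B u v' + w v' * B u v

/-- The energy density `n_a 𝒜ᵃ_{bc} Vᵇ Vᶜ` of a covector `V_a`, with `Vᵃ = gᵃᵇ V_b`. -/
def energyDensity {n : ℕ} (B : BilForm n) (u : Vec n) (V : Vec n →L[ℝ] ℝ) : ℝ :=
  symbol B u (B (futureNormal B)) (sharp B V) (sharp B V)

/-! ### The normals are what they should be -/

theorem IsLorentzForm.apply_sharp {n : ℕ} {B : BilForm n} (hB : IsLorentzForm B)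
    (η : Vec n →L[ℝ] ℝ) : B (sharp B η) = η := by
  obtain ⟨hsymm, v₀, hv₀, hpos⟩ := hB
  have hinj : Function.Injective B := by
    rw [injective_iff_map_eq_zero]
    intro x hx
    by_contra hne
    have h1 : B v₀ x = 0 := by rw [hsymm, hx]; rfl
    have h2 := hpos x h1 hne
    rw [hx] at h2
    exact lt_irrefl _ h2
  have hfin : Module.finrank ℝ (Vec n) = Module.finrank ℝ (Vec n →L[ℝ] ℝ) := by
    rw [← (LinearMap.toContinuousLinearMap (𝕜 := ℝ) (E := Vec n) (F' := ℝ)).finrank_eq]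
    exact (Subspace.dual_finrank_eq (K := ℝ) (V := Vec n)).symm
  let e : Vec n ≃ₗ[ℝ] (Vec n →L[ℝ] ℝ) :=
    LinearEquiv.ofInjectiveOfFinrankEq (B : Vec n →ₗ[ℝ] (Vec n →L[ℝ] ℝ)) hinj hfin
  have he : B = (e.toContinuousLinearEquiv : Vec n →L[ℝ] (Vec n →L[ℝ] ℝ)) :=
    ContinuousLinearMap.ext fun _ => rfl
  unfold sharp
  rw [he, ContinuousLinearMap.inverse_equiv]
  simp

/-- If the time slice is spacelike, `futureNormal B` is the future directed unit normal to it. -/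
theorem futureNormal_spec {n : ℕ} {B : BilForm n} (hB : IsLorentzForm B)
    (hs : ∀ ξ : EuclideanSpace ℝ (Fin (n + 1)), ξ ≠ 0 → 0 < B (0, ξ) (0, ξ)) :
    B (futureNormal B) (futureNormal B) = -1 ∧ 0 < (futureNormal B).1 ∧
      ∀ ξ, B (futureNormal B) (0, ξ) = 0 := by
  have hk := hB.apply_sharp (dtForm n)
  obtain ⟨hsymm, v₀, hv₀, -⟩ := hB
  unfold futureNormal
  set k := sharp B (dtForm n) with hkdef
  have hk' : ∀ w, B k w = w.1 := fun w => by rw [hk]; rfl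
  have hneg : k.1 < 0 := by
    by_contra! h
    rcases h.eq_or_lt with h | h
    · by_cases h2 : k.2 = 0
      · have hk0 : k = 0 := Prod.ext h.symm h2
        have := hk' (1, 0)
        rw [hk0] at this
        simp at this
      · have h3 := hs k.2 h2
        have h4 : ((0 : ℝ), k.2) = k := Prod.ext h rfl
        rw [h4, hk' k, ← h] at h3
        exact lt_irrefl _ h3
    · have hdec : v₀ = (v₀.1 / k.1) • k + ((0 : ℝ), v₀.2 - (v₀.1 / k.1) • k.2) := by
        refine Prod.ext ?_ ?_
        · simp [h.ne']
        · simp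
      set c := v₀.1 / k.1
      set ξ := v₀.2 - c • k.2
      have h5 : 0 ≤ B ((0 : ℝ), ξ) ((0 : ℝ), ξ) := by
        by_cases hξ : ξ = 0
        · rw [hξ, Prod.mk_zero_zero, map_zero]
        · exact (hs ξ hξ).le
      have h6 : B v₀ v₀ = c ^ 2 * k.1 + B ((0 : ℝ), ξ) ((0 : ℝ), ξ) := by
        rw [hdec]
        simp only [map_add, map_smul, add_apply, smul_apply, smul_eq_mul]
        rw [hsymm (0, ξ) k, hk' k, hk' (0, ξ)]
        ring
      have : 0 ≤ c ^ 2 * k.1 := by positivity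
      linarith
  have hpos : 0 < -k.1 := by linarith
  have hsq : Real.sqrt (-k.1) * Real.sqrt (-k.1) = -k.1 := Real.mul_self_sqrt hpos.le
  have hsp : 0 < Real.sqrt (-k.1) := Real.sqrt_pos.2 hpos
  refine ⟨?_, ?_, ?_⟩
  · simp only [map_neg, map_smul, neg_apply, smul_apply, smul_eq_mul, neg_smul, hk' k]
    field_simp
    nlinarith
  · have : ((-(Real.sqrt (-k.1))⁻¹) • k).1 = (Real.sqrt (-k.1))⁻¹ * (-k.1) := by
      simp
    rw [this]
    positivity
  · intro ξ
    simp [hk' (0, ξ)]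

/-- If the boundary hyperplane `{v' 0 = 0}` contains a timelike vector, `outwardNormal B` is the
outward unit normal to it. -/
theorem outwardNormal_spec {n : ℕ} {B : BilForm n} (hB : IsLorentzForm B)
    (hs : ∃ w : Vec n, w.2 0 = 0 ∧ B w w < 0) :
    B (outwardNormal B) (outwardNormal B) = 1 ∧ (outwardNormal B).2 0 < 0 ∧
      ∀ w : Vec n, w.2 0 = 0 → B (outwardNormal B) w = 0 := by
  have hk := hB.apply_sharp (dxForm n)
  obtain ⟨hsymm, v₀, hv₀, hp⟩ := hB
  obtain ⟨w, hw0, hww⟩ := hs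
  unfold outwardNormal
  set k := sharp B (dxForm n) with hkdef
  have hk' : ∀ w, B k w = w.2 0 := fun w => by rw [hk]; rfl
  have hk0 : k ≠ 0 := by
    intro h
    have := hk' (0, EuclideanSpace.single 0 1)
    rw [h] at this
    simp at this
  have hpos : 0 < k.2 0 := by
    by_contra! h
    have hkw : B k w = 0 := by rw [hk', hw0]
    set x := (B v₀ k) • w + (-(B v₀ w)) • k with hx
    have h1 : B v₀ x = 0 := by
      simp only [hx, map_add, map_smul, smul_eq_mul]; ring
    have h2 : B x x = (B v₀ k) ^ 2 * B w w + (B v₀ w) ^ 2 * k.2 0 := by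
      simp only [hx, map_add, map_smul, add_apply, smul_apply, smul_eq_mul]
      rw [hsymm w k, hkw, hk' k]
      ring
    have h3 : B x x ≤ 0 := by
      rw [h2]
      have a1 := mul_nonneg (sq_nonneg (B v₀ k)) (neg_nonneg.2 hww.le)
      have a2 := mul_nonneg (sq_nonneg (B v₀ w)) (neg_nonneg.2 h)
      linarith
    have h4 : x = 0 := by
      by_contra hne
      exact absurd (hp x h1 hne) (not_lt.2 h3)
    have h5 : B v₀ k = 0 := by
      have : B x w = 0 := by rw [h4]; simp
      simp only [hx, map_add, map_smul, add_apply, smul_apply, smul_eq_mul, hkw] at this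
      simpa [hww.ne] using this
    have h6 := hp k h5 hk0
    rw [hk' k] at h6
    exact absurd h6 (not_lt.2 h)
  have hsq : Real.sqrt (k.2 0) * Real.sqrt (k.2 0) = k.2 0 := Real.mul_self_sqrt hpos.le
  have hsp : 0 < Real.sqrt (k.2 0) := Real.sqrt_pos.2 hpos
  refine ⟨?_, ?_, ?_⟩
  · simp only [map_neg, map_smul, neg_apply, smul_apply, smul_eq_mul, neg_smul, hk' k]
    field_simp
    nlinarith
  · have : ((-(Real.sqrt (k.2 0))⁻¹) • k).2 0 = -((Real.sqrt (k.2 0))⁻¹ * (k.2 0)) := by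
      simp
    rw [this]
    have : 0 < (Real.sqrt (k.2 0))⁻¹ * (k.2 0) := by positivity
    linarith
  · intro w hw
    simp [hk' w, hw]

/-! ## Fields on the spacetime `[0, T] × X ⊆ ℝ × X` -/

/-- The model with corners of `ℝ × X`, where `X` is a manifold with boundary of dimension
`n + 1`. -/
abbrev stModel (n : ℕ) :
    ModelWithCorners ℝ (Vec n) (ModelProd ℝ (EuclideanHalfSpace (n + 1))) :=
  𝓘(ℝ, ℝ).prod (𝓡∂ (n + 1))

section Fields

variable (n : ℕ) (X : Type*) [TopologicalSpace X] [ChartedSpace (EuclideanHalfSpace (n + 1)) X]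

/-- Tensor fields `g_{ab}`. -/
abbrev MetricField : Type _ :=
  ∀ p : ℝ × X, TangentSpace (stModel n) p →L[ℝ] TangentSpace (stModel n) p →L[ℝ] ℝ

/-- Vector fields `uᵃ`. -/
abbrev VectorField : Type _ := ∀ p : ℝ × X, TangentSpace (stModel n) p

/-- Covector fields `V_a`. -/
abbrev CovectorField : Type _ := ∀ p : ℝ × X, TangentSpace (stModel n) p →L[ℝ] ℝ

end Fields

/-- The region `M = [0, T] × X`. -/
def slab (X : Type*) (T : ℝ) : Set (ℝ × X) := Icc 0 T ×ˢ univ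

section Manifold

variable {n : ℕ} {X : Type*} [TopologicalSpace X] [ChartedSpace (EuclideanHalfSpace (n + 1)) X]

variable (n X) in
/-- The lateral boundary `𝒯 = [0, T] × ∂X`. -/
def lateral (T : ℝ) : Set (ℝ × X) := Icc 0 T ×ˢ (𝓡∂ (n + 1)).boundary X

section Smoothness

variable [IsManifold (𝓡∂ (n + 1)) ∞ X]

/-- `g` is of class `Cᵏ` on `s`. -/
def MetricField.SmoothOn (k : WithTop ℕ∞) (g : MetricField n X) (s : Set (ℝ × X)) : Prop :=
  ContMDiffOn (stModel n) ((stModel n).prod 𝓘(ℝ, Vec n →L[ℝ] Vec n →L[ℝ] ℝ)) k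
    (fun p => (TotalSpace.mk' (Vec n →L[ℝ] Vec n →L[ℝ] ℝ) p (g p) :
      TotalSpace (Vec n →L[ℝ] Vec n →L[ℝ] ℝ)
        (fun p : ℝ × X => TangentSpace (stModel n) p →L[ℝ] TangentSpace (stModel n) p →L[ℝ] ℝ))) s

/-- `u` is of class `Cᵏ` on `s`. -/
def VectorField.SmoothOn (k : WithTop ℕ∞) (u : VectorField n X) (s : Set (ℝ × X)) : Prop :=
  ContMDiffOn (stModel n) (stModel n).tangent k
    (fun p => (⟨p, u p⟩ : TangentBundle (stModel n) (ℝ × X))) s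

/-- `V` is of class `Cᵏ` on `s`. -/
def CovectorField.SmoothOn (k : WithTop ℕ∞) (V : CovectorField n X) (s : Set (ℝ × X)) : Prop :=
  ContMDiffOn (stModel n) ((stModel n).prod 𝓘(ℝ, Vec n →L[ℝ] ℝ)) k
    (fun p => (TotalSpace.mk' (Vec n →L[ℝ] ℝ) p (V p) :
      TotalSpace (Vec n →L[ℝ] ℝ)
        (fun p : ℝ × X => TangentSpace (stModel n) p →L[ℝ] ℝ))) s

end Smoothness

/-- The future directed unit normal field `nᵃ` of the time slices `Σ_t`. -/
def sliceNormal (g : MetricField n X) : VectorField n X :=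
  fun p => futureNormal (n := n) (g p)

/-- The outward unit normal field `Nᵃ` of the lateral boundary. -/
def lateralNormal (g : MetricField n X) : VectorField n X :=
  fun p => outwardNormal (n := n) (g p)

/-- `g` is a smooth Lorentz metric on `M = [0, T] × X` for which the slices `Σ_t` are spacelike and
the lateral boundary is timelike. -/
structure IsSlabMetric [IsManifold (𝓡∂ (n + 1)) ∞ X] (T : ℝ) (g : MetricField n X) : Prop where
  smooth : g.SmoothOn ∞ (slab X T)
  lorentz : ∀ p ∈ slab X T, IsLorentzForm (n := n) (g p)
  spacelike_slices : ∀ p ∈ slab X T, ∀ ξ : EuclideanSpace ℝ (Fin (n + 1)),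
    ξ ≠ 0 → 0 < g p ((0, ξ) : Vec n) ((0, ξ) : Vec n)
  timelike_lateral : ∀ p ∈ lateral n X T, ∃ w : Vec n, w.2 0 = 0 ∧ g p w w < 0

/-- `τ` is a smooth, future directed, unit timelike vector field on the lateral boundary, tangent
to it. -/
structure IsBoundaryTimeField [IsManifold (𝓡∂ (n + 1)) ∞ X] (T : ℝ) (g : MetricField n X)
    (τ : VectorField n X) : Prop where
  smooth : τ.SmoothOn ∞ (lateral n X T)
  tangent : ∀ p ∈ lateral n X T, (τ p : Vec n).2 0 = 0
  future : ∀ p ∈ lateral n X T, IsFutureTimelike (n := n) (g p) (τ p)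
  unit : ∀ p ∈ lateral n X T, g p (τ p) (τ p) = -1

/-! ### Local coordinates `(t, x⁰, …, xⁿ)` -/

/-- The inverse of the coordinate system `(t, x⁰, …, xⁿ)` of `ℝ × X` given by the chart of `X` at
`x₀`. -/
def chartParam (x₀ : X) (z : Vec n) : ℝ × X := (z.1, (extChartAt (𝓡∂ (n + 1)) x₀).symm z.2)

/-- The coordinate domain, intersected with `[0, T] × X`. -/
def coordDomain (T : ℝ) (x₀ : X) : Set (Vec n) :=
  Icc 0 T ×ˢ (extChartAt (𝓡∂ (n + 1)) x₀).target

/-- The coordinate frame: `coordFrame x₀ z (stdVec n a)` is the coordinate vector field `∂_a`. -/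
def coordFrame (x₀ : X) (z : Vec n) : Vec n →L[ℝ] Vec n :=
  mfderivWithin 𝓘(ℝ, Vec n) (stModel n) (chartParam (n := n) x₀)
    (univ ×ˢ range (𝓡∂ (n + 1))) z

/-- `g_{ab}` in coordinates. -/
def metricCoord (g : MetricField n X) (x₀ : X) (z : Vec n) (a b : Fin (n + 2)) : ℝ :=
  g (chartParam x₀ z) (coordFrame x₀ z (stdVec n a)) (coordFrame x₀ z (stdVec n b))

/-- The matrix `(g_{ab})`. -/
def metricMatrix (g : MetricField n X) (x₀ : X) (z : Vec n) :
    Matrix (Fin (n + 2)) (Fin (n + 2)) ℝ :=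
  Matrix.of (metricCoord g x₀ z)

/-- `V_a` in coordinates. -/
def covectorCoord (V : CovectorField n X) (x₀ : X) (z : Vec n) (a : Fin (n + 2)) : ℝ :=
  V (chartParam x₀ z) (coordFrame x₀ z (stdVec n a))

/-- `uᵃ` in coordinates, `u = uᵃ ∂_a`. -/
def vectorCoord (u : VectorField n X) (x₀ : X) (z : Vec n) (a : Fin (n + 2)) : ℝ :=
  comp ((coordFrame x₀ z).inverse (u (chartParam x₀ z))) a

/-- The partial derivative `∂_a f` on the domain `D` (one-sided at boundary points of `D`). -/
def partialDeriv (D : Set (Vec n)) (a : Fin (n + 2)) (f : Vec n → ℝ) (z : Vec n) : ℝ :=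
  fderivWithin ℝ f D z (stdVec n a)

/-- The Christoffel symbols
`Γᶜ_{ab} = ½ gᶜᵈ (∂_a g_{bd} + ∂_b g_{ad} - ∂_d g_{ab})` of the Levi-Civita connection. -/
def christoffel (T : ℝ) (g : MetricField n X) (x₀ : X) (z : Vec n) (c a b : Fin (n + 2)) : ℝ :=
  1 / 2 * ∑ d, (metricMatrix g x₀ z)⁻¹ c d *
    (partialDeriv (coordDomain T x₀) a (fun y => metricCoord g x₀ y b d) z
      + partialDeriv (coordDomain T x₀) b (fun y => metricCoord g x₀ y a d) z
      - partialDeriv (coordDomain T x₀) d (fun y => metricCoord g x₀ y a b) z)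

/-- `∇_a V_b = ∂_a V_b - Γᶜ_{ab} V_c`. -/
def covDeriv (T : ℝ) (g : MetricField n X) (V : CovectorField n X) (x₀ : X) (z : Vec n)
    (a b : Fin (n + 2)) : ℝ :=
  partialDeriv (coordDomain T x₀) a (fun y => covectorCoord V x₀ y b) z
    - ∑ c, christoffel T g x₀ z c a b * covectorCoord V x₀ z c

/-- `gᵃᵇ ∇_a V_b`. -/
def divCoord (T : ℝ) (g : MetricField n X) (V : CovectorField n X) (x₀ : X) (z : Vec n) : ℝ :=
  ∑ a, ∑ b, (metricMatrix g x₀ z)⁻¹ a b * covDeriv T g V x₀ z a b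

/-- The Lie derivative `(£_u V)_b = uᵃ ∂_a V_b + V_a ∂_b uᵃ`. -/
def lieCoord (T : ℝ) (u : VectorField n X) (V : CovectorField n X) (x₀ : X) (z : Vec n)
    (b : Fin (n + 2)) : ℝ :=
  ∑ a, (vectorCoord u x₀ z a *
      partialDeriv (coordDomain T x₀) a (fun y => covectorCoord V x₀ y b) z
    + covectorCoord V x₀ z a *
      partialDeriv (coordDomain T x₀) b (fun y => vectorCoord u x₀ y a) z)

/-! ### The initial-boundary value problem -/

/-- `V` is a solution of class `C¹` on `M = [0, T] × X` of the first order reduced problem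
* `gᵃᵇ ∇_a V_b = F` and `£_u V_b = ∇_b Π`, where `Π = uᵃ V_a`, on `M`,
* `nᵇ V_b = π₀` and `ι₀^* V = dφ₀` on `Σ₀`,
* `Tᵇ V_b + α Nᵇ V_b = G` on the lateral boundary (the vector field `Tᵇ` is called `τ`). -/
structure IsReducedSolution [IsManifold (𝓡∂ (n + 1)) ∞ X] (T : ℝ) (g : MetricField n X)
    (u τ : VectorField n X) (α : ℝ × X → ℝ) (F : ℝ × X → ℝ) (φ₀ π₀ : X → ℝ) (G : ℝ × X → ℝ)
    (V : CovectorField n X) : Prop where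
  smooth : V.SmoothOn 1 (slab X T)
  divergence_eq : ∀ x₀ : X, ∀ z ∈ coordDomain (n := n) T x₀,
    divCoord T g V x₀ z = F (chartParam x₀ z)
  lie_eq : ∀ x₀ : X, ∀ z ∈ coordDomain (n := n) T x₀, ∀ b : Fin (n + 2),
    lieCoord T u V x₀ z b = partialDeriv (coordDomain T x₀) b
      (fun y => V (chartParam x₀ y) (u (chartParam x₀ y))) z
  initial_differentiable : MDifferentiable (𝓡∂ (n + 1)) 𝓘(ℝ, ℝ) φ₀
  initial_normal : ∀ x : X, V (0, x) (sliceNormal g (0, x)) = π₀ x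
  initial_tangential : ∀ (x : X) (ξ : EuclideanSpace ℝ (Fin (n + 1))),
    V (0, x) ((0, ξ) : Vec n) = mfderiv (𝓡∂ (n + 1)) 𝓘(ℝ, ℝ) φ₀ x ξ
  boundary : ∀ p ∈ lateral n X T,
    V p (τ p) + α p * V p (lateralNormal g p) = G p

/-! ### Volume measures

The measure induced by `g` on a hypersurface is `√|det|` of the Gram matrix of the coordinate
vectors tangent to it times Lebesgue measure in each coordinate system. These local measures agree
on overlaps, so that their supremum is the measure which extends all of them. -/

/-- The density of the measure induced by `g` on the hypersurface on which the `k`-th coordinate is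
constant, in the remaining coordinates. -/
def hypersurfaceDensity (g : MetricField n X) (x₀ : X) (k : Fin (n + 2)) (z : Vec n) : ℝ :=
  Real.sqrt |((metricMatrix g x₀ z).submatrix k.succAbove k.succAbove).det|

/-- The inclusion `(x¹, …, xⁿ) ↦ (0, x¹, …, xⁿ)` of the boundary of the half space. -/
def boundaryIncl (n : ℕ) (y : EuclideanSpace ℝ (Fin n)) : EuclideanSpace ℝ (Fin (n + 1)) :=
  WithLp.toLp 2 (Fin.cons 0 (fun i => y i))

/-- The volume measure on `X ≅ Σ_s = {s} × X` induced by `g`. -/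
def sliceVolume [MeasurableSpace X] (g : MetricField n X) (s : ℝ) : Measure X :=
  ⨆ x₀ : X, Measure.map (extChartAt (𝓡∂ (n + 1)) x₀).symm
    ((volume.restrict (extChartAt (𝓡∂ (n + 1)) x₀).target).withDensity
      (fun y => ENNReal.ofReal (hypersurfaceDensity g x₀ 0 (s, y))))

/-- The volume measure on `𝒯_t = [0, t] × ∂X` induced by `g`, as a measure on `ℝ × X`. -/
def lateralVolume [MeasurableSpace X] (g : MetricField n X) (t : ℝ) : Measure (ℝ × X) :=
  ⨆ x₀ : X, Measure.map
    (fun q : ℝ × EuclideanSpace ℝ (Fin n) => chartParam (n := n) x₀ (q.1, boundaryIncl n q.2))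
    ((volume.restrict {q : ℝ × EuclideanSpace ℝ (Fin n) |
        q.1 ∈ Icc 0 t ∧ boundaryIncl n q.2 ∈ (extChartAt (𝓡∂ (n + 1)) x₀).target}).withDensity
      (fun q => ENNReal.ofReal (hypersurfaceDensity g x₀ 1 (q.1, boundaryIncl n q.2))))

/-- `∫_{Σ_t} n_a 𝒜ᵃ_{bc} Vᵇ Vᶜ`. -/
def sliceEnergy [MeasurableSpace X] (g : MetricField n X) (u : VectorField n X)
    (V : CovectorField n X) (t : ℝ) : ℝ :=
  ∫ x, energyDensity (n := n) (g (t, x)) (u (t, x)) (V (t, x)) ∂(sliceVolume g t)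

/-- `∫_{𝒯_t} n_a 𝒜ᵃ_{bc} Vᵇ Vᶜ`. -/
def lateralEnergy [MeasurableSpace X] (g : MetricField n X) (u : VectorField n X)
    (V : CovectorField n X) (t : ℝ) : ℝ :=
  ∫ p, energyDensity (n := n) (g p) (u p) (V p) ∂(lateralVolume g t)

end Manifold

end BoundaryWave

end

open scoped Topology

noncomputable section

namespace BoundaryWave

/-! ### Lorentz forms -/

theorem IsLorentzForm.pos_of_orthogonal {n : ℕ} {B : BilForm n} (hB : IsLorentzForm B)
    {τ w : Vec n} (hτ : B τ τ < 0) (hw : B τ w = 0) (hne : w ≠ 0) : 0 < B w w := by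
  obtain ⟨hsymm, v₀, -, hp⟩ := hB
  by_contra! h
  set x := (B v₀ w) • τ + (-(B v₀ τ)) • w with hx
  have h1 : B v₀ x = 0 := by
    simp only [hx, map_add, map_smul, smul_eq_mul]; ring
  have h2 : B x x = (B v₀ w) ^ 2 * B τ τ + (B v₀ τ) ^ 2 * B w w := by
    simp only [hx, map_add, map_smul, add_apply, smul_apply, smul_eq_mul]
    rw [hsymm w τ, hw]
    ring
  have h4 : x = 0 := by
    by_contra hx0
    have h3 := hp x h1 hx0
    nlinarith [mul_nonneg (sq_nonneg (B v₀ w)) (neg_nonneg.2 hτ.le),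
      mul_nonneg (sq_nonneg (B v₀ τ)) (neg_nonneg.2 h)]
  have h5 : B v₀ w = 0 := by
    have : B τ x = 0 := by rw [h4, map_zero]
    simp only [hx, map_add, map_smul, smul_eq_mul, hw] at this
    simpa [hτ.ne] using this
  exact absurd (hp w h5 hne) (not_lt.2 h)

theorem IsLorentzForm.injective {n : ℕ} {B : BilForm n} (hB : IsLorentzForm B) :
    Function.Injective B := by
  obtain ⟨hsymm, v₀, -, hp⟩ := hB
  rw [injective_iff_map_eq_zero]
  intro x hx
  by_contra hne
  have h2 := hp x (by rw [hsymm, hx]; rfl) hne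
  rw [hx] at h2
  exact lt_irrefl _ h2

/-- The dominant energy condition. -/
theorem IsLorentzForm.symbol_pos {n : ℕ} {B : BilForm n} (hB : IsLorentzForm B) {ν u v : Vec n}
    (hν : B ν ν < 0) (hu : B u u < 0) (hνu : B ν u < 0) (hv : v ≠ 0) :
    0 < symbol B u (B ν) v v := by
  set y := (-(B ν u)) • v + (B ν v) • u with hy
  have h1 : B ν y = 0 := by
    simp only [hy, map_add, map_smul, smul_eq_mul]; ring
  have h2 : -(B ν u) * symbol B u (B ν) v v = B y y + (B ν v) ^ 2 * -(B u u) := by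
    simp only [hy, symbol, map_add, map_smul, add_apply, smul_apply, smul_eq_mul]
    rw [hB.1 v u]
    ring
  have h3 : 0 < B y y + (B ν v) ^ 2 * -(B u u) := by
    by_cases hy0 : y = 0
    · have ha : B ν v ≠ 0 := by
        intro ha
        rw [ha, zero_smul, add_zero, hy0] at hy
        rcases smul_eq_zero.1 hy.symm with h | h
        · exact hνu.ne (neg_eq_zero.1 h)
        · exact hv h
      have : 0 < (B ν v) ^ 2 * -(B u u) := mul_pos (by positivity) (by linarith)
      rw [hy0]; simpa using this
    · have := hB.pos_of_orthogonal hν h1 hy0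
      have : 0 ≤ (B ν v) ^ 2 * -(B u u) := mul_nonneg (sq_nonneg _) (by linarith)
      linarith
  rw [← h2] at h3
  exact pos_of_mul_pos_right h3 (by linarith)

/-- The homogeneous boundary condition makes the energy flux through the boundary negative. -/
theorem IsLorentzForm.symbol_neg_of_boundary {n : ℕ} {B : BilForm n} (hB : IsLorentzForm B)
    {τ N v : Vec n} (hτ : B τ τ = -1) (hN : B N N = 1) (hNτ : B N τ = 0) {α ρ : ℝ} (hα : 0 < α)
    (hρ : 0 < ρ) (hρ' : ρ < 1) (hv : v ≠ 0) (hbc : B v τ + α * B v N = 0) :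
    symbol B (τ + ((1 - ρ) * (α / (1 + α ^ 2))) • N) (B N) v v < 0 := by
  have hδ : 0 < (1 - ρ) * (α / (1 + α ^ 2)) := mul_pos (by linarith) (by positivity)
  have hδ' : (1 - ρ) * (α / (1 + α ^ 2)) * (1 + α ^ 2) = (1 - ρ) * α := by field_simp
  set δ := (1 - ρ) * (α / (1 + α ^ 2))
  have hs := hB.1
  rw [hs v τ, hs v N] at hbc
  set x := v + (B τ v) • τ + (-(B N v)) • N with hx
  have hτN : B τ N = 0 := by rw [hs, hNτ]
  have h1 : B τ x = 0 := by
    simp only [hx, map_add, map_smul, smul_eq_mul, hτ, hτN]; ring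
  have h2 : symbol B (τ + δ • N) (B N) v v = -δ * B x x - (1 + ρ) * α * (B N v) ^ 2 := by
    simp only [hx, symbol, map_add, map_smul, add_apply, smul_apply, smul_eq_mul, hτ, hτN, hN, hNτ,
      hs v τ, hs v N]
    have ha : B τ v = -α * B N v := by linarith
    rw [ha]
    linear_combination (B N v) ^ 2 * hδ'
  rw [h2]
  by_cases hx0 : x = 0
  · have hb : B N v ≠ 0 := by
      intro hb
      have ha : B τ v = 0 := by rw [hb] at hbc; linarith
      rw [ha, hb, zero_smul, neg_zero, zero_smul, add_zero, add_zero, hx0] at hx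
      exact hv hx.symm
    have : 0 < (1 + ρ) * α * (B N v) ^ 2 := by positivity
    rw [hx0]; simp; linarith
  · have := mul_pos hδ (hB.pos_of_orthogonal (by rw [hτ]; norm_num) h1 hx0)
    have : 0 ≤ (1 + ρ) * α * (B N v) ^ 2 := by positivity
    linarith

/-! ### Components with respect to a frame -/

/-- The vector with prescribed components. -/
def ofComp {n : ℕ} (x : Fin (n + 2) → ℝ) : Vec n := (x 0, WithLp.toLp 2 (fun i => x i.succ))

theorem comp_ofComp {n : ℕ} (x : Fin (n + 2) → ℝ) : comp (ofComp x) = x := by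
  funext a
  refine Fin.cases rfl (fun i => rfl) a

theorem ofComp_comp {n : ℕ} (v : Vec n) : ofComp (comp v) = v := by
  refine Prod.ext rfl ?_
  ext i
  rfl

theorem comp_zero_eq {n : ℕ} (v : Vec n) : comp v 0 = v.1 := rfl

theorem comp_one_eq {n : ℕ} (v : Vec n) : comp v 1 = v.2 0 := rfl

theorem stdVec_zero (n : ℕ) : stdVec n 0 = (1, 0) := rfl

theorem stdVec_succ (n : ℕ) (i : Fin (n + 1)) :
    stdVec n i.succ = (0, EuclideanSpace.single i 1) := rfl

theorem ofComp_eq_sum {n : ℕ} (x : Fin (n + 2) → ℝ) : ofComp x = ∑ a, x a • stdVec n a := by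
  rw [Fin.sum_univ_succ]
  refine Prod.ext ?_ ?_
  · simp [ofComp, stdVec_zero, stdVec_succ, Prod.fst_sum]
  · simp only [ofComp, stdVec_zero, stdVec_succ, Prod.snd_add, Prod.smul_snd, Prod.snd_sum,
      smul_zero, zero_add]
    ext i
    simp [Finset.sum_apply, Pi.single_apply]

theorem comp_add {n : ℕ} (v w : Vec n) : comp (v + w) = comp v + comp w := by
  funext a
  refine Fin.cases rfl (fun i => rfl) a

theorem comp_smul {n : ℕ} (c : ℝ) (v : Vec n) : comp (c • v) = c • comp v := by
  funext a
  refine Fin.cases rfl (fun i => rfl) a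

theorem comp_stdVec {n : ℕ} (a b : Fin (n + 2)) : comp (stdVec n a) b = if a = b then 1 else 0 := by
  have : stdVec n a = ofComp (Pi.single a 1) := by
    rw [ofComp_eq_sum, Finset.sum_eq_single a] <;> simp +contextual
  rw [this, comp_ofComp, Pi.single_apply]
  simp [eq_comm]

/-- The Gram matrix of a bilinear form in the frame `A e_a`. -/
def gram {n : ℕ} (B : BilForm n) (A : Vec n →L[ℝ] Vec n) : Matrix (Fin (n + 2)) (Fin (n + 2)) ℝ :=
  Matrix.of fun a b => B (A (stdVec n a)) (A (stdVec n b))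

/-- The components of a covector in the frame `A e_a`. -/
def covComp {n : ℕ} (A : Vec n →L[ℝ] Vec n) (η : Vec n →L[ℝ] ℝ) (a : Fin (n + 2)) : ℝ :=
  η (A (stdVec n a))

/-- The components of the current `𝒜ᵃ_{bc} ξᵇ ξᶜ` in terms of the inverse metric. -/
def current {m : ℕ} (H : Matrix (Fin m) (Fin m) ℝ) (u ξ : Fin m → ℝ) (a : Fin m) : ℝ :=
  -u a * (ξ ⬝ᵥ H *ᵥ ξ) + 2 * (H *ᵥ ξ) a * (u ⬝ᵥ ξ)

section Frame

variable {n : ℕ} {B : BilForm n} {A : Vec n →L[ℝ] Vec n}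

theorem apply_inverse (hA : A.IsInvertible) (v : Vec n) : A (A.inverse v) = v := by
  obtain ⟨e, rfl⟩ := hA
  simp

theorem inverse_apply (hA : A.IsInvertible) (v : Vec n) : A.inverse (A v) = v := by
  obtain ⟨e, rfl⟩ := hA
  simp

theorem apply_eq_covComp (hA : A.IsInvertible) (η : Vec n →L[ℝ] ℝ) (v : Vec n) :
    η v = comp (A.inverse v) ⬝ᵥ covComp A η := by
  conv_lhs => rw [← apply_inverse hA v, ← ofComp_comp (A.inverse v), ofComp_eq_sum]
  simp [dotProduct, covComp]

theorem gram_mulVec_comp (hA : A.IsInvertible) (hs : ∀ v w, B v w = B w v) (v : Vec n) :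
    gram B A *ᵥ comp (A.inverse v) = covComp A (B v) := by
  funext a
  rw [covComp, hs, apply_eq_covComp hA (B (A (stdVec n a))) v, dotProduct_comm]
  rfl

theorem isUnit_det_gram (hA : A.IsInvertible) (hB : IsLorentzForm B) :
    IsUnit (gram B A).det := by
  rw [← Matrix.isUnit_iff_isUnit_det, ← Matrix.mulVec_injective_iff_isUnit]
  rw [← Matrix.coe_mulVecLin, injective_iff_map_eq_zero]
  intro x hx
  have h1 := gram_mulVec_comp hA hB.1 (A (ofComp x))
  rw [inverse_apply hA, comp_ofComp] at h1
  rw [Matrix.coe_mulVecLin] at hx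
  rw [hx] at h1
  have h2 : B (A (ofComp x)) = 0 := by
    refine ContinuousLinearMap.ext fun w => ?_
    rw [apply_eq_covComp hA, ← h1]
    simp
  have h3 := hB.injective (h2.trans (map_zero B).symm)
  have h4 : ofComp x = 0 := by rw [← inverse_apply hA (ofComp x), h3, map_zero]
  rw [← comp_ofComp x, h4]
  funext a
  refine Fin.cases rfl (fun i => rfl) a

theorem comp_inverse_eq (hA : A.IsInvertible) (hB : IsLorentzForm B) (v : Vec n) :
    comp (A.inverse v) = (gram B A)⁻¹ *ᵥ covComp A (B v) := by
  rw [← gram_mulVec_comp hA hB.1, Matrix.mulVec_mulVec, Matrix.nonsing_inv_mul _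
    (isUnit_det_gram hA hB), Matrix.one_mulVec]

theorem comp_sharp (hA : A.IsInvertible) (hB : IsLorentzForm B) (η : Vec n →L[ℝ] ℝ) :
    comp (A.inverse (sharp B η)) = (gram B A)⁻¹ *ᵥ covComp A η := by
  rw [comp_inverse_eq hA hB, hB.apply_sharp]

theorem gram_inv_symm (hB : IsLorentzForm B) : ((gram B A)⁻¹)ᵀ = (gram B A)⁻¹ := by
  rw [Matrix.transpose_nonsing_inv]
  congr 1
  ext a b
  exact hB.1 _ _

theorem symbol_sharp (hA : A.IsInvertible) (hB : IsLorentzForm B) (u : Vec n)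
    (η w : Vec n →L[ℝ] ℝ) (a : Fin (n + 2)) (c : ℝ) (hw : ∀ v, w v = c * comp (A.inverse v) a) :
    symbol B u w (sharp B η) (sharp B η) =
      c * current (gram B A)⁻¹ (comp (A.inverse u)) (covComp A η) a := by
  have h1 : B (sharp B η) (sharp B η) = covComp A η ⬝ᵥ (gram B A)⁻¹ *ᵥ covComp A η := by
    conv_lhs => rw [hB.apply_sharp, apply_eq_covComp hA, comp_sharp hA hB, dotProduct_comm]
  have h2 : B u (sharp B η) = comp (A.inverse u) ⬝ᵥ covComp A η := by
    rw [hB.1, hB.apply_sharp, apply_eq_covComp hA]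
  rw [symbol, h1, h2, hw, hw, comp_sharp hA hB, current]
  ring

/-- A covector is determined by its components, which are arbitrary. -/
theorem exists_covComp_eq (hA : A.IsInvertible) (ξ : Fin (n + 2) → ℝ) :
    ∃ η : Vec n →L[ℝ] ℝ, covComp A η = ξ := by
  let l : Vec n →ₗ[ℝ] ℝ :=
    { toFun := fun v => comp (A.inverse v) ⬝ᵥ ξ
      map_add' := fun v w => by simp [comp_add, add_dotProduct]
      map_smul' := fun c v => by simp [comp_smul, smul_dotProduct] }
  refine ⟨LinearMap.toContinuousLinearMap l, ?_⟩
  funext a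
  change comp (A.inverse (A (stdVec n a))) ⬝ᵥ ξ = ξ a
  rw [inverse_apply hA]
  simp [dotProduct, comp_stdVec]

theorem fst_inverse (hA : A.IsInvertible) (hA0 : ∀ v, (A v).1 = v.1) (v : Vec n) :
    (A.inverse v).1 = v.1 := by rw [← hA0, apply_inverse hA]

theorem covComp_dtForm (hA0 : ∀ v, (A v).1 = v.1) : covComp A (dtForm n) = Pi.single 0 1 := by
  funext a
  change (A (stdVec n a)).1 = _
  rw [hA0, ← comp_zero_eq, comp_stdVec, Pi.single_apply]

theorem sharp_dtForm_fst (hA : A.IsInvertible) (hA0 : ∀ v, (A v).1 = v.1)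
    (hB : IsLorentzForm B) : (sharp B (dtForm n)).1 = (gram B A)⁻¹ 0 0 := by
  rw [← fst_inverse hA hA0, ← comp_zero_eq, comp_sharp hA hB, covComp_dtForm hA0]
  simp

theorem futureNormal_lower (hA : A.IsInvertible) (hA0 : ∀ v, (A v).1 = v.1)
    (hB : IsLorentzForm B) (v : Vec n) :
    B (futureNormal B) v = -(Real.sqrt (-(gram B A)⁻¹ 0 0))⁻¹ * v.1 := by
  rw [futureNormal, sharp_dtForm_fst hA hA0 hB]
  simp only [map_neg, map_smul, neg_apply, smul_apply, smul_eq_mul, neg_smul, hB.apply_sharp]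
  rw [neg_mul]
  rfl

theorem gram_inv_zero_neg (hA : A.IsInvertible) (hA0 : ∀ v, (A v).1 = v.1)
    (hB : IsLorentzForm B)
    (hs : ∀ ξ : EuclideanSpace ℝ (Fin (n + 1)), ξ ≠ 0 → 0 < B (0, ξ) (0, ξ)) :
    (gram B A)⁻¹ 0 0 < 0 := by
  obtain ⟨h1, h2, -⟩ := futureNormal_spec hB hs
  rw [futureNormal_lower hA hA0 hB] at h1
  by_contra! h
  rw [Real.sqrt_eq_zero'.2 (by linarith)] at h1
  simp at h1

theorem energyDensity_eq_current (hA : A.IsInvertible) (hA0 : ∀ v, (A v).1 = v.1)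
    (hB : IsLorentzForm B) (u : Vec n) (η : Vec n →L[ℝ] ℝ) :
    energyDensity B u η = -(Real.sqrt (-(gram B A)⁻¹ 0 0))⁻¹ *
      current (gram B A)⁻¹ (comp (A.inverse u)) (covComp A η) 0 := by
  refine symbol_sharp hA hB u η _ 0 _ fun v => ?_
  rw [futureNormal_lower hA hA0 hB, comp_zero_eq, fst_inverse hA hA0]

theorem sharp_ne_zero (hB : IsLorentzForm B) {η : Vec n →L[ℝ] ℝ} (hη : η ≠ 0) :
    sharp B η ≠ 0 := by
  intro h
  apply hη
  rw [← hB.apply_sharp η, h, map_zero]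

theorem energyDensity_pos (hB : IsLorentzForm B)
    (hs : ∀ ξ : EuclideanSpace ℝ (Fin (n + 1)), ξ ≠ 0 → 0 < B (0, ξ) (0, ξ)) {u : Vec n}
    (hu : IsFutureTimelike B u) {η : Vec n →L[ℝ] ℝ} (hη : η ≠ 0) : 0 < energyDensity B u η := by
  have hI : (ContinuousLinearMap.id ℝ (Vec n)).IsInvertible :=
    ⟨ContinuousLinearEquiv.refl ℝ (Vec n), rfl⟩
  obtain ⟨h1, h2, -⟩ := futureNormal_spec hB hs
  refine hB.symbol_pos (by rw [h1]; norm_num) hu.1 ?_ (sharp_ne_zero hB hη)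
  rw [futureNormal_lower hI (fun _ => rfl) hB]
  have := gram_inv_zero_neg hI (fun _ => rfl) hB hs
  have h3 : 0 < Real.sqrt (-(gram B (ContinuousLinearMap.id ℝ (Vec n)))⁻¹ 0 0) :=
    Real.sqrt_pos.2 (by linarith)
  have := mul_pos (inv_pos.2 h3) hu.2
  linarith

theorem current_zero_neg (hA : A.IsInvertible) (hA0 : ∀ v, (A v).1 = v.1)
    (hB : IsLorentzForm B)
    (hs : ∀ ξ : EuclideanSpace ℝ (Fin (n + 1)), ξ ≠ 0 → 0 < B (0, ξ) (0, ξ)) {u : Vec n}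
    (hu : IsFutureTimelike B u) {ξ : Fin (n + 2) → ℝ} (hξ : ξ ≠ 0) :
    current (gram B A)⁻¹ (comp (A.inverse u)) ξ 0 < 0 := by
  obtain ⟨η, rfl⟩ := exists_covComp_eq hA ξ
  have hη : η ≠ 0 := by
    rintro rfl
    exact hξ (by funext a; simp [covComp])
  have h1 := energyDensity_pos hB hs hu hη
  rw [energyDensity_eq_current hA hA0 hB] at h1
  have h3 : 0 ≤ (Real.sqrt (-(gram B A)⁻¹ 0 0))⁻¹ := by positivity
  by_contra! h
  have := mul_nonneg h3 h
  linarith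

section Boundary

variable {l : ℝ}

theorem comp_one_inverse (hA : A.IsInvertible) (hA1 : ∀ v, (A v).2 0 = l * v.2 0) (v : Vec n) :
    v.2 0 = l * comp (A.inverse v) 1 := by
  rw [comp_one_eq, ← hA1, apply_inverse hA]

theorem covComp_dxForm (hA1 : ∀ v, (A v).2 0 = l * v.2 0) :
    covComp A (dxForm n) = Pi.single 1 l := by
  funext a
  change (A (stdVec n a)).2 0 = _
  rw [hA1, ← comp_one_eq, comp_stdVec, Pi.single_apply]
  split_ifs <;> simp

theorem comp_sharp_dxForm (hA : A.IsInvertible) (hA1 : ∀ v, (A v).2 0 = l * v.2 0)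
    (hB : IsLorentzForm B) (a : Fin (n + 2)) :
    comp (A.inverse (sharp B (dxForm n))) a = l * (gram B A)⁻¹ a 1 := by
  rw [comp_sharp hA hB, covComp_dxForm hA1]
  simp [mul_comm]

theorem sharp_dxForm_snd (hA : A.IsInvertible) (hA1 : ∀ v, (A v).2 0 = l * v.2 0)
    (hB : IsLorentzForm B) : (sharp B (dxForm n)).2 0 = l ^ 2 * (gram B A)⁻¹ 1 1 := by
  rw [comp_one_inverse hA hA1, comp_sharp_dxForm hA hA1 hB]
  ring

theorem comp_outwardNormal (hA : A.IsInvertible) (hA1 : ∀ v, (A v).2 0 = l * v.2 0) (hl : 0 < l)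
    (hB : IsLorentzForm B) (a : Fin (n + 2)) :
    comp (A.inverse (outwardNormal B)) a =
      -(Real.sqrt ((gram B A)⁻¹ 1 1))⁻¹ * (gram B A)⁻¹ a 1 := by
  rw [outwardNormal, map_smul, comp_smul, Pi.smul_apply, comp_sharp_dxForm hA hA1 hB,
    sharp_dxForm_snd hA hA1 hB, Real.sqrt_mul (sq_nonneg l), Real.sqrt_sq hl.le, smul_eq_mul,
    mul_inv]
  field_simp

theorem outwardNormal_lower (hA : A.IsInvertible) (hA1 : ∀ v, (A v).2 0 = l * v.2 0) (hl : 0 < l)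
    (hB : IsLorentzForm B) (v : Vec n) :
    B (outwardNormal B) v = -(Real.sqrt ((gram B A)⁻¹ 1 1))⁻¹ * comp (A.inverse v) 1 := by
  rw [outwardNormal, sharp_dxForm_snd hA hA1 hB, Real.sqrt_mul (sq_nonneg l), Real.sqrt_sq hl.le]
  simp only [map_neg, map_smul, neg_apply, smul_apply, smul_eq_mul, neg_smul, hB.apply_sharp,
    mul_inv, neg_mul]
  change -(l⁻¹ * _ * v.2 0) = _
  rw [comp_one_inverse hA hA1 v]
  field_simp

theorem gram_inv_one_pos (hA : A.IsInvertible) (hA1 : ∀ v, (A v).2 0 = l * v.2 0) (hl : 0 < l)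
    (hB : IsLorentzForm B) (hs : ∃ w : Vec n, w.2 0 = 0 ∧ B w w < 0) :
    0 < (gram B A)⁻¹ 1 1 := by
  obtain ⟨h1, h2, -⟩ := outwardNormal_spec hB hs
  rw [outwardNormal_lower hA hA1 hl hB] at h1
  by_contra! h
  rw [Real.sqrt_eq_zero'.2 h] at h1
  simp at h1

/-- The flux through the boundary is negative under the homogeneous boundary condition. -/
theorem current_one_pos (hA : A.IsInvertible) (hA1 : ∀ v, (A v).2 0 = l * v.2 0) (hl : 0 < l)
    (hB : IsLorentzForm B) (hs : ∃ w : Vec n, w.2 0 = 0 ∧ B w w < 0) {τ : Vec n}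
    (hτ : B τ τ = -1) (hτ0 : τ.2 0 = 0) {α ρ : ℝ} (hα : 0 < α) (hρ : 0 < ρ) (hρ' : ρ < 1)
    {ξ : Fin (n + 2) → ℝ} (hξ : ξ ≠ 0)
    (hbc : comp (A.inverse (τ + α • outwardNormal B)) ⬝ᵥ ξ = 0) :
    0 < current (gram B A)⁻¹
      (comp (A.inverse (τ + ((1 - ρ) * (α / (1 + α ^ 2))) • outwardNormal B))) ξ 1 := by
  obtain ⟨η, rfl⟩ := exists_covComp_eq hA ξ
  have hη : η ≠ 0 := by
    rintro rfl
    exact hξ (by funext a; simp [covComp])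
  obtain ⟨h1, h2, h3⟩ := outwardNormal_spec hB hs
  rw [← apply_eq_covComp hA] at hbc
  have h4 := hB.symbol_neg_of_boundary hτ h1 (h3 τ hτ0) hα hρ hρ' (sharp_ne_zero hB hη)
    (by rw [hB.apply_sharp, ← hbc, map_add, map_smul, smul_eq_mul])
  rw [symbol_sharp hA hB _ _ _ 1 _ (outwardNormal_lower hA hA1 hl hB)] at h4
  have h5 : 0 < (Real.sqrt ((gram B A)⁻¹ 1 1))⁻¹ :=
    inv_pos.2 (Real.sqrt_pos.2 (gram_inv_one_pos hA hA1 hl hB hs))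
  rw [neg_mul, neg_lt_zero] at h4
  exact pos_of_mul_pos_right h4 h5.le

end Boundary

end Frame

theorem det_submatrix_succAbove {m : ℕ} (G : Matrix (Fin (m + 1)) (Fin (m + 1)) ℝ)
    (hG : IsUnit G.det) (k : Fin (m + 1)) :
    (G.submatrix k.succAbove k.succAbove).det = G.det * G⁻¹ k k := by
  have h := Matrix.adjugate_fin_succ_eq_det_submatrix G k k
  rw [Even.neg_one_pow ⟨_, rfl⟩, one_mul] at h
  rw [← h, Matrix.inv_def, Matrix.smul_apply, smul_eq_mul, ← mul_assoc, Ring.mul_inverse_cancel _ hG,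
    one_mul]

/-! ### Coordinate frames and changes of coordinates -/

section Frames

variable {n : ℕ} {X : Type*} [TopologicalSpace X] [ChartedSpace (EuclideanHalfSpace (n + 1)) X]

theorem mem_range_model_iff {y : EuclideanSpace ℝ (Fin (n + 1))} :
    y ∈ range (𝓡∂ (n + 1)) ↔ 0 ≤ y 0 := by
  rw [range_modelWithCornersEuclideanHalfSpace]; rfl

theorem extChartAt_apply_zero_nonneg (x₀ x : X) : 0 ≤ (extChartAt (𝓡∂ (n + 1)) x₀ x) 0 :=
  mem_range_model_iff.1 (mem_range_self _)

theorem mem_target_prod_iff {x₀ : X} {t₀ : ℝ} {z : Vec n} :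
    z ∈ (extChartAt (stModel n) (t₀, x₀)).target ↔ z.2 ∈ (extChartAt (𝓡∂ (n + 1)) x₀).target := by
  rw [extChartAt_prod, extChartAt_model_space_eq_id]
  simp [PartialEquiv.prod_target]

theorem range_stModel :
    range (stModel n) = (univ : Set ℝ) ×ˢ range (𝓡∂ (n + 1)) := by
  rw [ModelWithCorners.range_prod]
  simp

theorem chartParam_mem_slab {T : ℝ} {x₀ : X} {z : Vec n} (hz : z ∈ coordDomain T x₀) :
    chartParam x₀ z ∈ slab X T := ⟨hz.1, mem_univ _⟩

theorem vectorCoord_eq_comp (u : VectorField n X) (x₀ : X) (z : Vec n) :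
    vectorCoord u x₀ z = comp ((coordFrame x₀ z).inverse (u (chartParam x₀ z))) := rfl

variable [IsManifold (𝓡∂ (n + 1)) ∞ X]

instance isManifold_one : IsManifold (𝓡∂ (n + 1)) 1 X :=
  IsManifold.of_le (n := ∞) (by exact_mod_cast le_top)

theorem tangentCoordChange_leftInverse {x₀ x₁ x : X}
    (h₀ : x ∈ (extChartAt (𝓡∂ (n + 1)) x₀).source) (h₁ : x ∈ (extChartAt (𝓡∂ (n + 1)) x₁).source)
    (v : EuclideanSpace ℝ (Fin (n + 1))) :
    tangentCoordChange (𝓡∂ (n + 1)) x₁ x₀ x (tangentCoordChange (𝓡∂ (n + 1)) x₀ x₁ x v) = v := by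
  rw [tangentCoordChange_comp ⟨⟨h₀, h₁⟩, h₀⟩, tangentCoordChange_self h₀]

theorem coordFrame_apply {x₀ : X} {z : Vec n}
    (hz : z.2 ∈ (extChartAt (𝓡∂ (n + 1)) x₀).target) (v : Vec n) :
    coordFrame x₀ z v = (v.1, tangentCoordChange (𝓡∂ (n + 1)) x₀
      ((extChartAt (𝓡∂ (n + 1)) x₀).symm z.2) ((extChartAt (𝓡∂ (n + 1)) x₀).symm z.2) v.2) := by
  set x := (extChartAt (𝓡∂ (n + 1)) x₀).symm z.2 with hx
  have hxs : x ∈ (extChartAt (𝓡∂ (n + 1)) x₀).source := (extChartAt _ x₀).map_target hz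
  have hdiff : MDifferentiableWithinAt 𝓘(ℝ, Vec n) (stModel n) (chartParam (n := n) x₀)
      (univ ×ˢ range (𝓡∂ (n + 1))) z := by
    rw [← range_stModel]
    exact mdifferentiableWithinAt_extChartAt_symm (x := ((0 : ℝ), x₀))
      (mem_target_prod_iff.2 hz)
  have h1 := hdiff.hasMFDerivWithinAt
  have h2 := (hasFDerivWithinAt_tangentCoordChange (I := 𝓡∂ (n + 1))
    (x := x₀) (y := x) (z := x) ⟨hxs, mem_extChartAt_source x⟩)
  rw [hx, (extChartAt _ x₀).right_inv hz, ← hx] at h2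
  have h3 : HasFDerivWithinAt (fun w : Vec n => ((id w.1, ((extChartAt (𝓡∂ (n + 1)) x) ∘
      (extChartAt (𝓡∂ (n + 1)) x₀).symm) w.2) : Vec n))
      (((ContinuousLinearMap.id ℝ ℝ).prodMap (tangentCoordChange (𝓡∂ (n + 1)) x₀ x x)))
      (univ ×ˢ range (𝓡∂ (n + 1))) z :=
    ((hasFDerivWithinAt_id z.1 univ).comp z hasFDerivWithinAt_fst fun _ _ => mem_univ _).prodMk
      (h2.comp z hasFDerivWithinAt_snd fun _ hw => hw.2)
  have h4 := h1.2
  have hu : UniqueDiffWithinAt ℝ ((univ : Set ℝ) ×ˢ range (𝓡∂ (n + 1))) z :=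
    (uniqueDiffWithinAt_univ).prod ((𝓡∂ (n + 1)).uniqueDiffOn _
      (extChartAt_target_subset_range x₀ hz))
  have h5 : HasFDerivWithinAt (fun w : Vec n => ((id w.1, ((extChartAt (𝓡∂ (n + 1)) x) ∘
      (extChartAt (𝓡∂ (n + 1)) x₀).symm) w.2) : Vec n)) (coordFrame x₀ z)
      (univ ×ˢ range (𝓡∂ (n + 1))) z :=
    HasFDerivWithinAt.mono h4 fun w hw => ⟨hw, mem_range_self w⟩
  rw [hu.eq h5 h3]
  rfl

theorem coordFrame_isInvertible {x₀ : X} {z : Vec n}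
    (hz : z.2 ∈ (extChartAt (𝓡∂ (n + 1)) x₀).target) :
    (coordFrame x₀ z).IsInvertible := by
  have h := isInvertible_mfderivWithin_extChartAt_symm (I := stModel n) (x := ((0 : ℝ), x₀))
    (mem_target_prod_iff.2 hz)
  rw [range_stModel] at h
  exact h

theorem coordFrame_fst {x₀ : X} {z : Vec n}
    (hz : z.2 ∈ (extChartAt (𝓡∂ (n + 1)) x₀).target) (v : Vec n) :
    (coordFrame x₀ z v).1 = v.1 := by rw [coordFrame_apply hz]

/-- The coordinate frames of two charts at the same point. -/
theorem coordFrame_change {x₀ x₁ : X} {t : ℝ} {x : X}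
    (h₀ : x ∈ (extChartAt (𝓡∂ (n + 1)) x₀).source) (h₁ : x ∈ (extChartAt (𝓡∂ (n + 1)) x₁).source)
    (v : Vec n) :
    coordFrame x₀ (t, extChartAt (𝓡∂ (n + 1)) x₀ x) v =
      coordFrame x₁ (t, extChartAt (𝓡∂ (n + 1)) x₁ x)
        (v.1, tangentCoordChange (𝓡∂ (n + 1)) x₀ x₁ x v.2) := by
  rw [coordFrame_apply ((extChartAt _ x₀).map_source h₀),
    coordFrame_apply ((extChartAt _ x₁).map_source h₁)]
  simp only [(extChartAt _ x₀).left_inv h₀, (extChartAt _ x₁).left_inv h₁]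
  rw [tangentCoordChange_comp ⟨⟨h₀, h₁⟩, mem_extChartAt_source x⟩]

theorem mem_boundary_iff {x₀ x : X} (hx : x ∈ (extChartAt (𝓡∂ (n + 1)) x₀).source) :
    x ∈ (𝓡∂ (n + 1)).boundary X ↔ (extChartAt (𝓡∂ (n + 1)) x₀ x) 0 = 0 := by
  rw [extChartAt_source] at hx
  have h : (𝓡∂ (n + 1)).IsInteriorPoint x ↔ 0 < (extChartAt (𝓡∂ (n + 1)) x₀ x) 0 := by
    rw [ModelWithCorners.isInteriorPoint_iff_of_mem_atlas (n := 1) one_ne_zero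
      (chart_mem_atlas _ x₀) hx]
    have hi : interior (range (𝓡∂ (n + 1))) = {y | 0 < y 0} :=
      interior_range_modelWithCornersEuclideanHalfSpace (n + 1)
    constructor
    · intro h
      have := interior_mono (extChartAt_target_subset_range (I := 𝓡∂ (n + 1)) x₀) h
      rw [hi] at this
      exact this
    · intro h
      refine OpenPartialHomeomorph.mem_interior_extend_target _
        ((chartAt _ x₀).map_source hx) ?_
      rw [hi]
      exact h
  change (𝓡∂ (n + 1)).IsBoundaryPoint x ↔ _
  rw [← not_iff_not, ← ModelWithCorners.isInteriorPoint_iff_not_isBoundaryPoint, h]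
  exact ⟨fun h => h.ne', fun h => lt_of_le_of_ne (extChartAt_apply_zero_nonneg _ _) (Ne.symm h)⟩

/-- At the boundary, a change of coordinates preserves the boundary hyperplane and the side. -/
theorem exists_tangentCoordChange_normal {x₀ x₁ x : X}
    (h₀ : x ∈ (extChartAt (𝓡∂ (n + 1)) x₀).source) (h₁ : x ∈ (extChartAt (𝓡∂ (n + 1)) x₁).source)
    (hb : x ∈ (𝓡∂ (n + 1)).boundary X) :
    ∃ l : ℝ, 0 < l ∧ ∀ v, (tangentCoordChange (𝓡∂ (n + 1)) x₀ x₁ x v) 0 = l * v 0 := by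
  set m := tangentCoordChange (𝓡∂ (n + 1)) x₀ x₁ x with hm
  set y := extChartAt (𝓡∂ (n + 1)) x₀ x with hy
  have hd := hasFDerivWithinAt_tangentCoordChange (I := 𝓡∂ (n + 1)) ⟨h₀, h₁⟩
  have hy0 : y 0 = 0 := (mem_boundary_iff h₀).1 hb
  set p : EuclideanSpace ℝ (Fin (n + 1)) →L[ℝ] ℝ := EuclideanSpace.proj 0
  have hd' := p.hasFDerivAt.comp_hasFDerivWithinAt _ hd
  have hmin : IsLocalMinOn (p ∘ (extChartAt (𝓡∂ (n + 1)) x₁ ∘ (extChartAt (𝓡∂ (n + 1)) x₀).symm))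
      (range (𝓡∂ (n + 1))) y := by
    refine Filter.Eventually.of_forall fun w => ?_
    have : (extChartAt (𝓡∂ (n + 1)) x₁ ((extChartAt (𝓡∂ (n + 1)) x₀).symm y)) 0 = 0 := by
      rw [hy, (extChartAt _ x₀).left_inv h₀]
      exact (mem_boundary_iff h₁).1 hb
    change (extChartAt (𝓡∂ (n + 1)) x₁ ((extChartAt (𝓡∂ (n + 1)) x₀).symm y)) 0 ≤ _
    rw [this]
    exact extChartAt_apply_zero_nonneg _ _
  have hpos : ∀ v : EuclideanSpace ℝ (Fin (n + 1)), 0 ≤ v 0 → 0 ≤ (m v) 0 := by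
    intro v hv
    refine hmin.hasFDerivWithinAt_nonneg hd' (mem_posTangentConeAt_of_segment_subset ?_)
    have hconv : Convex ℝ (range (𝓡∂ (n + 1))) := (𝓡∂ (n + 1)).convex_range
    refine hconv.segment_subset (mem_range_self _) (mem_range_model_iff.2 ?_)
    simpa [hy0] using hv
  have hzero : ∀ v : EuclideanSpace ℝ (Fin (n + 1)), v 0 = 0 → (m v) 0 = 0 := by
    intro v hv
    refine le_antisymm ?_ (hpos v hv.ge)
    have := hpos (-v) (by simp [hv])
    rw [map_neg] at this
    simpa using this
  set e : EuclideanSpace ℝ (Fin (n + 1)) := EuclideanSpace.single 0 1 with he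
  have he0 : e 0 = 1 := by simp [he]
  have hl : ∀ v, (m v) 0 = (m e) 0 * v 0 := by
    intro v
    have := hzero (v - v 0 • e) (by simp [he0])
    rw [map_sub, map_smul] at this
    simp only [PiLp.sub_apply, PiLp.smul_apply, smul_eq_mul] at this
    linarith
  refine ⟨(m e) 0, lt_of_le_of_ne (hpos e (by simp [he0])) fun h => ?_, hl⟩
  have h1 := hl (tangentCoordChange (𝓡∂ (n + 1)) x₁ x₀ x e)
  rw [hm, tangentCoordChange_leftInverse h₁ h₀, ← hm, he0, ← h, zero_mul] at h1
  exact one_ne_zero h1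

theorem exists_coordFrame_normal {x₀ : X} {z : Vec n}
    (hz : z.2 ∈ (extChartAt (𝓡∂ (n + 1)) x₀).target) (hz0 : z.2 0 = 0) :
    ∃ l : ℝ, 0 < l ∧ ∀ v, (coordFrame x₀ z v).2 0 = l * v.2 0 := by
  have hs := (extChartAt (𝓡∂ (n + 1)) x₀).map_target hz
  obtain ⟨l, hl, h⟩ := exists_tangentCoordChange_normal hs (mem_extChartAt_source _)
    ((mem_boundary_iff hs).2 (by rw [(extChartAt _ x₀).right_inv hz, hz0]))
  exact ⟨l, hl, fun v => by rw [coordFrame_apply hz, h]⟩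

theorem chartParam_mem_lateral {T : ℝ} {x₀ : X} {z : Vec n} (hz : z ∈ coordDomain T x₀)
    (hz0 : z.2 0 = 0) : chartParam x₀ z ∈ lateral n X T :=
  ⟨hz.1, (mem_boundary_iff ((extChartAt _ x₀).map_target hz.2)).2 (by
    rw [(extChartAt _ x₀).right_inv hz.2, hz0])⟩

end Frames

/-! ### Regularity of the components -/

section Regularity

variable {n : ℕ} {X : Type*} [TopologicalSpace X] [ChartedSpace (EuclideanHalfSpace (n + 1)) X]

theorem uniqueDiffOn_coordDomain {T : ℝ} (hT : 0 < T) (x₀ : X) :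
    UniqueDiffOn ℝ (coordDomain (n := n) T x₀) :=
  (uniqueDiffOn_Icc hT).prod (uniqueDiffOn_extChartAt_target x₀)

variable [IsManifold (𝓡∂ (n + 1)) ∞ X]

theorem contMDiffOn_chartParam (x₀ : X) :
    ContMDiffOn 𝓘(ℝ, Vec n) (stModel n) ∞ (chartParam (n := n) x₀)
      (univ ×ˢ (extChartAt (𝓡∂ (n + 1)) x₀).target) := by
  have h := contMDiffOn_extChartAt_symm (I := stModel n) (n := ∞) ((0 : ℝ), x₀)
  exact h.mono fun z hz => mem_target_prod_iff.2 hz.2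

theorem contMDiffOn_coordFrame (x₀ : X) (v : Vec n) :
    ContMDiffOn 𝓘(ℝ, Vec n) (stModel n).tangent ∞
      (fun z => (⟨chartParam x₀ z, coordFrame x₀ z v⟩ : TangentBundle (stModel n) (ℝ × X)))
      (univ ×ˢ (extChartAt (𝓡∂ (n + 1)) x₀).target) := by
  have hu : UniqueMDiffOn 𝓘(ℝ, Vec n)
      ((univ : Set ℝ) ×ˢ (extChartAt (𝓡∂ (n + 1)) x₀).target) :=
    (uniqueDiffOn_univ.prod (uniqueDiffOn_extChartAt_target x₀)).uniqueMDiffOn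
  have h := (contMDiffOn_chartParam (n := n) x₀).contMDiffOn_tangentMapWithin
    (m := ∞) (by simp) hu
  have hc : ContMDiffOn 𝓘(ℝ, Vec n) 𝓘(ℝ, Vec n).tangent ∞
      (fun z : Vec n => (⟨z, v⟩ : TangentBundle 𝓘(ℝ, Vec n) (Vec n)))
      ((univ : Set ℝ) ×ˢ (extChartAt (𝓡∂ (n + 1)) x₀).target) :=
    contMDiffOn_vectorSpace_iff_contDiffOn.2 contDiffOn_const
  refine (h.comp hc fun z hz => hz).congr fun z hz => ?_
  have : mfderivWithin 𝓘(ℝ, Vec n) (stModel n) (chartParam (n := n) x₀)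
      (univ ×ˢ (extChartAt (𝓡∂ (n + 1)) x₀).target) z = coordFrame x₀ z := by
    refine mfderivWithin_congr_set ?_
    rw [← nhdsWithin_eq_iff_eventuallyEq]
    rw [show z = (z.1, z.2) from rfl, nhdsWithin_prod_eq, nhdsWithin_prod_eq,
      nhdsWithin_extChartAt_target_eq_of_mem hz.2]
  simp only [tangentMapWithin, Function.comp_apply, this]
  rfl

theorem contDiffOn_metric_apply {T : ℝ} {g : MetricField n X} {k : WithTop ℕ∞}
    (hk : k ≤ ∞) (hg : g.SmoothOn k (slab X T)) (x₀ : X)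
    {v w : ∀ z : Vec n, TangentSpace (stModel n) (chartParam x₀ z)}
    (hv : ContMDiffOn 𝓘(ℝ, Vec n) (stModel n).tangent k
      (fun z => (⟨chartParam x₀ z, v z⟩ : TangentBundle (stModel n) (ℝ × X))) (coordDomain T x₀))
    (hw : ContMDiffOn 𝓘(ℝ, Vec n) (stModel n).tangent k
      (fun z => (⟨chartParam x₀ z, w z⟩ : TangentBundle (stModel n) (ℝ × X))) (coordDomain T x₀)) :
    ContDiffOn ℝ k (fun z => g (chartParam x₀ z) (v z) (w z)) (coordDomain T x₀) := by
  rw [← contMDiffOn_iff_contDiffOn]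
  have hp : ContMDiffOn 𝓘(ℝ, Vec n) (stModel n) k (chartParam (n := n) x₀) (coordDomain T x₀) :=
    ((contMDiffOn_chartParam x₀).mono fun z hz => ⟨mem_univ _, hz.2⟩).of_le hk
  have hg' := hg.comp hp fun z hz => chartParam_mem_slab hz
  intro z hz
  have : ContMDiffWithinAt 𝓘(ℝ, Vec n) ((stModel n).prod 𝓘(ℝ, ℝ)) k
      (fun m ↦ TotalSpace.mk' ℝ (E := Bundle.Trivial (ℝ × X) ℝ) (chartParam x₀ m)
        (g (chartParam x₀ m) (v m) (w m))) (coordDomain T x₀) z := by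
    apply ContMDiffWithinAt.clm_bundle_apply₂ (F₁ := Vec n) (F₂ := Vec n)
    · exact hg' z hz
    · exact hv z hz
    · exact hw z hz
  simp only [contMDiffWithinAt_totalSpace] at this
  exact this.2

theorem contDiffOn_covector_apply {T : ℝ} {V : CovectorField n X} {k : WithTop ℕ∞}
    (hk : k ≤ ∞) (hV : V.SmoothOn k (slab X T)) (x₀ : X)
    {v : ∀ z : Vec n, TangentSpace (stModel n) (chartParam x₀ z)}
    (hv : ContMDiffOn 𝓘(ℝ, Vec n) (stModel n).tangent k
      (fun z => (⟨chartParam x₀ z, v z⟩ : TangentBundle (stModel n) (ℝ × X)))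
      (coordDomain T x₀)) :
    ContDiffOn ℝ k (fun z => V (chartParam x₀ z) (v z)) (coordDomain T x₀) := by
  rw [← contMDiffOn_iff_contDiffOn]
  have hp : ContMDiffOn 𝓘(ℝ, Vec n) (stModel n) k (chartParam (n := n) x₀) (coordDomain T x₀) :=
    ((contMDiffOn_chartParam x₀).mono fun z hz => ⟨mem_univ _, hz.2⟩).of_le hk
  have hV' := hV.comp hp fun z hz => chartParam_mem_slab hz
  intro z hz
  have : ContMDiffWithinAt 𝓘(ℝ, Vec n) ((stModel n).prod 𝓘(ℝ, ℝ)) k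
      (fun m ↦ TotalSpace.mk' ℝ (E := Bundle.Trivial (ℝ × X) ℝ) (chartParam x₀ m)
        (V (chartParam x₀ m) (v m))) (coordDomain T x₀) z := by
    apply ContMDiffWithinAt.clm_bundle_apply (F₁ := Vec n)
    · exact hV' z hz
    · exact hv z hz
  simp only [contMDiffWithinAt_totalSpace] at this
  exact this.2

theorem contMDiffOn_coordFrame_coordDomain (T : ℝ) (x₀ : X) (v : Vec n) {k : WithTop ℕ∞}
    (hk : k ≤ ∞) :
    ContMDiffOn 𝓘(ℝ, Vec n) (stModel n).tangent k
      (fun z => (⟨chartParam x₀ z, coordFrame x₀ z v⟩ : TangentBundle (stModel n) (ℝ × X)))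
      (coordDomain T x₀) :=
  ((contMDiffOn_coordFrame x₀ v).mono fun _ hz => ⟨mem_univ _, hz.2⟩).of_le hk

theorem contDiffOn_covectorCoord {T : ℝ} {V : CovectorField n X} {k : WithTop ℕ∞}
    (hk : k ≤ ∞) (hV : V.SmoothOn k (slab X T)) (x₀ : X) (a : Fin (n + 2)) :
    ContDiffOn ℝ k (fun z => covectorCoord V x₀ z a) (coordDomain T x₀) :=
  contDiffOn_covector_apply hk hV x₀ (contMDiffOn_coordFrame_coordDomain T x₀ _ hk)

theorem contDiffOn_metricCoord {T : ℝ} {g : MetricField n X} (hg : IsSlabMetric T g) (x₀ : X)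
    (a b : Fin (n + 2)) :
    ContDiffOn ℝ ∞ (fun z => metricCoord g x₀ z a b) (coordDomain T x₀) :=
  contDiffOn_metric_apply le_rfl hg.smooth x₀ (contMDiffOn_coordFrame_coordDomain T x₀ _ le_rfl)
    (contMDiffOn_coordFrame_coordDomain T x₀ _ le_rfl)

theorem contDiffOn_det {E : Type*} [NormedAddCommGroup E] [NormedSpace ℝ E] {k : WithTop ℕ∞}
    {m : ℕ} {M : E → Matrix (Fin m) (Fin m) ℝ} {s : Set E}
    (hM : ∀ a b, ContDiffOn ℝ k (fun z => M z a b) s) : ContDiffOn ℝ k (fun z => (M z).det) s := by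
  simp only [Matrix.det_apply']
  refine ContDiffOn.sum fun σ _ => contDiffOn_const.mul (contDiffOn_prod fun i _ => hM _ _)

theorem isUnit_det_metricMatrix {T : ℝ} {g : MetricField n X} (hg : IsSlabMetric T g) {x₀ : X}
    {z : Vec n} (hz : z ∈ coordDomain T x₀) : IsUnit (metricMatrix g x₀ z).det :=
  isUnit_det_gram (coordFrame_isInvertible hz.2) (hg.lorentz _ (chartParam_mem_slab hz))

theorem contDiffOn_det_metricMatrix {T : ℝ} {g : MetricField n X} (hg : IsSlabMetric T g)
    (x₀ : X) : ContDiffOn ℝ ∞ (fun z => (metricMatrix g x₀ z).det) (coordDomain T x₀) :=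
  contDiffOn_det (contDiffOn_metricCoord hg x₀)

theorem contDiffOn_inv_metricMatrix {T : ℝ} {g : MetricField n X} (hg : IsSlabMetric T g) (x₀ : X)
    (a b : Fin (n + 2)) :
    ContDiffOn ℝ ∞ (fun z => (metricMatrix g x₀ z)⁻¹ a b) (coordDomain T x₀) := by
  simp only [Matrix.inv_def, Matrix.smul_apply, Matrix.adjugate_fin_succ_eq_det_submatrix,
    Ring.inverse_eq_inv', smul_eq_mul]
  refine ((contDiffOn_det_metricMatrix hg x₀).inv
    fun z hz => (isUnit_det_metricMatrix hg hz).ne_zero).mul (contDiffOn_const.mul ?_)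
  exact contDiffOn_det fun c d => contDiffOn_metricCoord hg x₀ _ _

/-- The volume element `√|det g|` in coordinates. -/
def volumeElement (g : MetricField n X) (x₀ : X) (z : Vec n) : ℝ :=
  Real.sqrt |(metricMatrix g x₀ z).det|

theorem volumeElement_pos {T : ℝ} {g : MetricField n X} (hg : IsSlabMetric T g) {x₀ : X}
    {z : Vec n} (hz : z ∈ coordDomain T x₀) : 0 < volumeElement g x₀ z :=
  Real.sqrt_pos.2 (abs_pos.2 (isUnit_det_metricMatrix hg hz).ne_zero)

theorem contDiffOn_volumeElement {T : ℝ} {g : MetricField n X} (hg : IsSlabMetric T g) (x₀ : X) :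
    ContDiffOn ℝ ∞ (volumeElement g x₀) (coordDomain T x₀) := by
  intro z hz
  have h := (isUnit_det_metricMatrix hg hz).ne_zero
  have h1 : ContDiffAt ℝ ∞ (fun r : ℝ => Real.sqrt |r|) (metricMatrix g x₀ z).det :=
    (contDiffAt_abs h).sqrt (abs_ne_zero.2 h)
  exact ContDiffAt.comp_contDiffWithinAt (g := fun r : ℝ => Real.sqrt |r|)
    (f := fun z => (metricMatrix g x₀ z).det) z h1 (contDiffOn_det_metricMatrix hg x₀ z hz)

theorem vectorCoord_eq_mulVec {T : ℝ} {g : MetricField n X} (hg : IsSlabMetric T g)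
    (u : VectorField n X) {x₀ : X} {z : Vec n} (hz : z ∈ coordDomain T x₀) :
    vectorCoord u x₀ z = (metricMatrix g x₀ z)⁻¹ *ᵥ
      fun a => g (chartParam x₀ z) (u (chartParam x₀ z)) (coordFrame x₀ z (stdVec n a)) :=
  comp_inverse_eq (coordFrame_isInvertible hz.2) (hg.lorentz _ (chartParam_mem_slab hz)) _

theorem contDiffOn_vectorCoord {T : ℝ} {g : MetricField n X} (hg : IsSlabMetric T g)
    {u : VectorField n X} (hu : u.SmoothOn ∞ (slab X T)) (x₀ : X) (a : Fin (n + 2)) :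
    ContDiffOn ℝ ∞ (fun z => vectorCoord u x₀ z a) (coordDomain T x₀) := by
  have hp : ContMDiffOn 𝓘(ℝ, Vec n) (stModel n) ∞ (chartParam (n := n) x₀) (coordDomain T x₀) :=
    (contMDiffOn_chartParam x₀).mono fun z hz => ⟨mem_univ _, hz.2⟩
  have hu' := hu.comp hp fun z hz => chartParam_mem_slab hz
  have h : ContDiffOn ℝ ∞ (fun z => ∑ b, (metricMatrix g x₀ z)⁻¹ a b *
      g (chartParam x₀ z) (u (chartParam x₀ z)) (coordFrame x₀ z (stdVec n b)))
      (coordDomain T x₀) :=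
    ContDiffOn.sum fun b _ => (contDiffOn_inv_metricMatrix hg x₀ a b).mul
      (contDiffOn_metric_apply le_rfl hg.smooth x₀ hu'
        (contMDiffOn_coordFrame_coordDomain T x₀ _ le_rfl))
  refine h.congr fun z hz => ?_
  rw [vectorCoord_eq_mulVec hg u hz]
  rfl

theorem covector_apply_eq (V : CovectorField n X) (u : VectorField n X) {x₀ : X}
    {z : Vec n} (hz : z.2 ∈ (extChartAt (𝓡∂ (n + 1)) x₀).target) :
    V (chartParam x₀ z) (u (chartParam x₀ z)) = vectorCoord u x₀ z ⬝ᵥ covectorCoord V x₀ z :=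
  apply_eq_covComp (coordFrame_isInvertible hz) _ _

theorem hypersurfaceDensity_eq {T : ℝ} {g : MetricField n X} (hg : IsSlabMetric T g) {x₀ : X}
    (k : Fin (n + 2)) {z : Vec n} (hz : z ∈ coordDomain T x₀) :
    hypersurfaceDensity g x₀ k z =
      volumeElement g x₀ z * Real.sqrt |(metricMatrix g x₀ z)⁻¹ k k| := by
  rw [hypersurfaceDensity, det_submatrix_succAbove _ (isUnit_det_metricMatrix hg hz), abs_mul,
    Real.sqrt_mul (abs_nonneg _)]
  rfl

theorem continuousOn_hypersurfaceDensity {T : ℝ} {g : MetricField n X} (hg : IsSlabMetric T g)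
    (x₀ : X) (k : Fin (n + 2)) :
    ContinuousOn (hypersurfaceDensity g x₀ k) (coordDomain T x₀) := by
  refine (contDiffOn_det (k := ∞) (E := Vec n) (M := fun z => (metricMatrix g x₀ z).submatrix
    k.succAbove k.succAbove) fun a b => contDiffOn_metricCoord hg x₀ _ _).continuousOn.abs.sqrt

end Regularity

/-! ### Gluing of local measures -/

section Gluing

theorem measurableSet_inter_preimage {E Y : Type*} [TopologicalSpace E] [MeasurableSpace E]
    [OpensMeasurableSpace E] [TopologicalSpace Y] [MeasurableSpace Y] [BorelSpace Y] {P : E → Y} {D : Set E}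
    (hD : MeasurableSet D) (hP : ContinuousOn P D) {A : Set Y}
    (hA : MeasurableSet A) : MeasurableSet (P ⁻¹' A ∩ D) := by
  have h : P ⁻¹' A ∩ D = Subtype.val '' ((fun q : D => P q) ⁻¹' A) := by
    ext q
    simp [and_comm]
  rw [h]
  exact hD.subtype_image ((continuousOn_iff_continuous_domRestrict.1 hP).measurable hA)

variable {E Y ι : Type*} [NormedAddCommGroup E] [MeasureSpace E] [BorelSpace E]
  [TopologicalSpace Y] [MeasurableSpace Y] [BorelSpace Y]

/-- A measure given in a parametrization `P` of a subset of `Y` by the density `ρ` on `D`. -/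
def paramMeasure (P : E → Y) (D : Set E) (ρ : E → ℝ) : Measure Y :=
  Measure.map P ((volume.restrict D).withDensity fun q => ENNReal.ofReal (ρ q))

theorem aemeasurable_param {P : E → Y} {D : Set E} {ρ : E → ℝ} (hD : MeasurableSet D)
    (hP : ContinuousOn P D) :
    AEMeasurable P ((volume.restrict D).withDensity fun q => ENNReal.ofReal (ρ q)) :=
  (hP.aemeasurable hD).mono_ac (withDensity_absolutelyContinuous _ _)

theorem integral_paramMeasure {P : E → Y} {D : Set E} {ρ : E → ℝ} {f : Y → ℝ}
    (hD : MeasurableSet D) (hP : ContinuousOn P D) (hρ : ContinuousOn ρ D)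
    (hρ0 : ∀ q ∈ D, 0 ≤ ρ q) (hf : AEStronglyMeasurable f (paramMeasure P D ρ)) :
    ∫ y, f y ∂paramMeasure P D ρ = ∫ q in D, ρ q * f (P q) := by
  rw [paramMeasure, integral_map (aemeasurable_param hD hP) hf,
    integral_withDensity_eq_integral_toReal_smul₀
      (hρ.aemeasurable hD).ennreal_ofReal (Filter.Eventually.of_forall fun _ => by simp)]
  refine setIntegral_congr_fun hD fun q hq => ?_
  simp only [ENNReal.toReal_ofReal (hρ0 q hq), smul_eq_mul]

theorem integrable_paramMeasure {P : E → Y} {D : Set E} {ρ : E → ℝ} {f : Y → ℝ}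
    (hD : MeasurableSet D) (hP : ContinuousOn P D) (hρ : ContinuousOn ρ D)
    (hρ0 : ∀ q ∈ D, 0 ≤ ρ q) (hf : AEStronglyMeasurable f (paramMeasure P D ρ))
    (hi : IntegrableOn (fun q => ρ q * f (P q)) D) : Integrable f (paramMeasure P D ρ) := by
  rw [paramMeasure, integrable_map_measure hf (aemeasurable_param hD hP),
    integrable_withDensity_iff_integrable_smul₀'
      (hρ.aemeasurable hD).ennreal_ofReal (Filter.Eventually.of_forall fun _ => by simp)]
  refine IntegrableOn.congr_fun hi (fun q hq => ?_) hD
  simp only [ENNReal.toReal_ofReal (hρ0 q hq), smul_eq_mul, Function.comp_apply]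

variable [SFinite (volume : Measure E)]

theorem paramMeasure_apply {P : E → Y} {D : Set E} {ρ : E → ℝ} (hD : MeasurableSet D)
    (hP : ContinuousOn P D) {A : Set Y} (hA : MeasurableSet A) :
    paramMeasure P D ρ A = ∫⁻ q in P ⁻¹' A ∩ D, ENNReal.ofReal (ρ q) := by
  rw [paramMeasure, Measure.map_apply_of_aemeasurable (aemeasurable_param hD hP) hA,
    withDensity_apply', Measure.restrict_restrict' hD]

theorem paramMeasure_mono {P : E → Y} {K D : Set E} {ρ : E → ℝ} (hK : MeasurableSet K)
    (hD : MeasurableSet D) (hP : ContinuousOn P D) (hKD : K ⊆ D) :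
    paramMeasure P K ρ ≤ paramMeasure P D ρ := by
  refine Measure.le_iff.2 fun A hA => ?_
  rw [paramMeasure_apply hD hP hA, paramMeasure_apply hK (hP.mono hKD) hA]
  exact lintegral_mono_set (inter_subset_inter_right _ hKD)

theorem paramMeasure_restrict {P : E → Y} {D : Set E} {ρ : E → ℝ} (hD : MeasurableSet D)
    (hP : ContinuousOn P D) {A : Set Y} (hA : MeasurableSet A) :
    (paramMeasure P D ρ).restrict A = paramMeasure P (P ⁻¹' A ∩ D) ρ := by
  rw [paramMeasure, Measure.restrict_map_of_aemeasurable (aemeasurable_param hD hP) hA,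
    restrict_withDensity', Measure.restrict_restrict' hD, paramMeasure]

variable [NormedSpace ℝ E]

/-- `P i`, with inverse `J i`, are parametrizations defined on `D i` for which the densities `ρ i`
obey the transformation rule. -/
structure IsParamFamily (P : ι → E → Y) (J : ι → Y → E) (D : ι → Set E) (ρ : ι → E → ℝ) :
    Prop where
  measurableSet_domain : ∀ i, MeasurableSet (D i)
  continuousOn_param : ∀ i, ContinuousOn (P i) (D i)
  left_inv : ∀ i, ∀ q ∈ D i, J i (P i q) = q
  measurableSet_image : ∀ i, MeasurableSet (P i '' D i)
  continuousOn_inv : ∀ i, ContinuousOn (J i) (P i '' D i)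
  continuousOn_density : ∀ i, ContinuousOn (ρ i) (D i)
  density_nonneg : ∀ i, ∀ q ∈ D i, 0 ≤ ρ i q
  change : ∀ i j, ∀ q ∈ D i, P i q ∈ P j '' D j → ∃ φ' : E →L[ℝ] E,
    HasFDerivWithinAt (fun q => J j (P i q)) φ' (D i ∩ P i ⁻¹' (P j '' D j)) q ∧
      ρ i q = |φ'.det| * ρ j (J j (P i q))

theorem IsParamFamily.aestronglyMeasurable {P : ι → E → Y} {J : ι → Y → E} {D : ι → Set E}
    {ρ : ι → E → ℝ} (h : IsParamFamily P J D ρ) (i : ι) {f : Y → ℝ}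
    (hf : ContinuousOn (fun q => f (P i q)) (D i)) :
    AEStronglyMeasurable f (paramMeasure (P i) (D i) (ρ i)) := by
  have hc : ContinuousOn f (P i '' D i) := by
    refine (hf.comp (h.continuousOn_inv i) ?_).congr ?_
    · rintro _ ⟨q, hq, rfl⟩
      rw [h.left_inv i q hq]
      exact hq
    · rintro _ ⟨q, hq, rfl⟩
      simp only [Function.comp_apply, h.left_inv i q hq]
  have hr : (paramMeasure (P i) (D i) (ρ i)).restrict (P i '' D i) =
      paramMeasure (P i) (D i) (ρ i) := by
    rw [paramMeasure_restrict (h.measurableSet_domain i) (h.continuousOn_param i)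
      (h.measurableSet_image i)]
    congr 1
    exact inter_eq_right.2 (subset_preimage_image _ _)
  rw [← hr]
  exact hc.aestronglyMeasurable (h.measurableSet_image i)

/-- Local integrals are controlled by the integral over the glued measure. -/
theorem IsParamFamily.setIntegral_le {P : ι → E → Y} {J : ι → Y → E} {D : ι → Set E}
    {ρ : ι → E → ℝ} (h : IsParamFamily P J D ρ) (i : ι) {K : Set E} (hKm : MeasurableSet K)
    (hKD : K ⊆ D i) {f : Y → ℝ} (hf : ContinuousOn (fun q => f (P i q)) (D i))
    (hf0 : 0 ≤ᵐ[⨆ i, paramMeasure (P i) (D i) (ρ i)] f)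
    (hint : Integrable f (⨆ i, paramMeasure (P i) (D i) (ρ i))) :
    ∫ q in K, ρ i q * f (P i q) ≤ ∫ y, f y ∂(⨆ i, paramMeasure (P i) (D i) (ρ i)) := by
  have hle : paramMeasure (P i) K (ρ i) ≤ paramMeasure (P i) (D i) (ρ i) :=
    paramMeasure_mono hKm (h.measurableSet_domain i) (h.continuousOn_param i) hKD
  have hle' := hle.trans (le_iSup (fun i => paramMeasure (P i) (D i) (ρ i)) i)
  rw [← integral_paramMeasure hKm ((h.continuousOn_param i).mono hKD)
    ((h.continuousOn_density i).mono hKD) (fun q hq => h.density_nonneg i q (hKD hq))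
    ((h.aestronglyMeasurable i hf).mono_measure hle)]
  exact integral_mono_measure hle' hf0 hint

variable [FiniteDimensional ℝ E] [(volume : Measure E).IsAddHaarMeasure]

theorem IsParamFamily.measure_le {P : ι → E → Y} {J : ι → Y → E} {D : ι → Set E} {ρ : ι → E → ℝ}
    (h : IsParamFamily P J D ρ) (i j : ι) {A : Set Y} (hA : MeasurableSet A)
    (hAj : A ⊆ P j '' D j) : paramMeasure (P i) (D i) (ρ i) A ≤ paramMeasure (P j) (D j) (ρ j) A := by
  rw [paramMeasure_apply (h.measurableSet_domain i) (h.continuousOn_param i) hA,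
    paramMeasure_apply (h.measurableSet_domain j) (h.continuousOn_param j) hA]
  set s := P i ⁻¹' A ∩ D i with hs
  have hsm : MeasurableSet s :=
    measurableSet_inter_preimage (h.measurableSet_domain i) (h.continuousOn_param i) hA
  have hch : ∀ q ∈ s, ∃ φ' : E →L[ℝ] E, HasFDerivWithinAt (fun q => J j (P i q)) φ' s q ∧
      ρ i q = |φ'.det| * ρ j (J j (P i q)) := fun q hq => by
    obtain ⟨φ', h1, h2⟩ := h.change i j q hq.2 (hAj hq.1)
    exact ⟨φ', h1.mono fun q' hq' => ⟨hq'.2, hAj hq'.1⟩, h2⟩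
  choose! φ' hφ' hρ using hch
  have hmem : ∀ q ∈ s, J j (P i q) ∈ D j ∧ P j (J j (P i q)) = P i q := fun q hq => by
    obtain ⟨q', hq', he⟩ := hAj hq.1
    rw [← he, h.left_inv j q' hq']
    exact ⟨hq', rfl⟩
  have hinj : InjOn (fun q => J j (P i q)) s := fun q hq q' hq' he => by
    have h1 : P i q = P i q' := by
      rw [← (hmem q hq).2, ← (hmem q' hq').2]
      exact congrArg _ he
    rw [← h.left_inv i q hq.2, ← h.left_inv i q' hq'.2, h1]
  calc ∫⁻ q in s, ENNReal.ofReal (ρ i q)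
      = ∫⁻ q in s, ENNReal.ofReal |(φ' q).det| * ENNReal.ofReal (ρ j (J j (P i q))) := by
        refine setLIntegral_congr_fun hsm fun q hq => ?_
        simp only [hρ q hq]
        rw [ENNReal.ofReal_mul (abs_nonneg _)]
    _ = ∫⁻ q in (fun q => J j (P i q)) '' s, ENNReal.ofReal (ρ j q) :=
        (lintegral_image_eq_lintegral_abs_det_fderiv_mul volume hsm hφ' hinj
          fun q => ENNReal.ofReal (ρ j q)).symm
    _ ≤ ∫⁻ q in P j ⁻¹' A ∩ D j, ENNReal.ofReal (ρ j q) := by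
        refine lintegral_mono_set ?_
        rintro _ ⟨q, hq, rfl⟩
        exact ⟨by rw [mem_preimage, (hmem q hq).2]; exact hq.1, (hmem q hq).1⟩

/-- The supremum of the local measures is computed with the help of a finite partition. -/
theorem IsParamFamily.iSup_eq_sum {P : ι → E → Y} {J : ι → Y → E} {D : ι → Set E} {ρ : ι → E → ℝ}
    (h : IsParamFamily P J D ρ) {N : ℕ} (k : Fin N → ι) {U : Fin N → Set Y}
    (hU : ∀ m, MeasurableSet (U m)) (hUk : ∀ m, U m ⊆ P (k m) '' D (k m))
    (hdisj : Pairwise fun m m' => Disjoint (U m) (U m')) (hcov : ∀ i, P i '' D i ⊆ ⋃ m, U m) :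
    (⨆ i, paramMeasure (P i) (D i) (ρ i)) =
      ∑ m, (paramMeasure (P (k m)) (D (k m)) (ρ (k m))).restrict (U m) := by
  set μ := fun i => paramMeasure (P i) (D i) (ρ i) with hμ
  change (⨆ i, μ i) = ∑ m, (μ (k m)).restrict (U m)
  refine le_antisymm (iSup_le fun i => ?_) ?_
  · refine Measure.le_iff.2 fun A hA => ?_
    have h0 : μ i A ≤ μ i (⋃ m, A ∩ U m) := by
      rw [← inter_iUnion]
      simp only [hμ]
      rw [paramMeasure_apply (h.measurableSet_domain i) (h.continuousOn_param i) hA,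
        paramMeasure_apply (h.measurableSet_domain i) (h.continuousOn_param i)
          (hA.inter (MeasurableSet.iUnion hU))]
      exact lintegral_mono_set fun q hq => ⟨⟨hq.1, hcov i (mem_image_of_mem _ hq.2)⟩, hq.2⟩
    refine h0.trans ((measure_iUnion_fintype_le _ _).trans ?_)
    rw [Measure.finsetSum_apply]
    refine Finset.sum_le_sum fun m _ => ?_
    rw [Measure.restrict_apply hA]
    exact h.measure_le i (k m) (hA.inter (hU m)) (inter_subset_right.trans (hUk m))
  · refine Measure.le_iff.2 fun A hA => ?_
    rw [Measure.finsetSum_apply]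
    calc ∑ m, (μ (k m)).restrict (U m) A ≤ ∑ m, (⨆ i, μ i) (A ∩ U m) := by
          refine Finset.sum_le_sum fun m _ => ?_
          rw [Measure.restrict_apply hA]
          exact le_iSup μ (k m) _
      _ = (⨆ i, μ i) (⋃ m, A ∩ U m) := by
          rw [measure_iUnion (fun m m' hm => (hdisj hm).mono inter_subset_right inter_subset_right)
            (fun m => hA.inter (hU m)), tsum_fintype]
      _ ≤ (⨆ i, μ i) A := measure_mono (iUnion_subset fun m => inter_subset_left)

/-- Integration with respect to the supremum of the local measures. -/
theorem IsParamFamily.integral_iSup {P : ι → E → Y} {J : ι → Y → E} {D : ι → Set E}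
    {ρ : ι → E → ℝ} (h : IsParamFamily P J D ρ) {N : ℕ} (k : Fin N → ι) {U : Fin N → Set Y}
    (hU : ∀ m, MeasurableSet (U m)) (hUk : ∀ m, U m ⊆ P (k m) '' D (k m))
    (hdisj : Pairwise fun m m' => Disjoint (U m) (U m')) (hcov : ∀ i, P i '' D i ⊆ ⋃ m, U m)
    {K : Fin N → Set E} (hK : ∀ m, IsCompact (K m)) (hKD : ∀ m, K m ⊆ D (k m))
    (hUK : ∀ m, P (k m) ⁻¹' U m ∩ D (k m) ⊆ K m)
    {f : Y → ℝ} (hf : ∀ i, ContinuousOn (fun q => f (P i q)) (D i)) :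
    Integrable f (⨆ i, paramMeasure (P i) (D i) (ρ i)) ∧
      ∫ y, f y ∂(⨆ i, paramMeasure (P i) (D i) (ρ i)) =
        ∑ m, ∫ q in P (k m) ⁻¹' U m ∩ D (k m), ρ (k m) q * f (P (k m) q) := by
  have hm : ∀ m, MeasurableSet (P (k m) ⁻¹' U m ∩ D (k m)) := fun m =>
    measurableSet_inter_preimage (h.measurableSet_domain _) (h.continuousOn_param _) (hU m)
  have hr : ∀ m, (paramMeasure (P (k m)) (D (k m)) (ρ (k m))).restrict (U m) =
      paramMeasure (P (k m)) (P (k m) ⁻¹' U m ∩ D (k m)) (ρ (k m)) := fun m =>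
    paramMeasure_restrict (h.measurableSet_domain _) (h.continuousOn_param _) (hU m)
  have hs : ∀ m, AEStronglyMeasurable f
      (paramMeasure (P (k m)) (P (k m) ⁻¹' U m ∩ D (k m)) (ρ (k m))) := fun m => by
    rw [← hr]
    exact (h.aestronglyMeasurable (k m) (hf (k m))).restrict
  have hP := fun m => (h.continuousOn_param (k m)).mono
    (inter_subset_right : P (k m) ⁻¹' U m ∩ D (k m) ⊆ _)
  have hρ := fun m => (h.continuousOn_density (k m)).mono
    (inter_subset_right : P (k m) ⁻¹' U m ∩ D (k m) ⊆ _)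
  have hi : ∀ m, Integrable f ((paramMeasure (P (k m)) (D (k m)) (ρ (k m))).restrict (U m)) := by
    intro m
    rw [hr]
    refine integrable_paramMeasure (hm m) (hP m) (hρ m)
      (fun q hq => h.density_nonneg _ q hq.2) (hs m) ?_
    exact ((((h.continuousOn_density (k m)).mul (hf (k m))).mono (hKD m)).integrableOn_compact
      (hK m)).mono_set (hUK m)
  rw [h.iSup_eq_sum k hU hUk hdisj hcov]
  refine ⟨integrable_finsetSum_measure.2 fun m _ => hi m, ?_⟩
  rw [integral_finsetSum_measure fun m _ => hi m]
  refine Finset.sum_congr rfl fun m _ => ?_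
  rw [hr, integral_paramMeasure (hm m) (hP m) (hρ m) (fun q hq => h.density_nonneg _ q hq.2) (hs m)]

end Gluing

/-! ### The volume measures as glued measures -/

theorem det_gram_comp {E : Type*} [NormedAddCommGroup E] [NormedSpace ℝ E] {m : ℕ}
    (b : Module.Basis (Fin m) ℝ E) (β : E →ₗ[ℝ] E →ₗ[ℝ] ℝ) (φ : E →L[ℝ] E) :
    (Matrix.of fun i j => β (φ (b i)) (φ (b j))).det =
      φ.det ^ 2 * (Matrix.of fun i j => β (b i) (b j)).det := by
  have h := LinearMap.BilinForm.toMatrix_comp b b β (φ : E →ₗ[ℝ] E) (φ : E →ₗ[ℝ] E)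
  have h1 : LinearMap.BilinForm.toMatrix b (LinearMap.BilinForm.comp β (φ : E →ₗ[ℝ] E)
      (φ : E →ₗ[ℝ] E)) = Matrix.of fun i j => β (φ (b i)) (φ (b j)) := by
    ext i j
    simp [LinearMap.BilinForm.toMatrix_apply]
  have h2 : LinearMap.BilinForm.toMatrix b β = Matrix.of fun i j => β (b i) (b j) := by
    ext i j
    simp [LinearMap.BilinForm.toMatrix_apply]
  rw [h1, h2] at h
  rw [h, Matrix.det_mul, Matrix.det_mul, Matrix.det_transpose, LinearMap.det_toMatrix]
  change LinearMap.det (φ : E →ₗ[ℝ] E) * _ * LinearMap.det (φ : E →ₗ[ℝ] E) =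
    LinearMap.det (φ : E →ₗ[ℝ] E) ^ 2 * _
  ring

theorem sqrt_det_gram_change {n : ℕ} {E : Type*} [NormedAddCommGroup E] [NormedSpace ℝ E]
    (b : Module.Basis (Fin (n + 1)) ℝ E) (j : E →L[ℝ] Vec n) {k : Fin (n + 2)}
    (hj : ∀ i, j (b i) = stdVec n (k.succAbove i)) (B : BilForm n) {A A' : Vec n →L[ℝ] Vec n}
    {φ : E →L[ℝ] E} (hφ : ∀ q, A (j q) = A' (j (φ q))) :
    Real.sqrt |((gram B A).submatrix k.succAbove k.succAbove).det| =
      |φ.det| * Real.sqrt |((gram B A').submatrix k.succAbove k.succAbove).det| := by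
  let β : E →ₗ[ℝ] E →ₗ[ℝ] ℝ := LinearMap.mk₂ ℝ (fun q r => B (A' (j q)) (A' (j r)))
    (by simp) (by simp) (by simp) (by simp)
  have h := det_gram_comp b β φ
  have h1 : (gram B A).submatrix k.succAbove k.succAbove =
      Matrix.of fun i i' => β (φ (b i)) (φ (b i')) := by
    ext i i'
    change B (A (stdVec n _)) (A (stdVec n _)) = B _ _
    rw [← hj, ← hj, hφ, hφ]
  have h2 : (gram B A').submatrix k.succAbove k.succAbove =
      Matrix.of fun i i' => β (b i) (b i') := by
    ext i i'
    change B (A' (stdVec n _)) (A' (stdVec n _)) = B _ _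
    rw [← hj, ← hj]
  rw [h1, h2, h, abs_mul, Real.sqrt_mul (abs_nonneg _), abs_pow, Real.sqrt_sq (abs_nonneg _)]

/-- The inclusion of the boundary hyperplane as a linear map. -/
def boundaryInclL (n : ℕ) :
    EuclideanSpace ℝ (Fin n) →L[ℝ] EuclideanSpace ℝ (Fin (n + 1)) :=
  LinearMap.toContinuousLinearMap
    { toFun := boundaryIncl n
      map_add' := fun x y => by
        ext i
        refine Fin.cases ?_ (fun i => ?_) i <;> simp [boundaryIncl]
      map_smul' := fun c x => by
        ext i
        refine Fin.cases ?_ (fun i => ?_) i <;> simp [boundaryIncl] }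

theorem continuous_boundaryIncl (n : ℕ) : Continuous (boundaryIncl n) :=
  (boundaryInclL n).continuous

theorem boundaryIncl_zero (n : ℕ) (y : EuclideanSpace ℝ (Fin n)) : boundaryIncl n y 0 = 0 := rfl

/-- The projection onto the boundary hyperplane. -/
def boundaryProjL (n : ℕ) :
    EuclideanSpace ℝ (Fin (n + 1)) →L[ℝ] EuclideanSpace ℝ (Fin n) :=
  LinearMap.toContinuousLinearMap
    { toFun := fun y => WithLp.toLp 2 fun i => y i.succ
      map_add' := fun x y => by ext i; simp
      map_smul' := fun c x => by ext i; simp }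

theorem boundaryProjL_boundaryIncl (n : ℕ) (y : EuclideanSpace ℝ (Fin n)) :
    boundaryProjL n (boundaryIncl n y) = y := by
  ext i; rfl

theorem boundaryIncl_boundaryProjL (n : ℕ) {y : EuclideanSpace ℝ (Fin (n + 1))} (hy : y 0 = 0) :
    boundaryIncl n (boundaryProjL n y) = y := by
  ext i
  refine Fin.cases ?_ (fun i => ?_) i
  · rw [hy]; rfl
  · rfl

/-- The coordinates `(t, x¹, …, xⁿ)` of the lateral boundary as a vector. -/
def lateralIncl (n : ℕ) : ℝ × EuclideanSpace ℝ (Fin n) →L[ℝ] Vec n :=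
  (ContinuousLinearMap.id ℝ ℝ).prodMap (boundaryInclL n)

theorem lateralIncl_apply (n : ℕ) (q : ℝ × EuclideanSpace ℝ (Fin n)) :
    lateralIncl n q = (q.1, boundaryIncl n q.2) := rfl

/-- The coordinates of `ℝ × ℝⁿ`. -/
def lateralEquiv (n : ℕ) : (ℝ × EuclideanSpace ℝ (Fin n)) ≃ₗ[ℝ] (Fin (n + 1) → ℝ) where
  toFun q := Fin.cons q.1 fun i => q.2 i
  invFun y := (y 0, WithLp.toLp 2 fun i => y i.succ)
  left_inv q := rfl
  right_inv y := by
    funext i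
    refine Fin.cases ?_ (fun i => ?_) i <;> simp
  map_add' x y := by
    funext i
    refine Fin.cases ?_ (fun i => ?_) i <;> simp
  map_smul' c x := by
    funext i
    refine Fin.cases ?_ (fun i => ?_) i <;> simp

theorem lateralIncl_basis (n : ℕ) (i : Fin (n + 1)) :
    lateralIncl n (Module.Basis.ofEquivFun (lateralEquiv n) i) =
      stdVec n ((1 : Fin (n + 2)).succAbove i) := by
  rw [Module.Basis.coe_ofEquivFun, lateralIncl_apply]
  beta_reduce
  have h1 : (lateralEquiv n).symm (Pi.single i 1) =
    (Pi.single (M := fun _ => ℝ) i (1 : ℝ) 0, WithLp.toLp 2 fun j : Fin n =>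
      Pi.single (M := fun _ => ℝ) i (1 : ℝ) j.succ) := rfl
  rw [h1]
  refine Fin.cases ?_ (fun i => ?_) i
  · rw [show (1 : Fin (n + 2)).succAbove 0 = 0 from rfl, stdVec_zero]
    refine Prod.ext (by simp) ?_
    ext j
    refine Fin.cases ?_ (fun j => ?_) j <;> simp [boundaryIncl]
  · rw [show (1 : Fin (n + 2)) = Fin.succ 0 from rfl, Fin.succ_succAbove_succ, stdVec_succ]
    refine Prod.ext (by simp) ?_
    ext j
    refine Fin.cases ?_ (fun j => ?_) j <;> simp [boundaryIncl, Pi.single_apply]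

section Volume

variable {n : ℕ} {X : Type*} [TopologicalSpace X] [ChartedSpace (EuclideanHalfSpace (n + 1)) X]

theorem measurableSet_extChartAt_target (x₀ : X) :
    MeasurableSet (extChartAt (𝓡∂ (n + 1)) x₀).target := by
  rw [extChartAt_target]
  exact ((𝓡∂ (n + 1)).continuous_symm.isOpen_preimage _ (chartAt _ x₀).open_target).measurableSet.inter
    (𝓡∂ (n + 1)).isClosed_range.measurableSet

theorem sliceVolume_eq [MeasurableSpace X] (g : MetricField n X) (s : ℝ) :
    sliceVolume g s = ⨆ x₀ : X, paramMeasure (extChartAt (𝓡∂ (n + 1)) x₀).symm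
      (extChartAt (𝓡∂ (n + 1)) x₀).target (fun y => hypersurfaceDensity g x₀ 0 (s, y)) := rfl

/-- The domain of the coordinates `(t, x¹, …, xⁿ)` of the lateral boundary. -/
def lateralDomain (n : ℕ) {X : Type*} [TopologicalSpace X]
    [ChartedSpace (EuclideanHalfSpace (n + 1)) X] (t : ℝ) (x₀ : X) :
    Set (ℝ × EuclideanSpace ℝ (Fin n)) :=
  {q | q.1 ∈ Icc 0 t ∧ boundaryIncl n q.2 ∈ (extChartAt (𝓡∂ (n + 1)) x₀).target}

theorem lateralVolume_eq [MeasurableSpace X] (g : MetricField n X) (t : ℝ) :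
    lateralVolume g t = ⨆ x₀ : X, paramMeasure (fun q => chartParam x₀ (lateralIncl n q))
      (lateralDomain n t x₀) (fun q => hypersurfaceDensity g x₀ 1 (lateralIncl n q)) := rfl

theorem lateralIncl_mem {T t : ℝ} (ht : t ≤ T) {x₀ : X} {q : ℝ × EuclideanSpace ℝ (Fin n)}
    (hq : q ∈ lateralDomain n t x₀) : lateralIncl n q ∈ coordDomain T x₀ :=
  ⟨⟨hq.1.1, hq.1.2.trans ht⟩, hq.2⟩

theorem measurableSet_lateralDomain (t : ℝ) (x₀ : X) :
    MeasurableSet (lateralDomain n t x₀) :=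
  (measurable_fst measurableSet_Icc).inter
    (((continuous_boundaryIncl n).measurable.comp measurable_snd)
      (measurableSet_extChartAt_target x₀))

theorem hypersurfaceDensity_eq_gram (g : MetricField n X) {x₀ x : X}
    (hx : x ∈ (extChartAt (𝓡∂ (n + 1)) x₀).source) (s : ℝ) (k : Fin (n + 2)) :
    hypersurfaceDensity g x₀ k (s, extChartAt (𝓡∂ (n + 1)) x₀ x) =
      Real.sqrt |((gram (g (s, x)) (coordFrame x₀ (s, extChartAt (𝓡∂ (n + 1)) x₀ x))).submatrix
        k.succAbove k.succAbove).det| := by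
  have h : ∀ p, chartParam x₀ (s, extChartAt (𝓡∂ (n + 1)) x₀ x) = p →
      hypersurfaceDensity g x₀ k (s, extChartAt (𝓡∂ (n + 1)) x₀ x) =
        Real.sqrt |((gram (g p) (coordFrame x₀ (s, extChartAt (𝓡∂ (n + 1)) x₀ x))).submatrix
          k.succAbove k.succAbove).det| := by
    rintro p rfl
    rfl
  exact h _ (Prod.ext rfl ((extChartAt _ x₀).left_inv hx))

theorem image_lateral (t : ℝ) (x₀ : X) :
    (fun q => chartParam x₀ (lateralIncl n q)) '' lateralDomain n t x₀ = Icc 0 t ×ˢ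
      ((extChartAt (𝓡∂ (n + 1)) x₀) ⁻¹' {y | y 0 = 0} ∩ (extChartAt (𝓡∂ (n + 1)) x₀).source) := by
  ext p
  constructor
  · rintro ⟨q, hq, rfl⟩
    refine ⟨hq.1, ?_, (extChartAt _ x₀).map_target hq.2⟩
    change (extChartAt (𝓡∂ (n + 1)) x₀
      ((extChartAt (𝓡∂ (n + 1)) x₀).symm (boundaryIncl n q.2))) 0 = 0
    rw [(extChartAt _ x₀).right_inv hq.2]
    rfl
  · rintro ⟨h1, h2, h3⟩
    refine ⟨(p.1, boundaryProjL n (extChartAt (𝓡∂ (n + 1)) x₀ p.2)), ⟨h1, ?_⟩, ?_⟩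
    · rw [boundaryIncl_boundaryProjL n h2]
      exact (extChartAt _ x₀).map_source h3
    · change (p.1, (extChartAt (𝓡∂ (n + 1)) x₀).symm (boundaryIncl n (boundaryProjL n
        (extChartAt (𝓡∂ (n + 1)) x₀ p.2)))) = p
      rw [boundaryIncl_boundaryProjL n h2, (extChartAt _ x₀).left_inv h3]

variable [IsManifold (𝓡∂ (n + 1)) ∞ X] [MeasurableSpace X] [BorelSpace X]

theorem isParamFamily_slice {T : ℝ} {g : MetricField n X} (hg : IsSlabMetric T g) {s : ℝ}
    (hs : s ∈ Icc 0 T) :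
    IsParamFamily (fun x₀ : X => (extChartAt (𝓡∂ (n + 1)) x₀).symm)
      (fun x₀ => extChartAt (𝓡∂ (n + 1)) x₀) (fun x₀ => (extChartAt (𝓡∂ (n + 1)) x₀).target)
      (fun x₀ y => hypersurfaceDensity g x₀ 0 (s, y)) where
  measurableSet_domain := measurableSet_extChartAt_target
  continuousOn_param := continuousOn_extChartAt_symm
  left_inv x₀ q hq := (extChartAt _ x₀).right_inv hq
  measurableSet_image x₀ := by
    rw [PartialEquiv.symm_image_target_eq_source]
    exact (isOpen_extChartAt_source x₀).measurableSet
  continuousOn_inv x₀ := by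
    rw [PartialEquiv.symm_image_target_eq_source]
    exact continuousOn_extChartAt x₀
  continuousOn_density x₀ := (continuousOn_hypersurfaceDensity hg x₀ 0).comp
    (by fun_prop) fun y hy => ⟨hs, hy⟩
  density_nonneg x₀ q _ := Real.sqrt_nonneg _
  change x₀ x₁ q hq hq' := by
    rw [PartialEquiv.symm_image_target_eq_source] at hq' ⊢
    set x := (extChartAt (𝓡∂ (n + 1)) x₀).symm q with hx
    have hx₀ : x ∈ (extChartAt (𝓡∂ (n + 1)) x₀).source := (extChartAt _ x₀).map_target hq
    have hqx : extChartAt (𝓡∂ (n + 1)) x₀ x = q := (extChartAt _ x₀).right_inv hq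
    refine ⟨tangentCoordChange (𝓡∂ (n + 1)) x₀ x₁ x, ?_, ?_⟩
    · have := hasFDerivWithinAt_tangentCoordChange (I := 𝓡∂ (n + 1)) ⟨hx₀, hq'⟩
      rw [hqx] at this
      exact this.mono fun y hy => extChartAt_target_subset_range x₀ hy.1
    · have hb : ∀ i, ContinuousLinearMap.inr ℝ ℝ (EuclideanSpace ℝ (Fin (n + 1)))
          ((EuclideanSpace.basisFun (Fin (n + 1)) ℝ).toBasis i) =
          stdVec n ((0 : Fin (n + 2)).succAbove i) := fun i => by
        rw [Fin.zero_succAbove, stdVec_succ]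
        simp
      have h := sqrt_det_gram_change _ _ hb (g (s, x))
        (A := coordFrame x₀ (s, extChartAt (𝓡∂ (n + 1)) x₀ x))
        (A' := coordFrame x₁ (s, extChartAt (𝓡∂ (n + 1)) x₁ x))
        (φ := tangentCoordChange (𝓡∂ (n + 1)) x₀ x₁ x)
        (fun q => coordFrame_change hx₀ hq' _)
      rw [← hypersurfaceDensity_eq_gram g hx₀, ← hypersurfaceDensity_eq_gram g hq', hqx] at h
      exact h

theorem isParamFamily_lateral {T : ℝ} {g : MetricField n X} (hg : IsSlabMetric T g) {t : ℝ}
    (ht : t ≤ T) :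
    IsParamFamily (fun (x₀ : X) q => chartParam x₀ (lateralIncl n q))
      (fun x₀ p => (p.1, boundaryProjL n (extChartAt (𝓡∂ (n + 1)) x₀ p.2)))
      (fun x₀ => lateralDomain n t x₀)
      (fun x₀ q => hypersurfaceDensity g x₀ 1 (lateralIncl n q)) where
  measurableSet_domain := measurableSet_lateralDomain t
  continuousOn_param x₀ := (contMDiffOn_chartParam x₀).continuousOn.comp
    (lateralIncl n).continuous.continuousOn fun q hq => ⟨mem_univ _, hq.2⟩
  left_inv x₀ q hq := by
    refine Prod.ext rfl ?_
    change boundaryProjL n (extChartAt _ x₀ ((extChartAt _ x₀).symm (boundaryIncl n q.2))) = q.2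
    rw [(extChartAt _ x₀).right_inv hq.2, boundaryProjL_boundaryIncl]
  measurableSet_image x₀ := by
    rw [image_lateral]
    refine measurableSet_Icc.prod ?_
    have hc : IsClosed {y : EuclideanSpace ℝ (Fin (n + 1)) | y 0 = 0} :=
      isClosed_eq (EuclideanSpace.proj (0 : Fin (n + 1))).continuous continuous_const
    exact measurableSet_inter_preimage (isOpen_extChartAt_source x₀).measurableSet
      (continuousOn_extChartAt x₀) hc.measurableSet
  continuousOn_inv x₀ := by
    rw [image_lateral]
    refine continuousOn_fst.prodMk ((boundaryProjL n).continuous.comp_continuousOn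
      ((continuousOn_extChartAt x₀).comp continuousOn_snd fun p hp => hp.2.2))
  continuousOn_density x₀ := (continuousOn_hypersurfaceDensity hg x₀ 1).comp
    (lateralIncl n).continuous.continuousOn fun q hq => lateralIncl_mem ht hq
  density_nonneg x₀ q _ := Real.sqrt_nonneg _
  change x₀ x₁ q hq hq' := by
    rw [image_lateral] at hq' ⊢
    set x := (extChartAt (𝓡∂ (n + 1)) x₀).symm (boundaryIncl n q.2) with hx
    have hx₀ : x ∈ (extChartAt (𝓡∂ (n + 1)) x₀).source := (extChartAt _ x₀).map_target hq.2
    have hx₁ : x ∈ (extChartAt (𝓡∂ (n + 1)) x₁).source := hq'.2.2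
    have hqx : extChartAt (𝓡∂ (n + 1)) x₀ x = boundaryIncl n q.2 :=
      (extChartAt _ x₀).right_inv hq.2
    have hb : x ∈ (𝓡∂ (n + 1)).boundary X := (mem_boundary_iff hx₀).2 (by rw [hqx]; rfl)
    have hqx₁ : boundaryIncl n (boundaryProjL n (extChartAt (𝓡∂ (n + 1)) x₁ x)) =
        extChartAt (𝓡∂ (n + 1)) x₁ x :=
      boundaryIncl_boundaryProjL n ((mem_boundary_iff hx₁).1 hb)
    obtain ⟨l, -, hl⟩ := exists_tangentCoordChange_normal hx₀ hx₁ hb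
    set m := tangentCoordChange (𝓡∂ (n + 1)) x₀ x₁ x with hm
    have hd := hasFDerivWithinAt_tangentCoordChange (I := 𝓡∂ (n + 1)) ⟨hx₀, hx₁⟩
    rw [hqx] at hd
    refine ⟨(ContinuousLinearMap.id ℝ ℝ).prodMap ((boundaryProjL n).comp
      (m.comp (boundaryInclL n))), ?_, ?_⟩
    · have h2 : HasFDerivWithinAt (fun r : ℝ × EuclideanSpace ℝ (Fin n) => boundaryIncl n r.2)
          ((boundaryInclL n).comp (ContinuousLinearMap.snd ℝ _ _)) (lateralDomain n t x₀) q :=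
        ((boundaryInclL n).comp (ContinuousLinearMap.snd ℝ ℝ _)).hasFDerivWithinAt
      have h3 := hd.comp q h2 fun r hr => extChartAt_target_subset_range x₀ hr.2
      have h4 := (boundaryProjL n).hasFDerivAt.comp_hasFDerivWithinAt q h3
      exact (hasFDerivWithinAt_fst.prodMk h4).mono inter_subset_left
    · have h := sqrt_det_gram_change _ _ (lateralIncl_basis n) (g (q.1, x))
        (A := coordFrame x₀ (q.1, extChartAt (𝓡∂ (n + 1)) x₀ x))
        (A' := coordFrame x₁ (q.1, extChartAt (𝓡∂ (n + 1)) x₁ x))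
        (φ := (ContinuousLinearMap.id ℝ ℝ).prodMap ((boundaryProjL n).comp
          (m.comp (boundaryInclL n)))) (fun r => by
          rw [coordFrame_change hx₀ hx₁]
          congr 1
          refine Prod.ext rfl ?_
          change m (boundaryIncl n r.2) =
            boundaryIncl n (boundaryProjL n (m (boundaryIncl n r.2)))
          rw [boundaryIncl_boundaryProjL n (by rw [hl, boundaryIncl_zero, mul_zero])])
      rw [← hypersurfaceDensity_eq_gram g hx₀, ← hypersurfaceDensity_eq_gram g hx₁, hqx] at h
      simp only [lateralIncl_apply]
      rw [h]
      congr 2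
      exact Prod.ext rfl hqx₁.symm

end Volume

/-! ### The divergence theorem in a coordinate chart -/

theorem measurableEmbedding_lateralEquiv_symm (m : ℕ) :
    MeasurableEmbedding (lateralEquiv m).symm :=
  (lateralEquiv m).symm.toContinuousLinearEquiv.toHomeomorph.measurableEmbedding

theorem continuous_lateralEquiv_symm (m : ℕ) : Continuous (lateralEquiv m).symm :=
  (lateralEquiv m).symm.toContinuousLinearEquiv.continuous

theorem measurePreserving_lateralEquiv_symm (m : ℕ) :
    MeasurePreserving (lateralEquiv m).symm volume volume := by
  have h1 := volume_preserving_piFinSuccAbove (fun _ : Fin (m + 1) => ℝ) 0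
  have h2 : MeasurePreserving (Prod.map id (WithLp.toLp 2) :
      ℝ × (Fin m → ℝ) → ℝ × EuclideanSpace ℝ (Fin m)) volume volume :=
    (MeasurePreserving.id (volume : Measure ℝ)).prod (PiLp.volume_preserving_toLp (Fin m))
  exact h2.comp h1

/-- The half space `x⁰ ≥ 0`. -/
def halfSpace (n : ℕ) : Set (EuclideanSpace ℝ (Fin (n + 1))) := {y | 0 ≤ y 0}

theorem isClosed_halfSpace (n : ℕ) : IsClosed (halfSpace n) :=
  isClosed_le continuous_const (EuclideanSpace.proj (0 : Fin (n + 1))).continuous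

section Divergence

variable {n : ℕ} {T : ℝ} {Ω : Set (EuclideanSpace ℝ (Fin (n + 1)))}
  {c : EuclideanSpace ℝ (Fin (n + 1))} {r : ℝ}

theorem continuousOn_indicator_ball (hΩn : ∀ y ∈ Ω, Ω ∈ 𝓝[halfSpace n] y)
    (hball : Metric.closedBall c r ∩ halfSpace n ⊆ Ω) {f : Vec n → ℝ}
    (hf : ContinuousOn f (Icc 0 T ×ˢ Ω))
    (hf0 : ∀ z ∈ Icc 0 T ×ˢ Ω, z.2 ∉ Metric.closedBall c r → f z = 0) :
    ContinuousOn (indicator (univ ×ˢ Metric.closedBall c r) f) (Icc 0 T ×ˢ halfSpace n) := by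
  intro z hz
  by_cases hzΩ : z.2 ∈ Ω
  · have h1 : Icc 0 T ×ˢ Ω ∈ 𝓝[Icc 0 T ×ˢ halfSpace n] z := by
      rw [show z = (z.1, z.2) from rfl, nhdsWithin_prod_eq]
      exact Filter.prod_mem_prod self_mem_nhdsWithin (hΩn _ hzΩ)
    have heq : EqOn (indicator (univ ×ˢ Metric.closedBall c r) f) f (Icc 0 T ×ˢ Ω) := by
      intro y hy
      by_cases hyb : y.2 ∈ Metric.closedBall c r
      · exact indicator_of_mem (show y ∈ univ ×ˢ Metric.closedBall c r from ⟨mem_univ _, hyb⟩) _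
      · rw [hf0 y hy hyb]
        exact indicator_of_notMem (fun h => hyb h.2) _
    have hzD : z ∈ Icc 0 T ×ˢ Ω := ⟨hz.1, hzΩ⟩
    exact ((hf z hzD).congr heq (heq hzD)).mono_of_mem_nhdsWithin h1
  · have hzb : z.2 ∉ Metric.closedBall c r := fun h => hzΩ (hball ⟨h, hz.2⟩)
    have h2 : ∀ᶠ y in 𝓝 z, indicator (univ ×ˢ Metric.closedBall c r) f y = 0 := by
      have : {y : Vec n | y.2 ∉ Metric.closedBall c r} ∈ 𝓝 z :=
        (Metric.isClosed_closedBall.isOpen_compl.preimage continuous_snd).mem_nhds hzb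
      filter_upwards [this] with y hy
      exact indicator_of_notMem (fun h => hy h.2) _
    exact ((continuousAt_const (y := (0 : ℝ))).congr (h2.mono fun y hy => hy.symm)).continuousWithinAt

theorem partialDeriv_eq_zero_of_notMem_ball {D : Set (Vec n)} {f : Vec n → ℝ}
    (hf0 : ∀ z ∈ D, z.2 ∉ Metric.closedBall c r → f z = 0) {z : Vec n} (hz : z ∈ D)
    (hzb : z.2 ∉ Metric.closedBall c r) (a : Fin (n + 2)) : partialDeriv D a f z = 0 := by
  have : f =ᶠ[𝓝[D] z] fun _ => 0 := by
    have h : {y : Vec n | y.2 ∉ Metric.closedBall c r} ∈ 𝓝[D] z :=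
      mem_nhdsWithin_of_mem_nhds
        ((Metric.isClosed_closedBall.isOpen_compl.preimage continuous_snd).mem_nhds hzb)
    filter_upwards [h, self_mem_nhdsWithin] with y hy hyD using hf0 y hyD hy
  rw [partialDeriv, this.fderivWithin_eq (hf0 z hz hzb)]
  simp

theorem continuousOn_partialDeriv {D : Set (Vec n)} (hD : UniqueDiffOn ℝ D) {f : Vec n → ℝ}
    (hf : ContDiffOn ℝ 1 f D) (a : Fin (n + 2)) : ContinuousOn (partialDeriv D a f) D :=
  (hf.continuousOn_fderivWithin hD le_rfl).clm_apply continuousOn_const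

/-- The divergence theorem on `[0, t] × Ω`, where `Ω` is relatively open in the half space, for
vector fields that vanish outside a ball. -/
theorem integral_divergence_chart (hΩn : ∀ y ∈ Ω, Ω ∈ 𝓝[halfSpace n] y)
    (hball : Metric.closedBall c r ∩ halfSpace n ⊆ Ω) (hD : UniqueDiffOn ℝ (Icc 0 T ×ˢ Ω))
    {w : Fin (n + 2) → Vec n → ℝ} (hw : ∀ a, ContDiffOn ℝ 1 (w a) (Icc 0 T ×ˢ Ω))
    (hw0 : ∀ a, ∀ z ∈ Icc 0 T ×ˢ Ω, z.2 ∉ Metric.closedBall c r → w a z = 0)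
    {t : ℝ} (ht : t ∈ Icc 0 T) :
    ∫ s in (0 : ℝ)..t, ∫ y in Metric.closedBall c r ∩ halfSpace n,
        ∑ a, partialDeriv (Icc 0 T ×ˢ Ω) a (w a) (s, y) =
      (∫ y in Metric.closedBall c r ∩ halfSpace n, w 0 (t, y))
        - (∫ y in Metric.closedBall c r ∩ halfSpace n, w 0 (0, y))
        - ∫ q in {q : ℝ × EuclideanSpace ℝ (Fin n) | q.1 ∈ Icc 0 t ∧
            boundaryIncl n q.2 ∈ Metric.closedBall c r}, w 1 (lateralIncl n q) := by
  set K := Metric.closedBall c r ∩ halfSpace n with hK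
  set D : Set (Vec n) := Icc 0 T ×ˢ Ω with hDdef
  set β : Set (Vec n) := univ ×ˢ Metric.closedBall c r with hβ
  set div : Vec n → ℝ := fun z => ∑ a, partialDeriv D a (w a) z with hdiv
  have hKc : IsCompact K := (isCompact_closedBall c r).inter_right (isClosed_halfSpace n)
  set R : ℝ := ‖c‖ + |r| + 1 with hR
  have hRpos : 0 < R := by positivity
  have hcoord : ∀ y ∈ Metric.closedBall c r, ∀ i, |y i| < R := by
    intro y hy i
    have h1 : ‖y i‖ ≤ ‖y‖ := PiLp.norm_apply_le y i
    have h2 : ‖y‖ ≤ ‖y - c‖ + ‖c‖ := by simpa using norm_add_le (y - c) c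
    rw [Metric.mem_closedBall, dist_eq_norm] at hy
    rw [Real.norm_eq_abs] at h1
    linarith [le_abs_self r]
  have hwt : ∀ a, ContinuousOn (indicator β (w a)) (Icc 0 T ×ˢ halfSpace n) := fun a =>
    continuousOn_indicator_ball hΩn hball (hw a).continuousOn (hw0 a)
  have hdivc : ContinuousOn div D :=
    continuousOn_finsetSum _ fun a _ => continuousOn_partialDeriv hD (hw a) a
  have hdivt : ContinuousOn (indicator β div) (Icc 0 T ×ˢ halfSpace n) :=
    continuousOn_indicator_ball hΩn hball hdivc fun z hz hzb =>
      Finset.sum_eq_zero fun a _ => partialDeriv_eq_zero_of_notMem_ball (hw0 a) hz hzb a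
  -- the box
  set lo : Fin (n + 2) → ℝ := Fin.cons 0 (Fin.cons 0 fun _ => -R) with hlo
  set hi : Fin (n + 2) → ℝ := Fin.cons t (Fin.cons R fun _ => R) with hhi
  have hle : lo ≤ hi := by
    intro i
    refine Fin.cases ht.1 (fun i => ?_) i
    refine Fin.cases hRpos.le (fun i => ?_) i
    change -R ≤ R
    linarith
  have hbox : ∀ x ∈ Icc lo hi, ofComp x ∈ Icc 0 T ×ˢ halfSpace n := fun x hx =>
    ⟨⟨hx.1 0, (hx.2 0).trans ht.2⟩, hx.1 1⟩
  let φ : (Fin (n + 2) → ℝ) →L[ℝ] Vec n :=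
    LinearMap.toContinuousLinearMap
      ((lateralEquiv (n + 1)).symm : (Fin (n + 2) → ℝ) →ₗ[ℝ] Vec n)
  have hφ : ∀ x, φ x = ofComp x := fun x => rfl
  let f' : Fin (n + 2) → (Fin (n + 2) → ℝ) → (Fin (n + 2) → ℝ) →L[ℝ] ℝ := fun a x =>
    (indicator β (fderivWithin ℝ (w a) D) (ofComp x)).comp φ
  have hf'sum : ∀ x, ∑ a, f' a x (Pi.single a 1) = indicator β div (ofComp x) := by
    intro x
    have he : ∀ a, φ (Pi.single a 1) = stdVec n a := fun a => by
      rw [hφ, ofComp_eq_sum, Finset.sum_eq_single a] <;> simp +contextual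
    simp only [f', ContinuousLinearMap.comp_apply, he]
    by_cases hx : ofComp x ∈ β
    · simp only [indicator_of_mem hx]
      rfl
    · simp only [indicator_of_notMem hx]
      simp
  have key := integral_divergence_of_hasFDerivAt_off_countable' lo hi hle
    (fun a x => indicator β (w a) (ofComp x)) f' ∅ countable_empty
    (fun a => (hwt a).comp φ.continuous.continuousOn hbox)
    (fun x hx a => by
      have hx' := hx.1
      rw [mem_univ_pi] at hx'
      by_cases hxb : ofComp x ∈ β
      · have hxH : (ofComp x).2 ∈ halfSpace n := (hx' 1).1.le
        have hxΩ : (ofComp x).2 ∈ Ω := hball ⟨hxb.2, hxH⟩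
        have hHn : halfSpace n ∈ 𝓝 (ofComp x).2 := by
          have : {y : EuclideanSpace ℝ (Fin (n + 1)) | 0 < y 0} ∈ 𝓝 (ofComp x).2 :=
            (isOpen_lt continuous_const
              (EuclideanSpace.proj (0 : Fin (n + 1))).continuous).mem_nhds (hx' 1).1
          exact Filter.mem_of_superset this fun y (hy : 0 < y 0) => hy.le
        have hDn : D ∈ 𝓝 (ofComp x) := by
          refine prod_mem_nhds (Icc_mem_nhds (hx' 0).1 ((hx' 0).2.trans_le ht.2)) ?_
          have := hΩn _ hxΩ
          rwa [nhdsWithin_eq_nhds.2 hHn] at this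
        have hxD : ofComp x ∈ D := mem_of_mem_nhds hDn
        have h1 : HasFDerivAt (w a) (fderivWithin ℝ (w a) D (ofComp x)) (ofComp x) :=
          (((hw a).differentiableOn one_ne_zero _ hxD).hasFDerivWithinAt).hasFDerivAt hDn
        have h2 : HasFDerivAt (indicator β (w a)) (fderivWithin ℝ (w a) D (ofComp x))
            (ofComp x) := by
          refine h1.congr_of_eventuallyEq ?_
          filter_upwards [hDn] with y hy
          by_cases hyb : y ∈ β
          · exact indicator_of_mem hyb _
          · rw [indicator_of_notMem hyb, hw0 a y hy fun h => hyb ⟨mem_univ _, h⟩]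
        simp only [f', indicator_of_mem hxb]
        exact HasFDerivAt.comp x (f := ofComp) h2 φ.hasFDerivAt
      · have h2 : HasFDerivAt (indicator β (w a)) (0 : Vec n →L[ℝ] ℝ) (ofComp x) := by
          refine (hasFDerivAt_const (0 : ℝ) (ofComp x)).congr_of_eventuallyEq ?_
          have hβc : IsClosed β := isClosed_univ.prod Metric.isClosed_closedBall
          filter_upwards [hβc.isOpen_compl.mem_nhds hxb] with y hy using indicator_of_notMem hy _
        simp only [f', indicator_of_notMem hxb]
        exact HasFDerivAt.comp x (f := ofComp) h2 φ.hasFDerivAt)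
    (by
      simp only [hf'sum]
      exact ((hdivt.comp φ.continuous.continuousOn hbox).integrableOn_compact isCompact_Icc))
  simp only [hf'sum] at key
  -- the spacetime integral
  have hvol : ∫ x in Icc lo hi, indicator β div (ofComp x) =
      ∫ s in (0 : ℝ)..t, ∫ y in K, div (s, y) := by
    have hsub : (lateralEquiv (n + 1)).symm ⁻¹' (Icc 0 t ×ˢ K) ⊆ Icc lo hi := by
      intro x hx
      have hc := hcoord _ hx.2.1
      refine ⟨fun i => ?_, fun i => ?_⟩
      · refine Fin.cases hx.1.1 (fun i => ?_) i
        refine Fin.cases hx.2.2 (fun i => ?_) i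
        exact (neg_lt_of_abs_lt (hc i.succ)).le
      · refine Fin.cases hx.1.2 (fun i => ?_) i
        refine Fin.cases (lt_of_abs_lt (hc 0)).le (fun i => ?_) i
        exact (lt_of_abs_lt (hc i.succ)).le
    have hint : IntegrableOn div (Icc 0 t ×ˢ K) :=
      (hdivc.mono (prod_mono (Icc_subset_Icc_right ht.2) hball)).integrableOn_compact
        (isCompact_Icc.prod hKc)
    rw [setIntegral_eq_of_subset_of_forall_sdiff_eq_zero measurableSet_Icc hsub]
    · rw [intervalIntegral.integral_of_le ht.1, ← integral_Icc_eq_integral_Ioc]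
      rw [← setIntegral_prod div hint, ← Measure.volume_eq_prod, ← (measurePreserving_lateralEquiv_symm (n + 1)).setIntegral_preimage_emb
        (measurableEmbedding_lateralEquiv_symm (n + 1))]
      refine setIntegral_congr_fun ((continuous_lateralEquiv_symm (n + 1)).measurable
        (measurableSet_Icc.prod hKc.measurableSet)) fun x hx => ?_
      exact indicator_of_mem (show ofComp x ∈ β from ⟨mem_univ _, hx.2.1⟩) _
    · intro x hx
      refine indicator_of_notMem (fun h => hx.2 ⟨⟨hx.1.1 0, hx.1.2 0⟩, h.2, hx.1.1 1⟩) _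
  -- the time slices
  have hface : ∀ s, ∫ x in Icc (lo ∘ Fin.succAbove 0) (hi ∘ Fin.succAbove 0),
      indicator β (w 0) (ofComp ((0 : Fin (n + 2)).insertNth s x : Fin (n + 2) → ℝ)) = ∫ y in K, w 0 (s, y) := by
    intro s
    have hof : ∀ x : Fin (n + 1) → ℝ,
        ofComp ((0 : Fin (n + 2)).insertNth (α := fun _ => ℝ) s x) = (s, WithLp.toLp 2 x) := by
      intro x
      rw [Fin.insertNth_zero]
      rfl
    simp only [hof]
    have hsub : (WithLp.toLp 2 : (Fin (n + 1) → ℝ) → EuclideanSpace ℝ (Fin (n + 1))) ⁻¹' K ⊆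
        Icc (lo ∘ Fin.succAbove 0) (hi ∘ Fin.succAbove 0) := by
      intro x hx
      have hc := hcoord _ hx.1
      refine ⟨fun i => ?_, fun i => ?_⟩
      · refine Fin.cases hx.2 (fun i => ?_) i
        exact (neg_lt_of_abs_lt (hc i.succ)).le
      · refine Fin.cases (lt_of_abs_lt (hc 0)).le (fun i => ?_) i
        exact (lt_of_abs_lt (hc i.succ)).le
    have hemb : MeasurableEmbedding
        (WithLp.toLp 2 : (Fin (n + 1) → ℝ) → EuclideanSpace ℝ (Fin (n + 1))) :=
      (MeasurableEquiv.toLp 2 (Fin (n + 1) → ℝ)).measurableEmbedding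
    rw [setIntegral_eq_of_subset_of_forall_sdiff_eq_zero measurableSet_Icc hsub]
    · rw [← (PiLp.volume_preserving_toLp (Fin (n + 1))).setIntegral_preimage_emb hemb]
      refine setIntegral_congr_fun (hemb.measurable hKc.measurableSet) fun x hx => ?_
      exact indicator_of_mem (show ((s, WithLp.toLp 2 x) : Vec n) ∈ β from ⟨mem_univ _, hx.1⟩) _
    · intro x hx
      exact indicator_of_notMem (fun h => hx.2 ⟨h.2, hx.1.1 0⟩) _
  -- the lateral boundary
  have hlat : ∫ x in Icc (lo ∘ Fin.succAbove 1) (hi ∘ Fin.succAbove 1),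
      indicator β (w 1) (ofComp ((1 : Fin (n + 2)).insertNth 0 x : Fin (n + 2) → ℝ)) =
        ∫ q in {q : ℝ × EuclideanSpace ℝ (Fin n) | q.1 ∈ Icc 0 t ∧
            boundaryIncl n q.2 ∈ Metric.closedBall c r}, w 1 (lateralIncl n q) := by
    set Q := {q : ℝ × EuclideanSpace ℝ (Fin n) | q.1 ∈ Icc 0 t ∧
            boundaryIncl n q.2 ∈ Metric.closedBall c r} with hQ
    have hQm : MeasurableSet Q := (measurable_fst measurableSet_Icc).inter
      (((continuous_boundaryIncl n).measurable.comp measurable_snd)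
        Metric.isClosed_closedBall.measurableSet)
    have hof : ∀ x : Fin (n + 1) → ℝ,
        ofComp ((1 : Fin (n + 2)).insertNth (α := fun _ => ℝ) 0 x) =
          lateralIncl n ((lateralEquiv n).symm x) := by
      intro x
      have hx0 : (1 : Fin (n + 2)).insertNth (α := fun _ => ℝ) 0 x 0 = x 0 := by
        have := Fin.insertNth_apply_succAbove (α := fun _ => ℝ) (1 : Fin (n + 2)) 0 x 0
        rwa [show (1 : Fin (n + 2)).succAbove 0 = 0 from rfl] at this
      have hx1 : (1 : Fin (n + 2)).insertNth (α := fun _ => ℝ) 0 x 1 = 0 :=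
        Fin.insertNth_apply_same _ _ _
      have hx2 : ∀ i : Fin n, (1 : Fin (n + 2)).insertNth (α := fun _ => ℝ) 0 x i.succ.succ =
          x i.succ := fun i => by
        have := Fin.insertNth_apply_succAbove (α := fun _ => ℝ) (1 : Fin (n + 2)) 0 x i.succ
        rwa [show (1 : Fin (n + 2)) = Fin.succ 0 from rfl, Fin.succ_succAbove_succ] at this
      refine Prod.ext hx0 ?_
      ext i
      refine Fin.cases hx1 (fun i => hx2 i) i
    simp only [hof]
    have hsub : (lateralEquiv n).symm ⁻¹' Q ⊆
        Icc (lo ∘ Fin.succAbove 1) (hi ∘ Fin.succAbove 1) := by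
      intro x hx
      have hc := hcoord _ hx.2
      refine ⟨fun i => ?_, fun i => ?_⟩
      · refine Fin.cases hx.1.1 (fun i => ?_) i
        rw [Function.comp_apply, show (1 : Fin (n + 2)) = Fin.succ 0 from rfl,
          Fin.succ_succAbove_succ]
        exact (neg_lt_of_abs_lt (hc i.succ)).le
      · refine Fin.cases hx.1.2 (fun i => ?_) i
        rw [Function.comp_apply, show (1 : Fin (n + 2)) = Fin.succ 0 from rfl,
          Fin.succ_succAbove_succ]
        exact (lt_of_abs_lt (hc i.succ)).le
    rw [setIntegral_eq_of_subset_of_forall_sdiff_eq_zero measurableSet_Icc hsub]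
    · rw [← (measurePreserving_lateralEquiv_symm n).setIntegral_preimage_emb
        (measurableEmbedding_lateralEquiv_symm n)]
      refine setIntegral_congr_fun ((continuous_lateralEquiv_symm n).measurable hQm)
        fun x hx => ?_
      exact indicator_of_mem (show lateralIncl n ((lateralEquiv n).symm x) ∈ β from
        ⟨mem_univ _, hx.2⟩) _
    · intro x hx
      exact indicator_of_notMem (fun h => hx.2 ⟨⟨hx.1.1 0, hx.1.2 0⟩, h.2⟩) _
  -- the remaining faces
  have hzero : ∀ (i : Fin (n + 1)) (s : ℝ), R ≤ |s| → ∀ x : Fin (n + 1) → ℝ,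
      indicator β (w i.succ) (ofComp (i.succ.insertNth (α := fun _ => ℝ) s x)) = 0 := by
    intro i s hs x
    refine indicator_of_notMem (fun h => ?_) _
    have h1 := hcoord _ h.2 i
    have h2 : (ofComp (i.succ.insertNth (α := fun _ => ℝ) s x)).2 i = s :=
      show Fin.insertNth (α := fun _ => ℝ) i.succ s x i.succ = s from
        Fin.insertNth_apply_same _ _ _
    rw [h2] at h1
    exact absurd hs (not_le.2 h1)
  have hRabs : R ≤ |R| := le_abs_self R
  have hRabs' : R ≤ |-R| := by rw [abs_neg]; exact hRabs
  rw [hvol, Fin.sum_univ_succ, Fin.sum_univ_succ] at key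
  have e1 : ∀ x, indicator β (w (Fin.succ 0)) (ofComp ((Fin.succ 0 : Fin (n + 2)).insertNth
      (α := fun _ => ℝ) (hi (Fin.succ 0)) x)) = 0 := hzero 0 _ hRabs
  have e2 : ∀ (i : Fin n) x, indicator β (w i.succ.succ) (ofComp (i.succ.succ.insertNth
      (α := fun _ => ℝ) (hi i.succ.succ) x)) = 0 := fun i => hzero i.succ _ hRabs
  have e3 : ∀ (i : Fin n) x, indicator β (w i.succ.succ) (ofComp (i.succ.succ.insertNth
      (α := fun _ => ℝ) (lo i.succ.succ) x)) = 0 := fun i => hzero i.succ _ hRabs'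
  simp only [e1, e2, e3, integral_zero, sub_zero, Finset.sum_const_zero, add_zero, hface] at key
  rw [key]
  have e4 : hi 0 = t := rfl
  have e5 : lo 0 = 0 := rfl
  rw [e4, e5, zero_sub, ← hlat]
  exact (sub_eq_add_neg _ _).symm

end Divergence

/-! ### Uniform bounds for quadratic forms -/

theorem exists_quadratic_bound {Z : Type*} [TopologicalSpace Z] [T2Space Z] {K : Set Z}
    (hK : IsCompact K) {m : ℕ} {f h : Z → (Fin m → ℝ) → ℝ}
    (hf : ContinuousOn (fun p : Z × (Fin m → ℝ) => f p.1 p.2) (K ×ˢ univ))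
    (hh : ContinuousOn (fun p : Z × (Fin m → ℝ) => h p.1 p.2) (K ×ˢ univ))
    (hf2 : ∀ z ∈ K, ∀ (c : ℝ) ξ, f z (c • ξ) = c ^ 2 * f z ξ)
    (hh2 : ∀ z ∈ K, ∀ (c : ℝ) ξ, h z (c • ξ) = c ^ 2 * h z ξ)
    (hh0 : ∀ z ∈ K, ∀ ξ, 0 ≤ h z ξ)
    (hfh : ∀ z ∈ K, ∀ ξ, ξ ≠ 0 → h z ξ = 0 → f z ξ < 0) :
    ∃ c C : ℝ, 0 < c ∧ 0 < C ∧ ∀ z ∈ K, ∀ ξ, f z ξ ≤ -c * ‖ξ‖ ^ 2 + C * h z ξ := by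
  set S : Set (Z × (Fin m → ℝ)) := K ×ˢ Metric.sphere 0 1 with hS
  have hSc : IsCompact S := hK.prod (isCompact_sphere _ _)
  have hSK : S ⊆ K ×ˢ univ := prod_mono_right (subset_univ _)
  have hS0 : ∀ p ∈ S, p.2 ≠ 0 := fun p hp h0 => by
    have := hp.2
    rw [h0] at this
    simp at this
  obtain ⟨C, hC, hCS⟩ : ∃ C : ℝ, 0 < C ∧ ∀ p ∈ S, f p.1 p.2 - C * h p.1 p.2 < 0 := by
    set S' := S ∩ (fun p : Z × (Fin m → ℝ) => f p.1 p.2) ⁻¹' Ici 0 with hS'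
    have hS'c : IsCompact S' := hSc.of_isClosed_subset
      ((hf.mono hSK).preimage_isClosed_of_isClosed hSc.isClosed isClosed_Ici) inter_subset_left
    rcases S'.eq_empty_or_nonempty with h0 | hne
    · refine ⟨1, one_pos, fun p hp => ?_⟩
      have h1 : ¬ (0 ≤ f p.1 p.2) := fun hp' => by
        have : p ∈ S' := ⟨hp, hp'⟩
        rw [h0] at this
        exact this
      have := hh0 p.1 hp.1 p.2
      linarith [not_le.1 h1]
    · obtain ⟨p₁, hp₁, hmin⟩ := hS'c.exists_isMinOn hne (hh.mono (inter_subset_left.trans hSK))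
      obtain ⟨p₂, hp₂, hmax⟩ := hS'c.exists_isMaxOn hne (hf.mono (inter_subset_left.trans hSK))
      have hpos : 0 < h p₁.1 p₁.2 := by
        refine lt_of_le_of_ne (hh0 _ hp₁.1.1 _) fun h0 => ?_
        exact absurd (hfh _ hp₁.1.1 _ (hS0 _ hp₁.1) h0.symm) (not_lt.2 hp₁.2)
      have h2 : 0 ≤ f p₂.1 p₂.2 := hp₂.2
      refine ⟨f p₂.1 p₂.2 / h p₁.1 p₁.2 + 1, by positivity, fun p hp => ?_⟩
      by_cases hp' : 0 ≤ f p.1 p.2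
      · have h3 : h p₁.1 p₁.2 ≤ h p.1 p.2 := hmin (show p ∈ S' from ⟨hp, hp'⟩)
        have h4 : f p.1 p.2 ≤ f p₂.1 p₂.2 := hmax (show p ∈ S' from ⟨hp, hp'⟩)
        have h5 : f p₂.1 p₂.2 ≤ f p₂.1 p₂.2 / h p₁.1 p₁.2 * h p.1 p.2 := by
          rw [div_mul_eq_mul_div, le_div_iff₀ hpos]
          exact mul_le_mul_of_nonneg_left h3 h2
        linarith
      · have := mul_nonneg (by positivity : 0 ≤ f p₂.1 p₂.2 / h p₁.1 p₁.2 + 1)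
          (hh0 p.1 hp.1 p.2)
        linarith [not_le.1 hp']
  obtain ⟨c, hc, hcS⟩ : ∃ c : ℝ, 0 < c ∧ ∀ p ∈ S, f p.1 p.2 - C * h p.1 p.2 ≤ -c := by
    rcases S.eq_empty_or_nonempty with h0 | hne
    · exact ⟨1, one_pos, fun p hp => by rw [h0] at hp; exact hp.elim⟩
    · obtain ⟨p₁, hp₁, hmax⟩ := hSc.exists_isMaxOn hne
        ((hf.mono hSK).sub (continuousOn_const (c := C) |>.mul (hh.mono hSK)))
      exact ⟨-(f p₁.1 p₁.2 - C * h p₁.1 p₁.2), neg_pos.2 (hCS _ hp₁), fun p hp => by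
        rw [neg_neg]; exact hmax hp⟩
  refine ⟨c, C, hc, hC, fun z hz ξ => ?_⟩
  by_cases hξ : ξ = 0
  · have h1 := hf2 z hz 0 0
    have h2 := hh2 z hz 0 0
    rw [smul_zero] at h1 h2
    rw [hξ, h1, h2]
    simp
  · have hn : 0 < ‖ξ‖ := norm_pos_iff.2 hξ
    have h1 := hcS (z, ‖ξ‖⁻¹ • ξ) ⟨hz, by
      rw [mem_sphere_zero_iff_norm, norm_smul, norm_inv, norm_norm, inv_mul_cancel₀ hn.ne']⟩
    simp only [hf2 z hz, hh2 z hz] at h1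
    have h2 := mul_le_mul_of_nonneg_left h1 (sq_nonneg ‖ξ‖)
    have h3 : ‖ξ‖ ^ 2 * (‖ξ‖⁻¹ ^ 2 * f z ξ - C * (‖ξ‖⁻¹ ^ 2 * h z ξ)) = f z ξ - C * h z ξ := by
      field_simp
    rw [h3] at h2
    linarith

theorem exists_quadratic_upper_bound {Z : Type*} [TopologicalSpace Z] [T2Space Z] {K : Set Z}
    (hK : IsCompact K) {m : ℕ} {f : Z → (Fin m → ℝ) → ℝ}
    (hf : ContinuousOn (fun p : Z × (Fin m → ℝ) => f p.1 p.2) (K ×ˢ univ))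
    (hf2 : ∀ z ∈ K, ∀ (c : ℝ) ξ, f z (c • ξ) = c ^ 2 * f z ξ) :
    ∃ C : ℝ, 0 < C ∧ ∀ z ∈ K, ∀ ξ, f z ξ ≤ C * ‖ξ‖ ^ 2 := by
  obtain ⟨c, C, hc, hC, h⟩ := exists_quadratic_bound hK (h := fun _ ξ => ‖ξ‖ ^ 2) hf
    (by fun_prop) hf2 (fun z _ c ξ => by rw [norm_smul, mul_pow, Real.norm_eq_abs, sq_abs])
    (fun z _ ξ => by positivity)
    (fun z _ ξ hξ h0 => absurd h0 (by positivity))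
  refine ⟨C, hC, fun z hz ξ => (h z hz ξ).trans ?_⟩
  have : 0 ≤ c * ‖ξ‖ ^ 2 := by positivity
  linarith

theorem current_smul {m : ℕ} (H : Matrix (Fin m) (Fin m) ℝ) (u ξ : Fin m → ℝ) (c : ℝ)
    (a : Fin m) : current H u (c • ξ) a = c ^ 2 * current H u ξ a := by
  simp only [current, Matrix.mulVec_smul, dotProduct_smul, smul_dotProduct, Pi.smul_apply,
    smul_eq_mul]
  ring

theorem current_eq_sum {m : ℕ} (H : Matrix (Fin m) (Fin m) ℝ) (u ξ : Fin m → ℝ) (a : Fin m) :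
    current H u ξ a = ∑ b, ∑ c, (-u a * H b c + 2 * H a b * u c) * (ξ b * ξ c) := by
  have h1 : ξ ⬝ᵥ H *ᵥ ξ = ∑ b, ∑ c, H b c * (ξ b * ξ c) := by
    simp only [dotProduct, Matrix.mulVec, Finset.mul_sum]
    exact Finset.sum_congr rfl fun b _ => Finset.sum_congr rfl fun c _ => by ring
  have h2 : (H *ᵥ ξ) a * (u ⬝ᵥ ξ) = ∑ b, ∑ c, H a b * u c * (ξ b * ξ c) := by
    simp only [dotProduct, Matrix.mulVec, Finset.sum_mul_sum]
    exact Finset.sum_congr rfl fun b _ => Finset.sum_congr rfl fun c _ => by ring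
  rw [current, mul_assoc, h1, h2, Finset.mul_sum, Finset.mul_sum, ← Finset.sum_add_distrib]
  refine Finset.sum_congr rfl fun b _ => ?_
  rw [Finset.mul_sum, Finset.mul_sum, ← Finset.sum_add_distrib]
  exact Finset.sum_congr rfl fun c _ => by ring

/-- The terms of the divergence of the current that contain derivatives `∂_a ξ_b = D a b`
collapse if `uᵃ (∂_a ξ_b - ∂_b ξ_a) = 0`. -/
theorem sum_current_deriv {m : ℕ} {H : Matrix (Fin m) (Fin m) ℝ} (hH : Hᵀ = H)
    {u ξ : Fin m → ℝ} {D : Fin m → Fin m → ℝ} (hD : ∀ b, ∑ a, u a * D a b = ∑ a, u a * D b a) :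
    ∑ a, ∑ b, ∑ c, (-u a * H b c + 2 * H a b * u c) * (D a b * ξ c + ξ b * D a c) =
      2 * (u ⬝ᵥ ξ) * ∑ a, ∑ b, H a b * D a b := by
  have hs : ∀ a b, H a b = H b a := fun a b => (congrFun (congrFun hH a) b).symm
  set p : Fin m → ℝ := fun b => ∑ a, u a * D a b with hp
  have t1 : ∑ a, ∑ b, ∑ c, u a * H b c * (D a b * ξ c) = ∑ b, ∑ c, H b c * ξ c * p b := by
    rw [Finset.sum_comm]
    refine Finset.sum_congr rfl fun b _ => ?_
    rw [Finset.sum_comm]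
    refine Finset.sum_congr rfl fun c _ => ?_
    rw [hp, Finset.mul_sum]
    exact Finset.sum_congr rfl fun a _ => by ring
  have t2 : ∑ a, ∑ b, ∑ c, u a * H b c * (ξ b * D a c) = ∑ b, ∑ c, H b c * ξ c * p b := by
    rw [Finset.sum_comm]
    rw [Finset.sum_comm (f := fun b c => H b c * ξ c * p b)]
    refine Finset.sum_congr rfl fun b _ => ?_
    rw [Finset.sum_comm]
    refine Finset.sum_congr rfl fun c _ => ?_
    rw [hp, Finset.mul_sum]
    exact Finset.sum_congr rfl fun a _ => by rw [hs b c]; ring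
  have t3 : ∑ a, ∑ b, ∑ c, H a b * u c * (D a b * ξ c) =
      (u ⬝ᵥ ξ) * ∑ a, ∑ b, H a b * D a b := by
    rw [Finset.mul_sum]
    refine Finset.sum_congr rfl fun a _ => ?_
    rw [Finset.mul_sum]
    refine Finset.sum_congr rfl fun b _ => ?_
    rw [dotProduct, Finset.sum_mul]
    exact Finset.sum_congr rfl fun c _ => by ring
  have t4 : ∑ a, ∑ b, ∑ c, H a b * u c * (ξ b * D a c) = ∑ b, ∑ c, H b c * ξ c * p b := by
    refine Finset.sum_congr rfl fun a _ => Finset.sum_congr rfl fun b _ => ?_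
    simp only [hp]
    rw [hD, Finset.mul_sum]
    exact Finset.sum_congr rfl fun c _ => by ring
  have hsplit : ∀ a b c, (-u a * H b c + 2 * H a b * u c) * (D a b * ξ c + ξ b * D a c) =
      2 * (H a b * u c * (D a b * ξ c)) + 2 * (H a b * u c * (ξ b * D a c))
        - u a * H b c * (D a b * ξ c) - u a * H b c * (ξ b * D a c) := fun a b c => by ring
  simp only [hsplit, Finset.sum_add_distrib, Finset.sum_sub_distrib, ← Finset.mul_sum]
  rw [t1, t2, t3, t4]
  ring

/-! ### Estimates in a coordinate chart -/

theorem comp_map_add_smul {n : ℕ} (A : Vec n →L[ℝ] Vec n) (v w : Vec n) (c : ℝ) (b : Fin (n + 2)) :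
    comp (A (v + c • w)) b = comp (A v) b + c * comp (A w) b := by
  rw [map_add, map_smul, comp_add, comp_smul]
  rfl

theorem map_add_smul_apply {n : ℕ} (η : Vec n →L[ℝ] ℝ) (v w : Vec n) (c : ℝ) :
    η (v + c • w) = η v + c * η w := by
  rw [map_add, map_smul, smul_eq_mul]

section ChartEstimates

variable {n : ℕ} {X : Type*} [TopologicalSpace X] [ChartedSpace (EuclideanHalfSpace (n + 1)) X]

/-- The coordinate components of the energy current density `√|g| 𝒜ᵃ_{bc} ξᵇ ξᶜ`. -/
def chartCurrent (g : MetricField n X) (u : VectorField n X) (x₀ : X) (a : Fin (n + 2))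
    (z : Vec n) (ξ : Fin (n + 2) → ℝ) : ℝ :=
  volumeElement g x₀ z * current (metricMatrix g x₀ z)⁻¹ (vectorCoord u x₀ z) ξ a

theorem chartCurrent_smul (g : MetricField n X) (u : VectorField n X) (x₀ : X) (a : Fin (n + 2))
    (z : Vec n) (c : ℝ) (ξ : Fin (n + 2) → ℝ) :
    chartCurrent g u x₀ a z (c • ξ) = c ^ 2 * chartCurrent g u x₀ a z ξ := by
  rw [chartCurrent, current_smul, chartCurrent]
  ring

theorem ContinuousOn.comp_fst' {Z Z' : Type*} [TopologicalSpace Z] [TopologicalSpace Z']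
    {s : Set Z} {f : Z → ℝ} (hf : ContinuousOn f s) :
    ContinuousOn (fun p : Z × Z' => f p.1) (s ×ˢ univ) :=
  hf.comp continuousOn_fst fun _ hp => hp.1

variable [IsManifold (𝓡∂ (n + 1)) ∞ X] {T : ℝ} {g : MetricField n X} {u τ : VectorField n X}
  {α : ℝ × X → ℝ} {ρ : ℝ}

theorem continuousOn_current (hg : IsSlabMetric T g) (hu : u.SmoothOn ∞ (slab X T)) (x₀ : X)
    (a : Fin (n + 2)) :
    ContinuousOn (fun p : Vec n × (Fin (n + 2) → ℝ) =>
      current (metricMatrix g x₀ p.1)⁻¹ (vectorCoord u x₀ p.1) p.2 a)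
      (coordDomain T x₀ ×ˢ univ) := by
  simp only [current_eq_sum]
  have hG := fun b c => ContinuousOn.comp_fst' (Z' := Fin (n + 2) → ℝ)
    (contDiffOn_inv_metricMatrix hg x₀ b c).continuousOn
  have hU := fun b => ContinuousOn.comp_fst' (Z' := Fin (n + 2) → ℝ)
    (contDiffOn_vectorCoord hg hu x₀ b).continuousOn
  refine continuousOn_finsetSum _ fun b _ => continuousOn_finsetSum _ fun c _ => ?_
  exact (((hU a).neg.mul (hG b c)).add ((continuousOn_const.mul (hG a b)).mul (hU c))).mul
    (Continuous.continuousOn (by fun_prop))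

theorem continuousOn_chartCurrent (hg : IsSlabMetric T g) (hu : u.SmoothOn ∞ (slab X T)) (x₀ : X)
    (a : Fin (n + 2)) :
    ContinuousOn (fun p : Vec n × (Fin (n + 2) → ℝ) => chartCurrent g u x₀ a p.1 p.2)
      (coordDomain T x₀ ×ˢ univ) :=
  (ContinuousOn.comp_fst' (contDiffOn_volumeElement hg x₀).continuousOn).mul
    (continuousOn_current hg hu x₀ a)

theorem metricMatrix_inv_zero_neg (hg : IsSlabMetric T g) {x₀ : X} {z : Vec n}
    (hz : z ∈ coordDomain T x₀) : (metricMatrix g x₀ z)⁻¹ 0 0 < 0 :=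
  gram_inv_zero_neg (coordFrame_isInvertible hz.2) (coordFrame_fst hz.2)
    (hg.lorentz _ (chartParam_mem_slab hz)) (hg.spacelike_slices _ (chartParam_mem_slab hz))

theorem metricMatrix_inv_one_pos (hg : IsSlabMetric T g) {x₀ : X} {z : Vec n}
    (hz : z ∈ coordDomain T x₀) (hz0 : z.2 0 = 0) : 0 < (metricMatrix g x₀ z)⁻¹ 1 1 := by
  obtain ⟨l, hl, h⟩ := exists_coordFrame_normal hz.2 hz0
  exact gram_inv_one_pos (coordFrame_isInvertible hz.2) h hl
    (hg.lorentz _ (chartParam_mem_slab hz)) (hg.timelike_lateral _ (chartParam_mem_lateral hz hz0))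

theorem energyDensity_chart_eq (hg : IsSlabMetric T g) (u : VectorField n X)
    (V : CovectorField n X) {x₀ : X} {z : Vec n} (hz : z ∈ coordDomain T x₀) :
    energyDensity (n := n) (g (chartParam x₀ z)) (u (chartParam x₀ z)) (V (chartParam x₀ z)) =
      -(Real.sqrt (-(metricMatrix g x₀ z)⁻¹ 0 0))⁻¹ *
        current (metricMatrix g x₀ z)⁻¹ (vectorCoord u x₀ z) (covectorCoord V x₀ z) 0 :=
  energyDensity_eq_current (coordFrame_isInvertible hz.2) (coordFrame_fst hz.2)
    (hg.lorentz _ (chartParam_mem_slab hz)) _ _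

theorem density_mul_energyDensity (hg : IsSlabMetric T g) {x₀ : X} {z : Vec n}
    (hz : z ∈ coordDomain T x₀) (V : CovectorField n X) :
    hypersurfaceDensity g x₀ 0 z * energyDensity (n := n) (g (chartParam x₀ z))
      (u (chartParam x₀ z)) (V (chartParam x₀ z)) =
        -chartCurrent g u x₀ 0 z (covectorCoord V x₀ z) := by
  have hneg := metricMatrix_inv_zero_neg hg hz
  have hpos : 0 < Real.sqrt (-(metricMatrix g x₀ z)⁻¹ 0 0) := Real.sqrt_pos.2 (by linarith)
  rw [hypersurfaceDensity_eq hg 0 hz, abs_of_neg hneg, energyDensity_chart_eq hg u V hz,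
    chartCurrent]
  field_simp

theorem hypersurfaceDensity_zero_pos (hg : IsSlabMetric T g) {x₀ : X} {z : Vec n}
    (hz : z ∈ coordDomain T x₀) : 0 < hypersurfaceDensity g x₀ 0 z := by
  rw [hypersurfaceDensity_eq hg 0 hz]
  exact mul_pos (volumeElement_pos hg hz)
    (Real.sqrt_pos.2 (abs_pos.2 (metricMatrix_inv_zero_neg hg hz).ne))

theorem hypersurfaceDensity_one_pos (hg : IsSlabMetric T g) {x₀ : X} {z : Vec n}
    (hz : z ∈ coordDomain T x₀) (hz0 : z.2 0 = 0) : 0 < hypersurfaceDensity g x₀ 1 z := by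
  rw [hypersurfaceDensity_eq hg 1 hz]
  exact mul_pos (volumeElement_pos hg hz)
    (Real.sqrt_pos.2 (abs_pos.2 (metricMatrix_inv_one_pos hg hz hz0).ne'))

/-- The energy density is uniformly positive definite on compact sets. -/
theorem exists_chartCurrent_zero_bound (hg : IsSlabMetric T g) (hu : u.SmoothOn ∞ (slab X T))
    (hu_future : ∀ p ∈ slab X T, IsFutureTimelike (n := n) (g p) (u p)) {x₀ : X}
    {K : Set (Vec n)} (hK : IsCompact K) (hKD : K ⊆ coordDomain T x₀) :
    ∃ c : ℝ, 0 < c ∧ ∀ z ∈ K, ∀ ξ, c * ‖ξ‖ ^ 2 ≤ -chartCurrent g u x₀ 0 z ξ := by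
  obtain ⟨c, C, hc, hC, h⟩ := exists_quadratic_bound hK (h := fun _ _ => 0)
    ((continuousOn_chartCurrent hg hu x₀ 0).mono (prod_mono_left hKD)) continuousOn_const
    (fun z _ => chartCurrent_smul g u x₀ 0 z) (by simp) (by simp) (fun z hz ξ hξ _ => by
      have hzD := hKD hz
      exact mul_neg_of_pos_of_neg (volumeElement_pos hg hzD)
        (current_zero_neg (coordFrame_isInvertible hzD.2) (coordFrame_fst hzD.2)
          (hg.lorentz _ (chartParam_mem_slab hzD))
          (hg.spacelike_slices _ (chartParam_mem_slab hzD))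
          (hu_future _ (chartParam_mem_slab hzD)) hξ))
  exact ⟨c, hc, fun z hz ξ => by have := h z hz ξ; linarith⟩

theorem exists_inv_bound {Z : Type*} [TopologicalSpace Z] {K : Set Z} (hK : IsCompact K)
    {f : Z → ℝ} (hf : ContinuousOn f K) (hpos : ∀ z ∈ K, 0 < f z) :
    ∃ M : ℝ, 0 < M ∧ ∀ z ∈ K, 1 ≤ M * f z := by
  obtain ⟨M, hM⟩ := hK.exists_bound_of_continuousOn (hf.inv₀ fun z hz => (hpos z hz).ne')
  simp only [Pi.inv_apply] at hM
  refine ⟨max M 1, by positivity, fun z hz => ?_⟩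
  have h1 := (le_abs_self _).trans (hM z hz)
  rw [inv_le_iff_one_le_mul₀ (hpos z hz)] at h1
  exact h1.trans (mul_le_mul_of_nonneg_right (le_max_left _ _) (hpos z hz).le)

/-- The components of the vector `T + α N` on the lateral boundary, where `u = T + δ N`. -/
def boundaryVector (g : MetricField n X) (u : VectorField n X) (α : ℝ × X → ℝ) (ρ : ℝ) (x₀ : X)
    (z : Vec n) (b : Fin (n + 2)) : ℝ :=
  vectorCoord u x₀ z b + (α (chartParam x₀ z) -
    (1 - ρ) * (α (chartParam x₀ z) / (1 + α (chartParam x₀ z) ^ 2))) *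
      (-(Real.sqrt ((metricMatrix g x₀ z)⁻¹ 1 1))⁻¹ * (metricMatrix g x₀ z)⁻¹ b 1)

theorem continuousOn_boundaryVector (hg : IsSlabMetric T g)
    (hα : ContMDiffOn (stModel n) 𝓘(ℝ, ℝ) ∞ α (lateral n X T))
    (hu : u.SmoothOn ∞ (slab X T)) (ρ : ℝ) (x₀ : X) (b : Fin (n + 2)) :
    ContinuousOn (fun z => boundaryVector g u α ρ x₀ z b) (coordDomain T x₀ ∩ {z | z.2 0 = 0}) := by
  have hac : ContinuousOn (fun z => α (chartParam x₀ z)) (coordDomain T x₀ ∩ {z | z.2 0 = 0}) :=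
    hα.continuousOn.comp ((contMDiffOn_chartParam x₀).continuousOn.mono
      fun z hz => ⟨mem_univ _, hz.1.2⟩) fun z hz => chartParam_mem_lateral hz.1 hz.2
  have hGc := fun b c => (contDiffOn_inv_metricMatrix hg x₀ b c).continuousOn.mono
    (inter_subset_left (s := coordDomain T x₀) (t := {z | z.2 0 = 0}))
  refine ((contDiffOn_vectorCoord hg hu x₀ b).continuousOn.mono inter_subset_left).add
    ((hac.sub (continuousOn_const.mul (hac.div (continuousOn_const.add (hac.pow 2))
      fun z hz => (by positivity : 0 < 1 + α (chartParam x₀ z) ^ 2).ne'))).mul (((hGc 1 1).sqrt.inv₀ fun z hz => ?_).neg.mul (hGc b 1)))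
  exact (Real.sqrt_pos.2 (metricMatrix_inv_one_pos hg hz.1 hz.2)).ne'

theorem comp_boundaryVector (hg : IsSlabMetric T g)
    (hu_lateral : ∀ p ∈ lateral n X T,
      u p = τ p + ((1 - ρ) * (α p / (1 + α p ^ 2))) • lateralNormal g p)
    {x₀ : X} {z : Vec n} (hz : z ∈ coordDomain T x₀) (hz0 : z.2 0 = 0) :
    comp ((coordFrame x₀ z).inverse (τ (chartParam x₀ z) +
      α (chartParam x₀ z) • lateralNormal g (chartParam x₀ z))) =
        boundaryVector g u α ρ x₀ z := by
  obtain ⟨l, hl, hA1⟩ := exists_coordFrame_normal hz.2 hz0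
  have h1 : τ (chartParam x₀ z) + α (chartParam x₀ z) • lateralNormal g (chartParam x₀ z) =
      u (chartParam x₀ z) + (α (chartParam x₀ z) -
        (1 - ρ) * (α (chartParam x₀ z) / (1 + α (chartParam x₀ z) ^ 2))) •
          lateralNormal g (chartParam x₀ z) := by
    rw [hu_lateral _ (chartParam_mem_lateral hz hz0), add_assoc, ← add_smul]
    congr 2
    ring
  funext b
  have h2 := comp_outwardNormal (coordFrame_isInvertible hz.2) hA1 hl
    (hg.lorentz _ (chartParam_mem_slab hz)) b
  exact (congrArg (fun v : Vec n => comp ((coordFrame x₀ z).inverse v) b) h1).trans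
    ((comp_map_add_smul _ _ _ _ b).trans (congrArg₂ (· + ·) rfl (congrArg _ h2)))

theorem boundary_apply_eq (hg : IsSlabMetric T g)
    (hu_lateral : ∀ p ∈ lateral n X T,
      u p = τ p + ((1 - ρ) * (α p / (1 + α p ^ 2))) • lateralNormal g p)
    (V : CovectorField n X) {x₀ : X} {z : Vec n} (hz : z ∈ coordDomain T x₀) (hz0 : z.2 0 = 0) :
    V (chartParam x₀ z) (τ (chartParam x₀ z)) +
      α (chartParam x₀ z) * V (chartParam x₀ z) (lateralNormal g (chartParam x₀ z)) =
        boundaryVector g u α ρ x₀ z ⬝ᵥ covectorCoord V x₀ z := by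
  have h1 := apply_eq_covComp (coordFrame_isInvertible hz.2) (V (chartParam x₀ z))
    (τ (chartParam x₀ z) + α (chartParam x₀ z) • lateralNormal g (chartParam x₀ z))
  rw [comp_boundaryVector hg hu_lateral hz hz0] at h1
  exact (map_add_smul_apply (V (chartParam x₀ z) : Vec n →L[ℝ] ℝ) _ _ _).symm.trans h1

/-- The energy flux through the boundary controls the energy density on the boundary, up to the
boundary data. -/
theorem exists_lateral_bound (hg : IsSlabMetric T g) (hτ : IsBoundaryTimeField T g τ)
    (hα : ContMDiffOn (stModel n) 𝓘(ℝ, ℝ) ∞ α (lateral n X T))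
    (hα_pos : ∀ p ∈ lateral n X T, 0 < α p) (hρ_pos : 0 < ρ) (hρ_lt : ρ < 1)
    (hu : u.SmoothOn ∞ (slab X T))
    (hu_lateral : ∀ p ∈ lateral n X T,
      u p = τ p + ((1 - ρ) * (α p / (1 + α p ^ 2))) • lateralNormal g p)
    {x₀ : X} {K : Set (Vec n)} (hK : IsCompact K) (hKD : K ⊆ coordDomain T x₀)
    (hK0 : ∀ z ∈ K, z.2 0 = 0) :
    ∃ A B : ℝ, 1 ≤ A ∧ 0 < B ∧ ∀ z ∈ K, ∀ V : CovectorField n X,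
      hypersurfaceDensity g x₀ 1 z * energyDensity (n := n) (g (chartParam x₀ z))
        (u (chartParam x₀ z)) (V (chartParam x₀ z)) ≤
      A * chartCurrent g u x₀ 1 z (covectorCoord V x₀ z) +
        B * (hypersurfaceDensity g x₀ 1 z * (V (chartParam x₀ z) (τ (chartParam x₀ z)) +
          α (chartParam x₀ z) * V (chartParam x₀ z) (lateralNormal g (chartParam x₀ z))) ^ 2) := by
  set γ : Vec n → (Fin (n + 2) → ℝ) → ℝ := fun z ξ => boundaryVector g u α ρ x₀ z ⬝ᵥ ξ with hγ
  have hlat : ∀ z ∈ K, chartParam x₀ z ∈ lateral n X T := fun z hz =>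
    chartParam_mem_lateral (hKD hz) (hK0 z hz)
  have hGc := fun b c => (contDiffOn_inv_metricMatrix hg x₀ b c).continuousOn.mono hKD
  have hγc : ContinuousOn (fun p : Vec n × (Fin (n + 2) → ℝ) => γ p.1 p.2) (K ×ˢ univ) :=
    continuousOn_finsetSum _ fun b _ => (ContinuousOn.comp_fst'
      ((continuousOn_boundaryVector hg hα hu ρ x₀ b).mono fun z hz => ⟨hKD hz, hK0 z hz⟩)).mul
        (Continuous.continuousOn (by fun_prop))
  have hγ2 : ∀ z c ξ, γ z (c • ξ) = c * γ z ξ := fun z c ξ => by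
    simp only [hγ, dotProduct_smul, smul_eq_mul]
  obtain ⟨c, C, hc, hC, hflux⟩ := exists_quadratic_bound hK
    (f := fun z ξ => -chartCurrent g u x₀ 1 z ξ) (h := fun z ξ => γ z ξ ^ 2)
    ((continuousOn_chartCurrent hg hu x₀ 1).mono (prod_mono_left hKD)).neg (hγc.pow 2)
    (fun z _ c ξ => by rw [chartCurrent_smul]; ring)
    (fun z _ c ξ => by rw [hγ2]; ring) (fun z _ ξ => sq_nonneg _) (fun z hz ξ hξ h0 => by
      obtain ⟨l, hl, hA1⟩ := exists_coordFrame_normal (hKD hz).2 (hK0 z hz)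
      have h1 := current_one_pos (coordFrame_isInvertible (hKD hz).2) hA1 hl
        (hg.lorentz _ (chartParam_mem_slab (hKD hz))) (hg.timelike_lateral _ (hlat z hz))
        (hτ.unit _ (hlat z hz)) (hτ.tangent _ (hlat z hz)) (hα_pos _ (hlat z hz)) hρ_pos hρ_lt hξ
        ((congrArg (· ⬝ᵥ ξ) (comp_boundaryVector hg hu_lateral (hKD hz) (hK0 z hz))).trans (pow_eq_zero_iff two_ne_zero |>.1 h0))
      have h2 : vectorCoord u x₀ z = comp ((coordFrame x₀ z).inverse (τ (chartParam x₀ z) +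
          ((1 - ρ) * (α (chartParam x₀ z) / (1 + α (chartParam x₀ z) ^ 2))) •
            lateralNormal g (chartParam x₀ z))) := by
        rw [vectorCoord_eq_comp, hu_lateral _ (hlat z hz)]
        rfl
      have h3 : 0 < current (metricMatrix g x₀ z)⁻¹ (vectorCoord u x₀ z) ξ 1 := by
        rw [h2]
        exact h1
      exact neg_neg_of_pos (mul_pos (volumeElement_pos hg (hKD hz)) h3))
  have hρc : ContinuousOn (hypersurfaceDensity g x₀ 1) K :=
    (continuousOn_hypersurfaceDensity hg x₀ 1).mono hKD
  have hρpos : ∀ z ∈ K, 0 < hypersurfaceDensity g x₀ 1 z := fun z hz =>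
    hypersurfaceDensity_one_pos hg (hKD hz) (hK0 z hz)
  have hG0 : ∀ z ∈ K, 0 < -(metricMatrix g x₀ z)⁻¹ 0 0 := fun z hz =>
    neg_pos.2 (metricMatrix_inv_zero_neg hg (hKD hz))
  obtain ⟨C₂, hC₂, hen⟩ := exists_quadratic_upper_bound hK
    (f := fun z ξ => hypersurfaceDensity g x₀ 1 z * -(Real.sqrt (-(metricMatrix g x₀ z)⁻¹ 0 0))⁻¹ *
      current (metricMatrix g x₀ z)⁻¹ (vectorCoord u x₀ z) ξ 0)
    ((ContinuousOn.comp_fst' (f := fun z => hypersurfaceDensity g x₀ 1 z *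
      -(Real.sqrt (-(metricMatrix g x₀ z)⁻¹ 0 0))⁻¹) (hρc.mul (((hGc 0 0).neg.sqrt.inv₀
        fun z hz => (Real.sqrt_pos.2 (hG0 z hz)).ne').neg))).mul
      ((continuousOn_current hg hu x₀ 0).mono (prod_mono_left hKD)))
    (fun z _ c ξ => by rw [current_smul]; ring)
  obtain ⟨M, hM, hMρ⟩ := exists_inv_bound hK hρc hρpos
  set A := max 1 (C₂ / c) with hA
  have hA1 : 1 ≤ A := le_max_left _ _
  have hAc : C₂ ≤ A * c := (div_le_iff₀ hc).1 (le_max_right _ _)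
  refine ⟨A, A * C * M, hA1, by positivity, fun z hz V => ?_⟩
  rw [boundary_apply_eq hg hu_lateral V (hKD hz) (hK0 z hz)]
  have h1 := hen z hz (covectorCoord V x₀ z)
  have h2 := hflux z hz (covectorCoord V x₀ z)
  rw [energyDensity_chart_eq hg u V (hKD hz), ← mul_assoc]
  set ξ := covectorCoord V x₀ z
  have h4 : C₂ * ‖ξ‖ ^ 2 ≤ A * c * ‖ξ‖ ^ 2 := mul_le_mul_of_nonneg_right hAc (by positivity)
  have h5 : A * -chartCurrent g u x₀ 1 z ξ ≤ A * (-c * ‖ξ‖ ^ 2 + C * γ z ξ ^ 2) :=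
    mul_le_mul_of_nonneg_left h2 (by linarith)
  have h6 : A * C * γ z ξ ^ 2 * 1 ≤ A * C * γ z ξ ^ 2 * (M * hypersurfaceDensity g x₀ 1 z) :=
    mul_le_mul_of_nonneg_left (hMρ z hz) (by positivity)
  linarith

end ChartEstimates

/-! ### The divergence of the energy current -/

theorem partialDeriv_sum_mul {n m : ℕ} {D : Set (Vec n)} {z : Vec n} (hD : UniqueDiffWithinAt ℝ D z)
    {f h : Fin m → Vec n → ℝ} (hf : ∀ b, DifferentiableWithinAt ℝ (f b) D z)
    (hh : ∀ b, DifferentiableWithinAt ℝ (h b) D z) (a : Fin (n + 2)) :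
    partialDeriv D a (fun y => ∑ b, f b y * h b y) z =
      ∑ b, (partialDeriv D a (f b) z * h b z + f b z * partialDeriv D a (h b) z) := by
  have h1 : HasFDerivWithinAt (fun y => ∑ b, f b y * h b y)
      (∑ b, (f b z • fderivWithin ℝ (h b) D z + h b z • fderivWithin ℝ (f b) D z)) D z :=
    HasFDerivWithinAt.fun_sum fun b _ =>
      (hf b).hasFDerivWithinAt.mul (hh b).hasFDerivWithinAt
  rw [partialDeriv, h1.fderivWithin hD, sum_apply]
  refine Finset.sum_congr rfl fun b _ => ?_
  simp only [partialDeriv, add_apply, smul_apply, smul_eq_mul]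
  ring

theorem partialDeriv_sum_quadratic {n m : ℕ} {D : Set (Vec n)} {z : Vec n}
    (hD : UniqueDiffWithinAt ℝ D z) {κ : Fin m → Fin m → Vec n → ℝ} {ξ : Fin m → Vec n → ℝ}
    (hκ : ∀ b c, DifferentiableWithinAt ℝ (κ b c) D z)
    (hξ : ∀ b, DifferentiableWithinAt ℝ (ξ b) D z) (a : Fin (n + 2)) :
    partialDeriv D a (fun y => ∑ b, ∑ c, κ b c y * (ξ b y * ξ c y)) z =
      ∑ b, ∑ c, (partialDeriv D a (κ b c) z * (ξ b z * ξ c z) +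
        κ b c z * (partialDeriv D a (ξ b) z * ξ c z + ξ b z * partialDeriv D a (ξ c) z)) := by
  have h1 : HasFDerivWithinAt (fun y => ∑ b, ∑ c, κ b c y * (ξ b y * ξ c y))
      (∑ b, ∑ c, (κ b c z • (ξ b z • fderivWithin ℝ (ξ c) D z + ξ c z • fderivWithin ℝ (ξ b) D z) +
        (ξ b z * ξ c z) • fderivWithin ℝ (κ b c) D z)) D z :=
    HasFDerivWithinAt.fun_sum fun b _ => HasFDerivWithinAt.fun_sum fun c _ =>
      (hκ b c).hasFDerivWithinAt.mul
        ((hξ b).hasFDerivWithinAt.mul (hξ c).hasFDerivWithinAt)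
  rw [partialDeriv, h1.fderivWithin hD, sum_apply]
  refine Finset.sum_congr rfl fun b _ => ?_
  rw [sum_apply]
  refine Finset.sum_congr rfl fun c _ => ?_
  simp only [partialDeriv, add_apply, smul_apply, smul_eq_mul]
  ring

section Divergence

variable {n : ℕ} {X : Type*} [TopologicalSpace X] [ChartedSpace (EuclideanHalfSpace (n + 1)) X]

/-- The coefficients of the localized energy current as a quadratic form in the covector. -/
def currentCoeff (g : MetricField n X) (u : VectorField n X) (x₀ : X)
    (ψ : EuclideanSpace ℝ (Fin (n + 1)) → ℝ) (a b c : Fin (n + 2)) (z : Vec n) : ℝ :=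
  ψ z.2 * (volumeElement g x₀ z * (-vectorCoord u x₀ z a * (metricMatrix g x₀ z)⁻¹ b c +
    2 * (metricMatrix g x₀ z)⁻¹ a b * vectorCoord u x₀ z c))

theorem mul_chartCurrent_eq_sum (g : MetricField n X) (u : VectorField n X) (x₀ : X)
    (ψ : EuclideanSpace ℝ (Fin (n + 1)) → ℝ) (a : Fin (n + 2)) (z : Vec n)
    (ξ : Fin (n + 2) → ℝ) :
    ψ z.2 * chartCurrent g u x₀ a z ξ =
      ∑ b, ∑ c, currentCoeff g u x₀ ψ a b c z * (ξ b * ξ c) := by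
  rw [chartCurrent, current_eq_sum]
  simp only [Finset.mul_sum]
  refine Finset.sum_congr rfl fun b _ => Finset.sum_congr rfl fun c _ => ?_
  rw [currentCoeff]
  ring

/-- The part of the divergence of the localized energy current that is quadratic in the covector. -/
def divergenceForm (T : ℝ) (g : MetricField n X) (u : VectorField n X) (x₀ : X)
    (ψ : EuclideanSpace ℝ (Fin (n + 1)) → ℝ) (z : Vec n) (ξ : Fin (n + 2) → ℝ) : ℝ :=
  (∑ a, ∑ b, ∑ c, partialDeriv (coordDomain T x₀) a (currentCoeff g u x₀ ψ a b c) z *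
      (ξ b * ξ c)) +
    2 * ψ z.2 * volumeElement g x₀ z * (vectorCoord u x₀ z ⬝ᵥ ξ) *
      ∑ a, ∑ b, (metricMatrix g x₀ z)⁻¹ a b * ∑ c, christoffel T g x₀ z c a b * ξ c

theorem divergenceForm_smul (T : ℝ) (g : MetricField n X) (u : VectorField n X) (x₀ : X)
    (ψ : EuclideanSpace ℝ (Fin (n + 1)) → ℝ) (z : Vec n) (k : ℝ) (ξ : Fin (n + 2) → ℝ) :
    divergenceForm T g u x₀ ψ z (k • ξ) = k ^ 2 * divergenceForm T g u x₀ ψ z ξ := by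
  have h1 : ∑ a, ∑ b, ∑ c, partialDeriv (coordDomain T x₀) a (currentCoeff g u x₀ ψ a b c) z *
      ((k • ξ) b * (k • ξ) c) = k ^ 2 * ∑ a, ∑ b, ∑ c,
        partialDeriv (coordDomain T x₀) a (currentCoeff g u x₀ ψ a b c) z * (ξ b * ξ c) := by
    simp only [Finset.mul_sum]
    refine Finset.sum_congr rfl fun a _ => Finset.sum_congr rfl fun b _ =>
      Finset.sum_congr rfl fun c _ => ?_
    simp only [Pi.smul_apply, smul_eq_mul]
    ring
  have h2 : ∑ a, ∑ b, (metricMatrix g x₀ z)⁻¹ a b * ∑ c, christoffel T g x₀ z c a b * (k • ξ) c =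
      k * ∑ a, ∑ b, (metricMatrix g x₀ z)⁻¹ a b * ∑ c, christoffel T g x₀ z c a b * ξ c := by
    simp only [Finset.mul_sum]
    refine Finset.sum_congr rfl fun a _ => Finset.sum_congr rfl fun b _ =>
      Finset.sum_congr rfl fun c _ => ?_
    simp only [Pi.smul_apply, smul_eq_mul]
    ring
  rw [divergenceForm, h1, h2, dotProduct_smul, divergenceForm, smul_eq_mul]
  ring

variable [IsManifold (𝓡∂ (n + 1)) ∞ X] {T : ℝ} {g : MetricField n X} {u τ : VectorField n X}
  {α : ℝ × X → ℝ} {F : ℝ × X → ℝ} {φ₀ π₀ : X → ℝ} {G : ℝ × X → ℝ} {V : CovectorField n X}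

theorem contDiffOn_currentCoeff (hg : IsSlabMetric T g) (hu : u.SmoothOn ∞ (slab X T)) (x₀ : X)
    {ψ : EuclideanSpace ℝ (Fin (n + 1)) → ℝ} (hψ : ContDiff ℝ ∞ ψ) (a b c : Fin (n + 2)) :
    ContDiffOn ℝ ∞ (currentCoeff g u x₀ ψ a b c) (coordDomain T x₀) :=
  (hψ.comp contDiff_snd).contDiffOn.mul ((contDiffOn_volumeElement hg x₀).mul
    (((contDiffOn_vectorCoord hg hu x₀ a).neg.mul (contDiffOn_inv_metricMatrix hg x₀ b c)).add
      ((contDiffOn_const.mul (contDiffOn_inv_metricMatrix hg x₀ a b)).mul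
        (contDiffOn_vectorCoord hg hu x₀ c))))

theorem continuousOn_christoffel (hT : 0 < T) (hg : IsSlabMetric T g) (x₀ : X)
    (c a b : Fin (n + 2)) :
    ContinuousOn (fun z => christoffel T g x₀ z c a b) (coordDomain T x₀) := by
  have hm := fun a b d => continuousOn_partialDeriv (uniqueDiffOn_coordDomain hT x₀)
    ((contDiffOn_metricCoord hg x₀ a b).of_le (by exact_mod_cast le_top)) d
  exact continuousOn_const.mul (continuousOn_finsetSum _ fun d _ =>
    (contDiffOn_inv_metricMatrix hg x₀ c d).continuousOn.mul
      (((hm b d a).add (hm a d b)).sub (hm a b d)))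

theorem continuousOn_divergenceForm (hT : 0 < T) (hg : IsSlabMetric T g)
    (hu : u.SmoothOn ∞ (slab X T)) (x₀ : X)
    {ψ : EuclideanSpace ℝ (Fin (n + 1)) → ℝ} (hψ : ContDiff ℝ ∞ ψ) :
    ContinuousOn (fun p : Vec n × (Fin (n + 2) → ℝ) => divergenceForm T g u x₀ ψ p.1 p.2)
      (coordDomain T x₀ ×ˢ univ) := by
  have hξ : ∀ b, ContinuousOn (fun p : Vec n × (Fin (n + 2) → ℝ) => p.2 b)
      (coordDomain T x₀ ×ˢ univ) := fun b => Continuous.continuousOn (by fun_prop)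
  have hψc : ContinuousOn (fun p : Vec n × (Fin (n + 2) → ℝ) => ψ p.1.2)
      (coordDomain T x₀ ×ˢ univ) :=
    (hψ.continuous.comp (continuous_snd.comp continuous_fst)).continuousOn
  refine ContinuousOn.add ?_ ((((continuousOn_const.mul hψc).mul (ContinuousOn.comp_fst'
    (contDiffOn_volumeElement hg x₀).continuousOn)).mul ?_).mul ?_)
  · refine continuousOn_finsetSum _ fun a _ => continuousOn_finsetSum _ fun b _ =>
      continuousOn_finsetSum _ fun c _ => ContinuousOn.mul ?_ ((hξ b).mul (hξ c))
    exact ContinuousOn.comp_fst' (continuousOn_partialDeriv (uniqueDiffOn_coordDomain hT x₀)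
      ((contDiffOn_currentCoeff hg hu x₀ hψ a b c).of_le (by exact_mod_cast le_top)) a)
  · exact continuousOn_finsetSum _ fun b _ => (ContinuousOn.comp_fst'
      (contDiffOn_vectorCoord hg hu x₀ b).continuousOn).mul (hξ b)
  · refine continuousOn_finsetSum _ fun a _ => continuousOn_finsetSum _ fun b _ =>
      ContinuousOn.mul (ContinuousOn.comp_fst' (contDiffOn_inv_metricMatrix hg x₀ a b).continuousOn)
        (continuousOn_finsetSum _ fun c _ => ContinuousOn.mul ?_ (hξ c))
    exact ContinuousOn.comp_fst' (continuousOn_christoffel hT hg x₀ c a b)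

/-- The Lie derivative equation says that `uᵃ (∂_a V_b - ∂_b V_a) = 0`. -/
theorem IsReducedSolution.sum_partialDeriv (hT : 0 < T) (hg : IsSlabMetric T g)
    (hu : u.SmoothOn ∞ (slab X T)) (h : IsReducedSolution T g u τ α F φ₀ π₀ G V) {x₀ : X}
    {z : Vec n} (hz : z ∈ coordDomain T x₀) (b : Fin (n + 2)) :
    ∑ a, vectorCoord u x₀ z a * partialDeriv (coordDomain T x₀) a (fun y => covectorCoord V x₀ y b) z =
      ∑ a, vectorCoord u x₀ z a *
        partialDeriv (coordDomain T x₀) b (fun y => covectorCoord V x₀ y a) z := by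
  have hV := fun a => (contDiffOn_covectorCoord (k := 1) (by exact_mod_cast le_top)
    h.smooth x₀ a).differentiableOn one_ne_zero z hz
  have hU := fun a => (contDiffOn_vectorCoord hg hu x₀ a).differentiableOn (by simp) z hz
  have h1 := h.lie_eq x₀ z hz b
  have h2 : partialDeriv (coordDomain T x₀) b (fun y => V (chartParam x₀ y) (u (chartParam x₀ y))) z =
      partialDeriv (coordDomain T x₀) b
        (fun y => ∑ a, vectorCoord u x₀ y a * covectorCoord V x₀ y a) z := by
    have h3 : EqOn (fun y => V (chartParam x₀ y) (u (chartParam x₀ y)))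
        (fun y => ∑ a, vectorCoord u x₀ y a * covectorCoord V x₀ y a) (coordDomain T x₀) :=
      fun y hy => covector_apply_eq V u hy.2
    rw [partialDeriv, partialDeriv, fderivWithin_congr h3 (h3 hz)]
  rw [h2, partialDeriv_sum_mul (uniqueDiffOn_coordDomain hT x₀ z hz) hU hV, lieCoord,
    Finset.sum_add_distrib, Finset.sum_add_distrib] at h1
  have h3 : ∑ a, covectorCoord V x₀ z a *
      partialDeriv (coordDomain T x₀) b (fun y => vectorCoord u x₀ y a) z =
      ∑ a, partialDeriv (coordDomain T x₀) b (fun y => vectorCoord u x₀ y a) z *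
        covectorCoord V x₀ z a := Finset.sum_congr rfl fun a _ => mul_comm _ _
  linarith

theorem IsReducedSolution.divergence_current (hT : 0 < T) (hg : IsSlabMetric T g)
    (hu : u.SmoothOn ∞ (slab X T)) (h : IsReducedSolution T g u τ α F φ₀ π₀ G V) {x₀ : X}
    {ψ : EuclideanSpace ℝ (Fin (n + 1)) → ℝ} (hψ : ContDiff ℝ ∞ ψ)
    {z : Vec n} (hz : z ∈ coordDomain T x₀) :
    ∑ a, partialDeriv (coordDomain T x₀) a
      (fun y => ψ y.2 * chartCurrent g u x₀ a y (covectorCoord V x₀ y)) z =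
      divergenceForm T g u x₀ ψ z (covectorCoord V x₀ z) +
        2 * (ψ z.2 * volumeElement g x₀ z * (vectorCoord u x₀ z ⬝ᵥ covectorCoord V x₀ z)) *
          F (chartParam x₀ z) := by
  have hV := fun a => (contDiffOn_covectorCoord (k := 1) (by exact_mod_cast le_top)
    h.smooth x₀ a).differentiableOn one_ne_zero z hz
  have hκ := fun a b c =>
    (contDiffOn_currentCoeff hg hu x₀ hψ a b c).differentiableOn (by simp) z hz
  have hF := h.divergence_eq x₀ z hz
  have hsymm : ((metricMatrix g x₀ z)⁻¹)ᵀ = (metricMatrix g x₀ z)⁻¹ :=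
    gram_inv_symm (hg.lorentz _ (chartParam_mem_slab hz))
  have hmain := sum_current_deriv hsymm (ξ := covectorCoord V x₀ z) (fun b => h.sum_partialDeriv hT hg hu hz b)
  simp only [mul_chartCurrent_eq_sum]
  simp only [partialDeriv_sum_quadratic (uniqueDiffOn_coordDomain hT x₀ z hz) (hκ _) hV,
    Finset.sum_add_distrib]
  rw [divergenceForm, add_assoc]
  congr 1
  have h4 : ∑ a, ∑ b, (metricMatrix g x₀ z)⁻¹ a b *
      partialDeriv (coordDomain T x₀) a (fun y => covectorCoord V x₀ y b) z =
      F (chartParam x₀ z) + ∑ a, ∑ b, (metricMatrix g x₀ z)⁻¹ a b *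
        ∑ c, christoffel T g x₀ z c a b * covectorCoord V x₀ z c := by
    rw [← hF]
    simp only [divCoord, covDeriv, mul_sub, Finset.sum_sub_distrib, sub_add_cancel]
  rw [h4] at hmain
  have h5 : ∀ a b c x, currentCoeff g u x₀ ψ a b c z * x = ψ z.2 * volumeElement g x₀ z *
      ((-vectorCoord u x₀ z a * (metricMatrix g x₀ z)⁻¹ b c +
    2 * (metricMatrix g x₀ z)⁻¹ a b * vectorCoord u x₀ z c) * x) := fun a b c x => by
    rw [currentCoeff]; ring
  simp only [h5, ← Finset.mul_sum]
  rw [hmain]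
  ring

/-- The divergence of the localized energy current is controlled by the energy density and the
source. -/
theorem exists_divergence_bound (hT : 0 < T) (hg : IsSlabMetric T g)
    (hu : u.SmoothOn ∞ (slab X T))
    (hu_future : ∀ p ∈ slab X T, IsFutureTimelike (n := n) (g p) (u p)) (τ : VectorField n X)
    (α : ℝ × X → ℝ) {x₀ : X}
    {ψ : EuclideanSpace ℝ (Fin (n + 1)) → ℝ} (hψ : ContDiff ℝ ∞ ψ)
    {K : Set (Vec n)} (hK : IsCompact K) (hKD : K ⊆ coordDomain T x₀) :
    ∃ C : ℝ, 0 < C ∧ ∀ (F : ℝ × X → ℝ) (φ₀ π₀ : X → ℝ) (G : ℝ × X → ℝ) (V : CovectorField n X),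
      IsReducedSolution T g u τ α F φ₀ π₀ G V → ∀ z ∈ K,
        -∑ a, partialDeriv (coordDomain T x₀) a
          (fun y => ψ y.2 * chartCurrent g u x₀ a y (covectorCoord V x₀ y)) z ≤
        C * (-chartCurrent g u x₀ 0 z (covectorCoord V x₀ z) +
          hypersurfaceDensity g x₀ 0 z * F (chartParam x₀ z) ^ 2) := by
  obtain ⟨c, hc, hcb⟩ := exists_chartCurrent_zero_bound hg hu hu_future hK hKD
  obtain ⟨M, hM, hMb⟩ := exists_inv_bound hK
    ((continuousOn_hypersurfaceDensity hg x₀ 0).mono hKD)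
    fun z hz => hypersurfaceDensity_zero_pos hg (hKD hz)
  have hlin : ContinuousOn (fun p : Vec n × (Fin (n + 2) → ℝ) =>
      ψ p.1.2 * volumeElement g x₀ p.1 * (vectorCoord u x₀ p.1 ⬝ᵥ p.2))
      (coordDomain T x₀ ×ˢ univ) :=
    ((hψ.continuous.comp (continuous_snd.comp continuous_fst)).continuousOn.mul
      (ContinuousOn.comp_fst' (contDiffOn_volumeElement hg x₀).continuousOn)).mul
      (continuousOn_finsetSum _ fun b _ => (ContinuousOn.comp_fst'
        (contDiffOn_vectorCoord hg hu x₀ b).continuousOn).mul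
          (Continuous.continuousOn (by fun_prop)))
  obtain ⟨C, hC, hCb⟩ := exists_quadratic_upper_bound hK
    (f := fun z ξ => -divergenceForm T g u x₀ ψ z ξ +
      (ψ z.2 * volumeElement g x₀ z * (vectorCoord u x₀ z ⬝ᵥ ξ)) ^ 2)
    (((continuousOn_divergenceForm hT hg hu x₀ hψ).neg.add (hlin.pow 2)).mono
      (prod_mono_left hKD))
    (fun z _ k ξ => by rw [divergenceForm_smul, dotProduct_smul, smul_eq_mul]; ring)
  refine ⟨max (C / c) M, by positivity, fun F φ₀ π₀ G V h z hz => ?_⟩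
  rw [h.divergence_current hT hg hu hψ (hKD hz)]
  have h1 := hCb z hz (covectorCoord V x₀ z)
  have h2 := hcb z hz (covectorCoord V x₀ z)
  have h3 := hMb z hz
  set e := -chartCurrent g u x₀ 0 z (covectorCoord V x₀ z)
  set q := ψ z.2 * volumeElement g x₀ z * (vectorCoord u x₀ z ⬝ᵥ covectorCoord V x₀ z)
  set f := F (chartParam x₀ z)
  set r := hypersurfaceDensity g x₀ 0 z
  have he : 0 ≤ e := le_trans (by positivity) h2
  have hr : 0 < r := hypersurfaceDensity_zero_pos hg (hKD hz)
  have h4 : C * ‖covectorCoord V x₀ z‖ ^ 2 ≤ C / c * e := by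
    rw [div_mul_eq_mul_div, le_div_iff₀ hc]
    nlinarith
  have h5 : f ^ 2 * 1 ≤ f ^ 2 * (M * r) := mul_le_mul_of_nonneg_left h3 (sq_nonneg _)
  have h6 : C / c * e ≤ max (C / c) M * e := mul_le_mul_of_nonneg_right (le_max_left _ _) he
  have h7 : M * (r * f ^ 2) ≤ max (C / c) M * (r * f ^ 2) :=
    mul_le_mul_of_nonneg_right (le_max_right _ _) (by positivity)
  nlinarith [sq_nonneg (q + f)]

end Divergence

/-! ### The energy estimate in a chart -/

theorem ContinuousOn.comp_graph {Z Z' : Type*} [TopologicalSpace Z] [TopologicalSpace Z']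
    {s : Set Z} {f : Z → Z' → ℝ} (hf : ContinuousOn (fun p : Z × Z' => f p.1 p.2) (s ×ˢ univ))
    {ξ : Z → Z'} (hξ : ContinuousOn ξ s) : ContinuousOn (fun z => f z (ξ z)) s :=
  hf.comp (continuousOn_id.prodMk hξ) fun _ hz => ⟨hz, mem_univ _⟩

theorem continuousOn_setIntegral_left {E : Type*} [NormedAddCommGroup E] [MeasureSpace E]
    [BorelSpace E] [IsFiniteMeasureOnCompacts (volume : Measure E)] {I : Set ℝ}
    (hI : IsCompact I) {S K : Set E} (hS : MeasurableSet S) (hK : IsCompact K) (hSK : S ⊆ K)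
    {f : ℝ × E → ℝ} (hf : ContinuousOn f (I ×ˢ K)) :
    ContinuousOn (fun s => ∫ y in S, f (s, y)) I := by
  obtain ⟨M, hM⟩ := (hI.prod hK).exists_bound_of_continuousOn hf
  refine continuousOn_of_dominated (bound := fun _ => M) (fun s hs => ?_) (fun s hs => ?_) ?_ ?_
  · have h1 : ContinuousOn (fun y => f (s, y)) K :=
      hf.comp (by fun_prop) fun y hy => ⟨hs, hy⟩
    exact (h1.integrableOn_of_subset_isCompact hK hS hSK
      ((measure_mono hSK).trans_lt hK.measure_lt_top).ne).aestronglyMeasurable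
  · filter_upwards [ae_restrict_mem hS] with y hy using hM _ ⟨hs, hSK hy⟩
  · exact integrableOn_const ((measure_mono hSK).trans_lt hK.measure_lt_top).ne
  · filter_upwards [ae_restrict_mem hS] with y hy
    exact hf.comp (by fun_prop) fun s hs => ⟨hs, hSK hy⟩

/-- The part of the lateral boundary in a ball of the coordinate space. -/
def lateralBall {n : ℕ} (c : EuclideanSpace ℝ (Fin (n + 1))) (r t : ℝ) :
    Set (ℝ × EuclideanSpace ℝ (Fin n)) :=
  {q | q.1 ∈ Icc 0 t ∧ boundaryIncl n q.2 ∈ Metric.closedBall c r}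

theorem isCompact_lateralBall {n : ℕ} (c : EuclideanSpace ℝ (Fin (n + 1))) (r t : ℝ) :
    IsCompact (lateralBall c r t) := by
  have h1 : IsClosed (lateralBall c r t) := (isClosed_Icc.preimage continuous_fst).inter
    (Metric.isClosed_closedBall.preimage ((continuous_boundaryIncl n).comp continuous_snd))
  refine (isCompact_Icc.prod ((isCompact_closedBall c r).image
    (boundaryProjL n).continuous)).of_isClosed_subset h1 fun q hq => ⟨hq.1, ?_⟩
  exact ⟨_, hq.2, boundaryProjL_boundaryIncl n q.2⟩

theorem lateralBall_mono {n : ℕ} {c : EuclideanSpace ℝ (Fin (n + 1))} {r r' t t' : ℝ} (hr : r ≤ r')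
    (ht : t ≤ t') : lateralBall c r t ⊆ lateralBall c r' t' := fun _ hq =>
  ⟨⟨hq.1.1, hq.1.2.trans ht⟩, Metric.closedBall_subset_closedBall hr hq.2⟩

section ChartEnergy

variable {n : ℕ} {X : Type*} [TopologicalSpace X] [ChartedSpace (EuclideanHalfSpace (n + 1)) X]

theorem mem_nhdsWithin_halfSpace (x₀ : X) :
    ∀ y ∈ (extChartAt (𝓡∂ (n + 1)) x₀).target,
      (extChartAt (𝓡∂ (n + 1)) x₀).target ∈ 𝓝[halfSpace n] y := by
  intro y hy
  have h := extChartAt_target_mem_nhdsWithin_of_mem hy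
  rwa [show range (𝓡∂ (n + 1)) = halfSpace n from range_euclideanHalfSpace _] at h

variable [IsManifold (𝓡∂ (n + 1)) ∞ X] {T : ℝ} {g : MetricField n X} {u τ : VectorField n X}
  {α : ℝ × X → ℝ} {ρ : ℝ} {F : ℝ × X → ℝ} {φ₀ π₀ : X → ℝ} {G : ℝ × X → ℝ} {V : CovectorField n X}

theorem IsReducedSolution.contDiffOn_coord (h : IsReducedSolution T g u τ α F φ₀ π₀ G V) (x₀ : X)
    (a : Fin (n + 2)) : ContDiffOn ℝ 1 (fun z => covectorCoord V x₀ z a) (coordDomain T x₀) :=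
  contDiffOn_covectorCoord (by exact_mod_cast le_top) h.smooth x₀ a

theorem IsReducedSolution.continuousOn_source (hT : 0 < T) (hg : IsSlabMetric T g)
    (h : IsReducedSolution T g u τ α F φ₀ π₀ G V) (x₀ : X) :
    ContinuousOn (fun z : Vec n => F (chartParam x₀ z)) (coordDomain T x₀) := by
  have h1 : ContinuousOn (divCoord T g V x₀) (coordDomain T x₀) :=
    continuousOn_finsetSum _ fun a _ => continuousOn_finsetSum _ fun b _ =>
      (contDiffOn_inv_metricMatrix hg x₀ a b).continuousOn.mul
        ((continuousOn_partialDeriv (uniqueDiffOn_coordDomain hT x₀) (h.contDiffOn_coord x₀ b) a).sub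
          (continuousOn_finsetSum _ fun c _ => (continuousOn_christoffel hT hg x₀ c a b).mul
            (h.contDiffOn_coord x₀ c).continuousOn))
  exact h1.congr fun z hz => (h.divergence_eq x₀ z hz).symm

theorem IsReducedSolution.continuousOn_boundary_data (hg : IsSlabMetric T g)
    (hα : ContMDiffOn (stModel n) 𝓘(ℝ, ℝ) ∞ α (lateral n X T))
    (hu : u.SmoothOn ∞ (slab X T)) (hu_lateral : ∀ p ∈ lateral n X T,
      u p = τ p + ((1 - ρ) * (α p / (1 + α p ^ 2))) • lateralNormal g p)
    (h : IsReducedSolution T g u τ α F φ₀ π₀ G V) (x₀ : X) :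
    ContinuousOn (fun z : Vec n => G (chartParam x₀ z)) (coordDomain T x₀ ∩ {z | z.2 0 = 0}) := by
  have h1 : ContinuousOn (fun z => boundaryVector g u α ρ x₀ z ⬝ᵥ covectorCoord V x₀ z)
      (coordDomain T x₀ ∩ {z | z.2 0 = 0}) :=
    continuousOn_finsetSum _ fun b _ => (continuousOn_boundaryVector hg hα hu ρ x₀ b).mul
      ((h.contDiffOn_coord x₀ b).continuousOn.mono inter_subset_left)
  refine h1.congr fun z hz => ?_
  exact (h.boundary _ (chartParam_mem_lateral hz.1 hz.2)).symm.trans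
    (boundary_apply_eq hg hu_lateral V hz.1 hz.2)

theorem continuousOn_energyDensity (hg : IsSlabMetric T g) (hu : u.SmoothOn ∞ (slab X T))
    {k : WithTop ℕ∞} (hk : k ≤ ∞) (hV : V.SmoothOn k (slab X T)) (x₀ : X) :
    ContinuousOn (fun z : Vec n => energyDensity (n := n) (g (chartParam x₀ z)) (u (chartParam x₀ z))
      (V (chartParam x₀ z))) (coordDomain T x₀) := by
  have hξ : ContinuousOn (covectorCoord V x₀) (coordDomain T x₀) :=
    continuousOn_pi.2 fun a => (contDiffOn_covectorCoord hk hV x₀ a).continuousOn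
  have h0 : ContinuousOn (fun z => (Real.sqrt (-(metricMatrix g x₀ z)⁻¹ 0 0))⁻¹)
      (coordDomain T x₀) :=
    (contDiffOn_inv_metricMatrix hg x₀ 0 0).continuousOn.neg.sqrt.inv₀ fun z hz =>
      (Real.sqrt_pos.2 (neg_pos.2 (metricMatrix_inv_zero_neg hg hz))).ne'
  have h2 : ContinuousOn (fun z => current (metricMatrix g x₀ z)⁻¹ (vectorCoord u x₀ z)
      (covectorCoord V x₀ z) 0) (coordDomain T x₀) :=
    ContinuousOn.comp_graph (f := fun z ξ => current (metricMatrix g x₀ z)⁻¹ (vectorCoord u x₀ z) ξ 0)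
      (continuousOn_current hg hu x₀ 0) hξ
  have h1 : ContinuousOn (fun z => -(Real.sqrt (-(metricMatrix g x₀ z)⁻¹ 0 0))⁻¹ *
      current (metricMatrix g x₀ z)⁻¹ (vectorCoord u x₀ z) (covectorCoord V x₀ z) 0)
      (coordDomain T x₀) := h0.neg.mul h2
  exact h1.congr fun z hz => energyDensity_chart_eq hg u V hz

theorem energyDensity_nonneg (hg : IsSlabMetric T g)
    (hu_future : ∀ p ∈ slab X T, IsFutureTimelike (n := n) (g p) (u p)) (V : CovectorField n X)
    {p : ℝ × X} (hp : p ∈ slab X T) : 0 ≤ energyDensity (n := n) (g p) (u p) (V p) := by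
  by_cases h : (show Vec n →L[ℝ] ℝ from V p) = 0
  · have h1 : energyDensity (n := n) (g p) (u p) (0 : Vec n →L[ℝ] ℝ) = 0 := by
      have h2 := energyDensity_eq_current (n := n) (A := ContinuousLinearMap.id ℝ (Vec n))
        ⟨ContinuousLinearEquiv.refl ℝ (Vec n), rfl⟩ (fun _ => rfl) (hg.lorentz p hp) (u p) 0
      rw [h2]
      have : covComp (ContinuousLinearMap.id ℝ (Vec n)) (0 : Vec n →L[ℝ] ℝ) = 0 := by
        funext a; rfl
      rw [this, current]
      simp
    exact (h1.symm.trans (congrArg (energyDensity (n := n) (g p) (u p)) h.symm)).le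
  · exact (energyDensity_pos (hg.lorentz p hp) (hg.spacelike_slices p hp) (hu_future p hp) h).le

theorem lateralIncl_mem_of_mem_lateralBall {x₀ : X} {c : EuclideanSpace ℝ (Fin (n + 1))} {r t : ℝ}
    (hball : Metric.closedBall c r ∩ halfSpace n ⊆ (extChartAt (𝓡∂ (n + 1)) x₀).target)
    (ht : t ≤ T) {q : ℝ × EuclideanSpace ℝ (Fin n)} (hq : q ∈ lateralBall c r t) :
    lateralIncl n q ∈ coordDomain T x₀ ∩ {z | z.2 0 = 0} :=
  ⟨⟨⟨hq.1.1, hq.1.2.trans ht⟩, hball ⟨hq.2, (boundaryIncl_zero n q.2).ge⟩⟩, boundaryIncl_zero n q.2⟩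

/-- The energy density with respect to the coordinates `k`-th of which is constant. -/
def chartEnergy (g : MetricField n X) (u : VectorField n X) (V : CovectorField n X) (x₀ : X)
    (k : Fin (n + 2)) (z : Vec n) : ℝ :=
  hypersurfaceDensity g x₀ k z * energyDensity (n := n) (g (chartParam x₀ z))
    (u (chartParam x₀ z)) (V (chartParam x₀ z))

theorem chartEnergy_zero (hg : IsSlabMetric T g) {x₀ : X} {z : Vec n}
    (hz : z ∈ coordDomain T x₀) (V : CovectorField n X) :
    chartEnergy g u V x₀ 0 z = -chartCurrent g u x₀ 0 z (covectorCoord V x₀ z) :=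
  density_mul_energyDensity hg hz V

theorem continuousOn_chartEnergy (hg : IsSlabMetric T g) (hu : u.SmoothOn ∞ (slab X T))
    (h : IsReducedSolution T g u τ α F φ₀ π₀ G V) (x₀ : X) (k : Fin (n + 2)) :
    ContinuousOn (chartEnergy g u V x₀ k) (coordDomain T x₀) :=
  (continuousOn_hypersurfaceDensity hg x₀ k).mul
    (continuousOn_energyDensity hg hu (by exact_mod_cast le_top) h.smooth x₀)

theorem chartEnergy_nonneg (hg : IsSlabMetric T g)
    (hu_future : ∀ p ∈ slab X T, IsFutureTimelike (n := n) (g p) (u p)) (V : CovectorField n X)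
    {x₀ : X} (k : Fin (n + 2)) {z : Vec n} (hz : z ∈ coordDomain T x₀) :
    0 ≤ chartEnergy g u V x₀ k z :=
  mul_nonneg (Real.sqrt_nonneg _) (energyDensity_nonneg hg hu_future V (chartParam_mem_slab hz))

theorem exists_chart_estimate (hT : 0 < T) (hg : IsSlabMetric T g)
    (hτ : IsBoundaryTimeField T g τ)
    (hα : ContMDiffOn (stModel n) 𝓘(ℝ, ℝ) ∞ α (lateral n X T))
    (hα_pos : ∀ p ∈ lateral n X T, 0 < α p) (hρ_pos : 0 < ρ) (hρ_lt : ρ < 1)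
    (hu : u.SmoothOn ∞ (slab X T))
    (hu_future : ∀ p ∈ slab X T, IsFutureTimelike (n := n) (g p) (u p))
    (hu_lateral : ∀ p ∈ lateral n X T,
      u p = τ p + ((1 - ρ) * (α p / (1 + α p ^ 2))) • lateralNormal g p)
    (x₀ : X) {c : EuclideanSpace ℝ (Fin (n + 1))} (ψ : ContDiffBump c)
    (hball : Metric.closedBall c ψ.rOut ∩ halfSpace n ⊆ (extChartAt (𝓡∂ (n + 1)) x₀).target) :
    ∃ C : ℝ, 0 < C ∧ ∀ (F : ℝ × X → ℝ) (φ₀ π₀ : X → ℝ) (G : ℝ × X → ℝ) (V : CovectorField n X),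
      IsReducedSolution T g u τ α F φ₀ π₀ G V → ∀ t ∈ Icc 0 T,
        (∫ y in Metric.closedBall c ψ.rIn ∩ halfSpace n, chartEnergy g u V x₀ 0 (t, y)) +
          (∫ q in lateralBall c ψ.rIn t, chartEnergy g u V x₀ 1 (lateralIncl n q)) ≤
        C * ((∫ y in Metric.closedBall c ψ.rOut ∩ halfSpace n, chartEnergy g u V x₀ 0 (0, y)) +
          (∫ s in (0 : ℝ)..t, ∫ y in Metric.closedBall c ψ.rOut ∩ halfSpace n,
            (chartEnergy g u V x₀ 0 (s, y) +
              hypersurfaceDensity g x₀ 0 (s, y) * F (chartParam x₀ (s, y)) ^ 2)) +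
          ∫ q in lateralBall c ψ.rOut t, hypersurfaceDensity g x₀ 1 (lateralIncl n q) *
            G (chartParam x₀ (lateralIncl n q)) ^ 2) := by
  set K := Metric.closedBall c ψ.rOut ∩ halfSpace n with hK
  have hKc : IsCompact K := (isCompact_closedBall c ψ.rOut).inter_right (isClosed_halfSpace n)
  have hMc : IsCompact (Icc 0 T ×ˢ K) := isCompact_Icc.prod hKc
  have hMD : Icc 0 T ×ˢ K ⊆ coordDomain T x₀ := prod_mono_right hball
  have hBc : IsCompact (Icc 0 T ×ˢ K ∩ {z : Vec n | z.2 0 = 0}) :=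
    hMc.inter_right (isClosed_eq (by fun_prop) continuous_const)
  obtain ⟨C₁, hC₁, hdiv⟩ := exists_divergence_bound hT hg hu hu_future τ α (x₀ := x₀)
    (ψ := ψ) ψ.contDiff hMc hMD
  obtain ⟨A, B, hA, hB, hlat⟩ := exists_lateral_bound hg hτ hα hα_pos hρ_pos hρ_lt hu hu_lateral
    (x₀ := x₀) hBc (inter_subset_left.trans hMD) fun z hz => hz.2
  refine ⟨A * (1 + C₁) + B, by positivity, fun F φ₀ π₀ G V h t ht => ?_⟩
  have hξ : ContinuousOn (covectorCoord V x₀) (coordDomain T x₀) :=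
    continuousOn_pi.2 fun a => (h.contDiffOn_coord x₀ a).continuousOn
  set w : Fin (n + 2) → Vec n → ℝ := fun a z =>
    ψ z.2 * chartCurrent g u x₀ a z (covectorCoord V x₀ z) with hw
  have hwC : ∀ a, ContDiffOn ℝ 1 (w a) (coordDomain T x₀) := fun a => by
    have h1 : w a = fun z => ∑ b, ∑ c, currentCoeff g u x₀ ψ a b c z *
        (covectorCoord V x₀ z b * covectorCoord V x₀ z c) :=
      funext fun z => mul_chartCurrent_eq_sum g u x₀ ψ a z _
    rw [h1]
    exact ContDiffOn.sum fun b _ => ContDiffOn.sum fun c _ =>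
      ((contDiffOn_currentCoeff hg hu x₀ ψ.contDiff a b c).of_le (by exact_mod_cast le_top)).mul
        ((h.contDiffOn_coord x₀ b).mul (h.contDiffOn_coord x₀ c))
  have hw0 : ∀ a, ∀ z ∈ coordDomain T x₀, z.2 ∉ Metric.closedBall c ψ.rOut → w a z = 0 := by
    intro a z _ hz
    rw [Metric.mem_closedBall, not_le] at hz
    simp only [hw, ψ.zero_of_le_dist hz.le, zero_mul]
  have hdivthm := integral_divergence_chart (mem_nhdsWithin_halfSpace x₀) hball
    (uniqueDiffOn_coordDomain hT x₀) hwC hw0 ht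
  change ∫ s in (0 : ℝ)..t, ∫ y in K, ∑ a, partialDeriv (coordDomain T x₀) a (w a) (s, y) =
    (∫ y in K, w 0 (t, y)) - (∫ y in K, w 0 (0, y)) -
      ∫ q in lateralBall c ψ.rOut t, w 1 (lateralIncl n q) at hdivthm
  have hwe : ∀ z ∈ coordDomain T x₀, w 0 z = -(ψ z.2 * chartEnergy g u V x₀ 0 z) := fun z hz => by
    rw [chartEnergy_zero hg hz]
    simp only [hw]
    ring
  have h0T : (0 : ℝ) ∈ Icc 0 T := ⟨le_rfl, hT.le⟩
  have hec := continuousOn_chartEnergy hg hu h x₀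
  have hslice : ∀ s ∈ Icc 0 T, ∀ {f : Vec n → ℝ}, ContinuousOn f (coordDomain T x₀) →
      IntegrableOn (fun y => f (s, y)) K := fun s hs f hf =>
    (hf.comp (by fun_prop) fun y hy => hMD ⟨hs, hy⟩ :
      ContinuousOn (fun y => f (s, y)) K).integrableOn_compact hKc
  have hψc : ContinuousOn (fun z : Vec n => ψ z.2) (coordDomain T x₀) :=
    (ψ.continuous.comp continuous_snd).continuousOn
  have hKm : MeasurableSet K := hKc.measurableSet
  -- the slice at time `t`
  have e1 : ∫ y in Metric.closedBall c ψ.rIn ∩ halfSpace n, chartEnergy g u V x₀ 0 (t, y) ≤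
      -∫ y in K, w 0 (t, y) := by
    rw [← integral_neg]
    have hsub : Metric.closedBall c ψ.rIn ∩ halfSpace n ⊆ K :=
      inter_subset_inter_left _ (Metric.closedBall_subset_closedBall ψ.rIn_lt_rOut.le)
    have hm : MeasurableSet (Metric.closedBall c ψ.rIn ∩ halfSpace n) :=
      Metric.isClosed_closedBall.measurableSet.inter (isClosed_halfSpace n).measurableSet
    calc _ = ∫ y in Metric.closedBall c ψ.rIn ∩ halfSpace n, -w 0 (t, y) := by
          refine setIntegral_congr_fun hm fun y hy => ?_
          simp only [hwe (t, y) (hMD ⟨ht, hsub hy⟩), ψ.one_of_mem_closedBall hy.1]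
          ring
      _ ≤ _ := by
          refine setIntegral_mono_set (hslice t ht (hwC 0).continuousOn.neg) ?_ hsub.eventuallyLE
          filter_upwards [ae_restrict_mem hKm] with y hy
          simp only [hwe (t, y) (hMD ⟨ht, hy⟩), Pi.zero_apply, neg_neg]
          exact mul_nonneg ψ.nonneg (chartEnergy_nonneg hg hu_future V 0 (hMD ⟨ht, hy⟩))
  -- the initial slice
  have e2 : -∫ y in K, w 0 (0, y) ≤ ∫ y in K, chartEnergy g u V x₀ 0 (0, y) := by
    rw [← integral_neg]
    refine setIntegral_mono_on (hslice 0 h0T (hwC 0).continuousOn.neg) (hslice 0 h0T (hec 0)) hKm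
      fun y hy => ?_
    rw [hwe (0, y) (hMD ⟨h0T, hy⟩), neg_neg]
    exact mul_le_of_le_one_left (chartEnergy_nonneg hg hu_future V 0 (hMD ⟨h0T, hy⟩)) ψ.le_one
  -- the interior
  set src : Vec n → ℝ := fun z => chartEnergy g u V x₀ 0 z +
    hypersurfaceDensity g x₀ 0 z * F (chartParam x₀ z) ^ 2 with hsrc
  have hsrcc : ContinuousOn src (coordDomain T x₀) := (hec 0).add
    ((continuousOn_hypersurfaceDensity hg x₀ 0).mul ((h.continuousOn_source hT hg x₀).pow 2))
  set dv : Vec n → ℝ := fun z => ∑ a, partialDeriv (coordDomain T x₀) a (w a) z with hdv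
  have hdvc : ContinuousOn dv (coordDomain T x₀) := continuousOn_finsetSum _ fun a _ =>
    continuousOn_partialDeriv (uniqueDiffOn_coordDomain hT x₀) (hwC a) a
  have hint : ∀ {f : Vec n → ℝ}, ContinuousOn f (coordDomain T x₀) →
      IntervalIntegrable (fun s => ∫ y in K, f (s, y)) volume 0 t := fun hf =>
    ((continuousOn_setIntegral_left isCompact_Icc hKm hKc subset_rfl (hf.mono hMD)).mono
      (uIcc_subset_Icc h0T ht)).intervalIntegrable
  have e3 : -∫ s in (0 : ℝ)..t, ∫ y in K, dv (s, y) ≤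
      C₁ * ∫ s in (0 : ℝ)..t, ∫ y in K, src (s, y) := by
    rw [← intervalIntegral.integral_neg, ← intervalIntegral.integral_const_mul]
    refine intervalIntegral.integral_mono_on ht.1 (hint hdvc).neg ((hint hsrcc).const_mul C₁)
      fun s hs => ?_
    have hsT : s ∈ Icc 0 T := ⟨hs.1, hs.2.trans ht.2⟩
    have hsy : ∀ y ∈ K, ((s, y) : Vec n) ∈ coordDomain T x₀ := fun y hy => hMD ⟨hsT, hy⟩
    rw [← integral_neg, ← integral_const_mul]
    refine setIntegral_mono_on (hslice s hsT hdvc).neg ((hslice s hsT hsrcc).const_mul C₁) hKm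
      fun y hy => ?_
    have h1 := hdiv F φ₀ π₀ G V h (s, y) ⟨hsT, hy⟩
    rw [← chartEnergy_zero hg (hsy y hy) V] at h1
    exact h1
  -- the lateral boundary
  set Q := lateralBall c ψ.rOut t with hQ
  have hQc : IsCompact Q := isCompact_lateralBall c ψ.rOut t
  have hQm : MeasurableSet Q := hQc.measurableSet
  have hQD : ∀ q ∈ Q, lateralIncl n q ∈ coordDomain T x₀ ∩ {z | z.2 0 = 0} := fun q hq =>
    lateralIncl_mem_of_mem_lateralBall hball ht.2 hq
  have hQi : ∀ {f : Vec n → ℝ}, ContinuousOn f (coordDomain T x₀ ∩ {z | z.2 0 = 0}) →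
      IntegrableOn (fun q => f (lateralIncl n q)) Q := fun hf =>
    (hf.comp (lateralIncl n).continuous.continuousOn hQD).integrableOn_compact hQc
  set bd : Vec n → ℝ := fun z => hypersurfaceDensity g x₀ 1 z * G (chartParam x₀ z) ^ 2 with hbd
  have hbdc : ContinuousOn bd (coordDomain T x₀ ∩ {z | z.2 0 = 0}) :=
    ((continuousOn_hypersurfaceDensity hg x₀ 1).mono inter_subset_left).mul
      ((h.continuousOn_boundary_data hg hα hu hu_lateral x₀).pow 2)
  have hbd0 : ∀ z, 0 ≤ bd z := fun z => mul_nonneg (Real.sqrt_nonneg _) (sq_nonneg _)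
  have e4 : ∫ q in lateralBall c ψ.rIn t, chartEnergy g u V x₀ 1 (lateralIncl n q) ≤
      A * (∫ q in Q, w 1 (lateralIncl n q)) + B * ∫ q in Q, bd (lateralIncl n q) := by
    have hsub : lateralBall c ψ.rIn t ⊆ Q := lateralBall_mono ψ.rIn_lt_rOut.le le_rfl
    have hψe : ContinuousOn (fun z => ψ z.2 * chartEnergy g u V x₀ 1 z)
        (coordDomain T x₀ ∩ {z | z.2 0 = 0}) := (hψc.mul (hec 1)).mono inter_subset_left
    have hw1 := hQi ((hwC 1).continuousOn.mono inter_subset_left)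
    calc _ = ∫ q in lateralBall c ψ.rIn t, ψ (lateralIncl n q).2 *
            chartEnergy g u V x₀ 1 (lateralIncl n q) := by
          refine setIntegral_congr_fun (isCompact_lateralBall c ψ.rIn t).measurableSet
            fun q hq => ?_
          have : ψ (lateralIncl n q).2 = 1 := ψ.one_of_mem_closedBall hq.2
          simp only [this, one_mul]
      _ ≤ ∫ q in Q, ψ (lateralIncl n q).2 * chartEnergy g u V x₀ 1 (lateralIncl n q) := by
          refine setIntegral_mono_set (hQi hψe) ?_ hsub.eventuallyLE
          filter_upwards [ae_restrict_mem hQm] with q hq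
          exact mul_nonneg ψ.nonneg (chartEnergy_nonneg hg hu_future V 1 (hQD q hq).1)
      _ ≤ ∫ q in Q, (A * w 1 (lateralIncl n q) + B * bd (lateralIncl n q)) := by
          refine setIntegral_mono_on (hQi hψe) ((hw1.const_mul A).add ((hQi hbdc).const_mul B)) hQm
            fun q hq => ?_
          have hz := hQD q hq
          have hzK : lateralIncl n q ∈ Icc 0 T ×ˢ K ∩ {z : Vec n | z.2 0 = 0} :=
            ⟨⟨hz.1.1, hq.2, (boundaryIncl_zero n q.2).ge⟩, hz.2⟩
          have h1 := hlat _ hzK V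
          rw [h.boundary _ (chartParam_mem_lateral hz.1 hz.2)] at h1
          have h2 := mul_le_mul_of_nonneg_left h1 (ψ.nonneg (x := (lateralIncl n q).2))
          have h3 : ψ (lateralIncl n q).2 * (B * bd (lateralIncl n q)) ≤
              1 * (B * bd (lateralIncl n q)) :=
            mul_le_mul_of_nonneg_right ψ.le_one (mul_nonneg hB.le (hbd0 _))
          calc _ ≤ _ := h2
            _ = A * w 1 (lateralIncl n q) + ψ (lateralIncl n q).2 * (B * bd (lateralIncl n q)) := by
              simp only [hw, hbd]; ring
            _ ≤ _ := by linarith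
      _ = _ := by
          rw [integral_add (hw1.const_mul A) ((hQi hbdc).const_mul B), integral_const_mul,
            integral_const_mul]
  set Et := ∫ y in Metric.closedBall c ψ.rIn ∩ halfSpace n, chartEnergy g u V x₀ 0 (t, y)
  set E0 := ∫ y in K, chartEnergy g u V x₀ 0 (0, y)
  set S := ∫ s in (0 : ℝ)..t, ∫ y in K, src (s, y)
  set Z := ∫ q in Q, bd (lateralIncl n q)
  have p0 : 0 ≤ Et := by
    refine setIntegral_nonneg (Metric.isClosed_closedBall.measurableSet.inter
      (isClosed_halfSpace n).measurableSet) fun y hy => ?_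
    exact chartEnergy_nonneg hg hu_future V 0 (hMD ⟨ht,
      Metric.closedBall_subset_closedBall ψ.rIn_lt_rOut.le hy.1, hy.2⟩)
  have p1 : 0 ≤ E0 := setIntegral_nonneg hKm fun y hy =>
    chartEnergy_nonneg hg hu_future V 0 (hMD ⟨h0T, hy⟩)
  have p2 : 0 ≤ S := intervalIntegral.integral_nonneg ht.1 fun s hs =>
    setIntegral_nonneg hKm fun y hy => add_nonneg
      (chartEnergy_nonneg hg hu_future V 0 (hMD ⟨⟨hs.1, hs.2.trans ht.2⟩, hy⟩))
      (mul_nonneg (Real.sqrt_nonneg _) (sq_nonneg _))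
  have p3 : 0 ≤ Z := integral_nonneg fun q => hbd0 _
  have h1 : A * Et ≤ A * -∫ y in K, w 0 (t, y) := mul_le_mul_of_nonneg_left e1 (by linarith)
  have h2 : A * (-(∫ y in K, w 0 (0, y)) - ∫ s in (0 : ℝ)..t, ∫ y in K, dv (s, y)) ≤
      A * (E0 + C₁ * S) := mul_le_mul_of_nonneg_left (by linarith) (by linarith)
  have h3 : Et ≤ A * Et := le_mul_of_one_le_left p0 hA
  have h4 : A * ∫ s in (0 : ℝ)..t, ∫ y in K, dv (s, y) = A * ((∫ y in K, w 0 (t, y)) -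
      (∫ y in K, w 0 (0, y)) - ∫ q in Q, w 1 (lateralIncl n q)) := congrArg (A * ·) hdivthm
  have q1 : 0 ≤ A * C₁ * E0 := by positivity
  have q2 : 0 ≤ A * S := by positivity
  have q3 : 0 ≤ (A * (1 + C₁)) * Z := by positivity
  have q4 : 0 ≤ B * (E0 + S) := by positivity
  linarith

end ChartEnergy

/-! ### Integrals over the slices and the lateral boundary -/

section Cover

variable {n : ℕ} {X : Type*} [TopologicalSpace X] [ChartedSpace (EuclideanHalfSpace (n + 1)) X]

variable (n X) in
/-- A partition of `X` into finitely many measurable pieces, each of which lies in a coordinate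
ball. -/
structure ChartCover [MeasurableSpace X] where
  /-- The number of pieces. -/
  card : ℕ
  /-- The centres of the coordinate balls. -/
  center : Fin card → X
  /-- A bump function that is `1` on the piece. -/
  bump : ∀ m, SmoothBumpFunction (𝓡∂ (n + 1)) (center m)
  /-- The pieces. -/
  piece : Fin card → Set X
  measurableSet_piece : ∀ m, MeasurableSet (piece m)
  piece_subset : ∀ m, piece m ⊆ (extChartAt (𝓡∂ (n + 1)) (center m)).source
  piece_ball : ∀ m, ∀ x ∈ piece m, extChartAt (𝓡∂ (n + 1)) (center m) x ∈
    Metric.closedBall (extChartAt (𝓡∂ (n + 1)) (center m) (center m)) (bump m).rIn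
  disjoint_piece : Pairwise fun m m' => Disjoint (piece m) (piece m')
  iUnion_piece : ⋃ m, piece m = univ

theorem nonempty_chartCover [CompactSpace X] [MeasurableSpace X] [BorelSpace X] :
    Nonempty (ChartCover n X) := by
  let f : ∀ x : X, SmoothBumpFunction (𝓡∂ (n + 1)) x := fun x => Classical.arbitrary _
  let O : X → Set X := fun x => (chartAt (EuclideanHalfSpace (n + 1)) x).source ∩
    extChartAt (𝓡∂ (n + 1)) x ⁻¹' Metric.ball (extChartAt (𝓡∂ (n + 1)) x x) (f x).rIn
  have hO : ∀ x, IsOpen (O x) := fun x => isOpen_extChartAt_preimage x Metric.isOpen_ball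
  have hxO : ∀ x, x ∈ O x := fun x => ⟨mem_chart_source _ x, Metric.mem_ball_self (f x).rIn_pos⟩
  obtain ⟨S, hS⟩ := isCompact_univ.elim_finite_subcover O hO fun x _ => mem_iUnion.2 ⟨x, hxO x⟩
  let k : Fin S.card → X := fun m => (S.equivFin.symm m : X)
  have hk : ⋃ m, O (k m) = univ := by
    refine eq_univ_of_forall fun x => ?_
    obtain ⟨y, hy, hxy⟩ := mem_iUnion₂.1 (hS (mem_univ x))
    refine mem_iUnion.2 ⟨S.equivFin ⟨y, hy⟩, ?_⟩
    simp only [k, Equiv.symm_apply_apply]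
    exact hxy
  exact ⟨{
    card := S.card
    center := k
    bump := fun m => f (k m)
    piece := disjointed fun m => O (k m)
    measurableSet_piece := fun m => by
      rw [disjointed_eq_inter_compl]
      exact (hO _).measurableSet.inter
        (MeasurableSet.biInter (to_countable _) fun j _ => (hO _).measurableSet.compl)
    piece_subset := fun m x hx => by
      rw [extChartAt_source]
      exact (disjointed_subset _ m hx).1
    piece_ball := fun m x hx => Metric.ball_subset_closedBall (disjointed_subset _ m hx).2
    disjoint_piece := disjoint_disjointed _
    iUnion_piece := by rw [iUnion_disjointed, hk] }⟩

namespace ChartCover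

variable [MeasurableSpace X] (𝒰 : ChartCover n X)

/-- The closed coordinate ball on which the bump function is `1`. -/
def innerBall (m : Fin 𝒰.card) : Set (EuclideanSpace ℝ (Fin (n + 1))) :=
  Metric.closedBall (extChartAt (𝓡∂ (n + 1)) (𝒰.center m) (𝒰.center m)) (𝒰.bump m).rIn ∩ halfSpace n

/-- The closed coordinate ball outside of which the bump function vanishes. -/
def outerBall (m : Fin 𝒰.card) : Set (EuclideanSpace ℝ (Fin (n + 1))) :=
  Metric.closedBall (extChartAt (𝓡∂ (n + 1)) (𝒰.center m) (𝒰.center m)) (𝒰.bump m).rOut ∩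
    halfSpace n

/-- The boundary part of `innerBall`, up to time `t`. -/
def innerLateral (t : ℝ) (m : Fin 𝒰.card) : Set (ℝ × EuclideanSpace ℝ (Fin n)) :=
  lateralBall (extChartAt (𝓡∂ (n + 1)) (𝒰.center m) (𝒰.center m)) (𝒰.bump m).rIn t

/-- The boundary part of `outerBall`, up to time `t`. -/
def outerLateral (t : ℝ) (m : Fin 𝒰.card) : Set (ℝ × EuclideanSpace ℝ (Fin n)) :=
  lateralBall (extChartAt (𝓡∂ (n + 1)) (𝒰.center m) (𝒰.center m)) (𝒰.bump m).rOut t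

/-- A piece in coordinates. -/
def slicePiece (m : Fin 𝒰.card) : Set (EuclideanSpace ℝ (Fin (n + 1))) :=
  (extChartAt (𝓡∂ (n + 1)) (𝒰.center m)).symm ⁻¹' 𝒰.piece m ∩
    (extChartAt (𝓡∂ (n + 1)) (𝒰.center m)).target

/-- The lateral boundary over a piece. -/
def lateralImage (t : ℝ) (m : Fin 𝒰.card) : Set (ℝ × X) :=
  (fun q => chartParam (𝒰.center m) (lateralIncl n q)) '' lateralDomain n t (𝒰.center m) ∩
    Prod.snd ⁻¹' 𝒰.piece m

/-- The lateral boundary over a piece in coordinates. -/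
def lateralPiece (t : ℝ) (m : Fin 𝒰.card) : Set (ℝ × EuclideanSpace ℝ (Fin n)) :=
  (fun q => chartParam (𝒰.center m) (lateralIncl n q)) ⁻¹' 𝒰.lateralImage t m ∩
    lateralDomain n t (𝒰.center m)

theorem outerBall_subset (m : Fin 𝒰.card) :
    𝒰.outerBall m ⊆ (extChartAt (𝓡∂ (n + 1)) (𝒰.center m)).target := by
  have h := (𝒰.bump m).closedBall_subset
  rwa [show range (𝓡∂ (n + 1)) = halfSpace n from range_euclideanHalfSpace _] at h

theorem innerBall_subset_outerBall (m : Fin 𝒰.card) : 𝒰.innerBall m ⊆ 𝒰.outerBall m :=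
  inter_subset_inter_left _ (Metric.closedBall_subset_closedBall (𝒰.bump m).rIn_lt_rOut.le)

theorem isCompact_innerBall (m : Fin 𝒰.card) : IsCompact (𝒰.innerBall m) :=
  (isCompact_closedBall _ _).inter_right (isClosed_halfSpace n)

theorem isCompact_outerBall (m : Fin 𝒰.card) : IsCompact (𝒰.outerBall m) :=
  (isCompact_closedBall _ _).inter_right (isClosed_halfSpace n)

theorem target_subset_halfSpace (x₀ : X) : (extChartAt (𝓡∂ (n + 1)) x₀).target ⊆ halfSpace n :=
  (extChartAt_target_subset_range x₀).trans (range_euclideanHalfSpace _).subset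

theorem slicePiece_subset (m : Fin 𝒰.card) : 𝒰.slicePiece m ⊆ 𝒰.innerBall m := fun y hy => by
  have h := 𝒰.piece_ball m _ hy.1
  rw [(extChartAt _ (𝒰.center m)).right_inv hy.2] at h
  exact ⟨h, target_subset_halfSpace _ hy.2⟩

theorem lateralPiece_subset (t : ℝ) (m : Fin 𝒰.card) :
    𝒰.lateralPiece t m ⊆ 𝒰.innerLateral t m := fun q hq => by
  have h := 𝒰.piece_ball m _ hq.1.2
  refine ⟨hq.2.1, ?_⟩
  change extChartAt (𝓡∂ (n + 1)) (𝒰.center m) ((extChartAt (𝓡∂ (n + 1)) (𝒰.center m)).symm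
    (boundaryIncl n q.2)) ∈ _ at h
  rwa [(extChartAt _ (𝒰.center m)).right_inv hq.2.2] at h

theorem outerLateral_subset (t : ℝ) (m : Fin 𝒰.card) :
    𝒰.outerLateral t m ⊆ lateralDomain n t (𝒰.center m) := fun q hq =>
  ⟨hq.1, 𝒰.outerBall_subset m ⟨hq.2, (boundaryIncl_zero n q.2).ge⟩⟩

theorem innerLateral_subset_outerLateral (t : ℝ) (m : Fin 𝒰.card) :
    𝒰.innerLateral t m ⊆ 𝒰.outerLateral t m :=
  lateralBall_mono (𝒰.bump m).rIn_lt_rOut.le le_rfl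

variable [IsManifold (𝓡∂ (n + 1)) ∞ X] [BorelSpace X] {T : ℝ} {g : MetricField n X}
  {H : ℝ × X → ℝ}

theorem measurableSet_slicePiece (m : Fin 𝒰.card) : MeasurableSet (𝒰.slicePiece m) :=
  measurableSet_inter_preimage (measurableSet_extChartAt_target _) (continuousOn_extChartAt_symm _)
    (𝒰.measurableSet_piece m)

theorem continuousOn_slice_param {s : ℝ} (hs : s ∈ Icc 0 T) {x₀ : X} {f : Vec n → ℝ}
    (hf : ContinuousOn f (coordDomain T x₀)) :
    ContinuousOn (fun y => f (s, y)) (extChartAt (𝓡∂ (n + 1)) x₀).target :=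
  hf.comp (by fun_prop) fun _ hy => ⟨hs, hy⟩

theorem sliceIntegral (hg : IsSlabMetric T g) {s : ℝ} (hs : s ∈ Icc 0 T)
    (hH : ∀ x₀, ContinuousOn (fun z : Vec n => H (chartParam x₀ z)) (coordDomain T x₀)) :
    Integrable (fun x => H (s, x)) (sliceVolume g s) ∧
      ∫ x, H (s, x) ∂sliceVolume g s = ∑ m, ∫ y in 𝒰.slicePiece m,
        hypersurfaceDensity g (𝒰.center m) 0 (s, y) * H (chartParam (𝒰.center m) (s, y)) := by
  rw [sliceVolume_eq]
  refine (isParamFamily_slice hg hs).integral_iSup 𝒰.center 𝒰.measurableSet_piece (fun m => ?_)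
    𝒰.disjoint_piece (fun i => ?_) 𝒰.isCompact_innerBall
    (fun m => (𝒰.innerBall_subset_outerBall m).trans (𝒰.outerBall_subset m)) 𝒰.slicePiece_subset
    (f := fun x => H (s, x)) (fun i => continuousOn_slice_param hs (hH i))
  · rw [PartialEquiv.symm_image_target_eq_source]
    exact 𝒰.piece_subset m
  · rw [𝒰.iUnion_piece]
    exact subset_univ _

theorem continuousOn_sliceIntegral (𝒰 : ChartCover n X) (hg : IsSlabMetric T g)
    (hH : ∀ x₀, ContinuousOn (fun z : Vec n => H (chartParam x₀ z)) (coordDomain T x₀)) :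
    ContinuousOn (fun s => ∫ x, H (s, x) ∂sliceVolume g s) (Icc 0 T) := by
  refine ContinuousOn.congr ?_ fun s hs => (𝒰.sliceIntegral hg hs hH).2
  refine continuousOn_finsetSum _ fun m _ => ?_
  refine continuousOn_setIntegral_left (f := fun z : Vec n =>
      hypersurfaceDensity g (𝒰.center m) 0 z * H (chartParam (𝒰.center m) z)) isCompact_Icc
    (𝒰.measurableSet_slicePiece m) (𝒰.isCompact_innerBall m) (𝒰.slicePiece_subset m) ?_
  exact ((continuousOn_hypersurfaceDensity hg _ 0).mul (hH _)).mono
    (prod_mono_right ((𝒰.innerBall_subset_outerBall m).trans (𝒰.outerBall_subset m)))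

theorem setIntegral_outerBall_le (hg : IsSlabMetric T g) {s : ℝ} (hs : s ∈ Icc 0 T)
    (hH : ∀ x₀, ContinuousOn (fun z : Vec n => H (chartParam x₀ z)) (coordDomain T x₀))
    (hH0 : ∀ p ∈ slab X T, 0 ≤ H p) (m : Fin 𝒰.card) :
    ∫ y in 𝒰.outerBall m,
        hypersurfaceDensity g (𝒰.center m) 0 (s, y) * H (chartParam (𝒰.center m) (s, y)) ≤
      ∫ x, H (s, x) ∂sliceVolume g s :=
  (isParamFamily_slice hg hs).setIntegral_le (𝒰.center m) (𝒰.isCompact_outerBall m).measurableSet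
    (𝒰.outerBall_subset m) (f := fun x => H (s, x)) (continuousOn_slice_param hs (hH _))
    (Filter.Eventually.of_forall fun x => hH0 (s, x) ⟨hs, mem_univ _⟩)
    (𝒰.sliceIntegral hg hs hH).1

theorem sliceIntegral_le (hg : IsSlabMetric T g) {s : ℝ} (hs : s ∈ Icc 0 T)
    (hH : ∀ x₀, ContinuousOn (fun z : Vec n => H (chartParam x₀ z)) (coordDomain T x₀))
    (hH0 : ∀ p ∈ slab X T, 0 ≤ H p) :
    ∫ x, H (s, x) ∂sliceVolume g s ≤ ∑ m, ∫ y in 𝒰.innerBall m,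
      hypersurfaceDensity g (𝒰.center m) 0 (s, y) * H (chartParam (𝒰.center m) (s, y)) := by
  rw [(𝒰.sliceIntegral hg hs hH).2]
  refine Finset.sum_le_sum fun m _ => ?_
  have hsub := (𝒰.innerBall_subset_outerBall m).trans (𝒰.outerBall_subset m)
  refine setIntegral_mono_set ?_ ?_ (𝒰.slicePiece_subset m).eventuallyLE
  · exact ((continuousOn_slice_param hs ((continuousOn_hypersurfaceDensity hg _ 0).mul
      (hH _))).mono hsub).integrableOn_compact (𝒰.isCompact_innerBall m)
  · filter_upwards [ae_restrict_mem (𝒰.isCompact_innerBall m).measurableSet] with y hy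
    exact mul_nonneg (Real.sqrt_nonneg _) (hH0 _ (chartParam_mem_slab ⟨hs, hsub hy⟩))

theorem continuousOn_lateral_param {t : ℝ} (ht : t ≤ T) {x₀ : X} {f : Vec n → ℝ}
    (hf : ContinuousOn f (coordDomain T x₀ ∩ {z | z.2 0 = 0})) :
    ContinuousOn (fun q => f (lateralIncl n q)) (lateralDomain n t x₀) :=
  hf.comp (lateralIncl n).continuous.continuousOn fun q hq =>
    ⟨lateralIncl_mem ht hq, boundaryIncl_zero n q.2⟩

theorem lateralIntegral (hg : IsSlabMetric T g) {t : ℝ} (ht : t ≤ T)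
    (hH : ∀ x₀, ContinuousOn (fun z : Vec n => H (chartParam x₀ z))
      (coordDomain T x₀ ∩ {z | z.2 0 = 0})) :
    Integrable H (lateralVolume g t) ∧
      ∫ p, H p ∂lateralVolume g t = ∑ m, ∫ q in 𝒰.lateralPiece t m,
        hypersurfaceDensity g (𝒰.center m) 1 (lateralIncl n q) *
          H (chartParam (𝒰.center m) (lateralIncl n q)) := by
  rw [lateralVolume_eq]
  have : (volume : Measure (ℝ × EuclideanSpace ℝ (Fin n))).IsAddHaarMeasure :=
    Measure.prod.instIsAddHaarMeasure volume volume
  refine (isParamFamily_lateral hg ht).integral_iSup 𝒰.center (U := 𝒰.lateralImage t) (fun m => ?_)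
    (fun m => inter_subset_left) (fun m m' hm => ?_) (fun i => ?_)
    (fun m => isCompact_lateralBall _ _ t)
    (fun m => (𝒰.innerLateral_subset_outerLateral t m).trans (𝒰.outerLateral_subset t m))
    (𝒰.lateralPiece_subset t) (fun i => continuousOn_lateral_param ht (hH i))
  · exact ((isParamFamily_lateral hg ht).measurableSet_image _).inter
      (measurable_snd (𝒰.measurableSet_piece m))
  · exact ((𝒰.disjoint_piece hm).preimage _).mono inter_subset_right inter_subset_right
  · intro p hp
    have hp2 : p.2 ∈ ⋃ m, 𝒰.piece m := by
      rw [𝒰.iUnion_piece]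
      exact mem_univ _
    obtain ⟨m, hm⟩ := mem_iUnion.1 hp2
    refine mem_iUnion.2 ⟨m, ?_, hm⟩
    rw [image_lateral] at hp ⊢
    have hs := 𝒰.piece_subset m hm
    exact ⟨hp.1, (mem_boundary_iff hs).1 ((mem_boundary_iff hp.2.2).2 hp.2.1), hs⟩

theorem setIntegral_outerLateral_le (hg : IsSlabMetric T g) {t : ℝ} (ht : t ≤ T)
    (hH : ∀ x₀, ContinuousOn (fun z : Vec n => H (chartParam x₀ z))
      (coordDomain T x₀ ∩ {z | z.2 0 = 0})) (hH0 : ∀ p, 0 ≤ H p) (m : Fin 𝒰.card) :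
    ∫ q in 𝒰.outerLateral t m, hypersurfaceDensity g (𝒰.center m) 1 (lateralIncl n q) *
        H (chartParam (𝒰.center m) (lateralIncl n q)) ≤ ∫ p, H p ∂lateralVolume g t :=
  (isParamFamily_lateral hg ht).setIntegral_le (𝒰.center m)
    (isCompact_lateralBall _ _ t).measurableSet (𝒰.outerLateral_subset t m)
    (continuousOn_lateral_param ht (hH _)) (Filter.Eventually.of_forall hH0)
    (𝒰.lateralIntegral hg ht hH).1

theorem lateralIntegral_nonneg (𝒰 : ChartCover n X) (hg : IsSlabMetric T g) {t : ℝ} (ht : t ≤ T)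
    (hH : ∀ x₀, ContinuousOn (fun z : Vec n => H (chartParam x₀ z))
      (coordDomain T x₀ ∩ {z | z.2 0 = 0})) (hH0 : ∀ p ∈ slab X T, 0 ≤ H p) :
    0 ≤ ∫ p, H p ∂lateralVolume g t := by
  rw [(𝒰.lateralIntegral hg ht hH).2]
  refine Finset.sum_nonneg fun m _ => setIntegral_nonneg ?_ fun q hq =>
    mul_nonneg (Real.sqrt_nonneg _) (hH0 _ (chartParam_mem_slab (lateralIncl_mem ht hq.2)))
  exact measurableSet_inter_preimage (measurableSet_lateralDomain t _)
    ((isParamFamily_lateral hg ht).continuousOn_param _)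
    (((isParamFamily_lateral hg ht).measurableSet_image _).inter
      (measurable_snd (𝒰.measurableSet_piece m)))

theorem lateralIntegral_le (hg : IsSlabMetric T g) {t : ℝ} (ht : t ≤ T)
    (hH : ∀ x₀, ContinuousOn (fun z : Vec n => H (chartParam x₀ z))
      (coordDomain T x₀ ∩ {z | z.2 0 = 0})) (hH0 : ∀ p ∈ slab X T, 0 ≤ H p) :
    ∫ p, H p ∂lateralVolume g t ≤ ∑ m, ∫ q in 𝒰.innerLateral t m,
      hypersurfaceDensity g (𝒰.center m) 1 (lateralIncl n q) *
        H (chartParam (𝒰.center m) (lateralIncl n q)) := by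
  rw [(𝒰.lateralIntegral hg ht hH).2]
  refine Finset.sum_le_sum fun m _ => ?_
  have hsub := (𝒰.innerLateral_subset_outerLateral t m).trans (𝒰.outerLateral_subset t m)
  refine setIntegral_mono_set ?_ ?_ (𝒰.lateralPiece_subset t m).eventuallyLE
  · exact ((continuousOn_lateral_param ht (((continuousOn_hypersurfaceDensity hg _ 1).mono
      inter_subset_left).mul (hH _))).mono hsub).integrableOn_compact (isCompact_lateralBall _ _ t)
  · filter_upwards [ae_restrict_mem (isCompact_lateralBall _ _ t).measurableSet] with q hq
    exact mul_nonneg (Real.sqrt_nonneg _)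
      (hH0 _ (chartParam_mem_slab (lateralIncl_mem ht (hsub hq))))

theorem lateralIntegral_mono (𝒰 : ChartCover n X) (hg : IsSlabMetric T g) {s t : ℝ} (hst : s ≤ t) (ht : t ≤ T)
    (hH : ∀ x₀, ContinuousOn (fun z : Vec n => H (chartParam x₀ z))
      (coordDomain T x₀ ∩ {z | z.2 0 = 0})) (hH0 : ∀ p, 0 ≤ H p) :
    ∫ p, H p ∂lateralVolume g s ≤ ∫ p, H p ∂lateralVolume g t := by
  refine integral_mono_measure ?_ (Filter.Eventually.of_forall hH0) (𝒰.lateralIntegral hg ht hH).1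
  rw [lateralVolume_eq, lateralVolume_eq]
  exact iSup_mono fun i => paramMeasure_mono (measurableSet_lateralDomain s i)
    (measurableSet_lateralDomain t i) ((isParamFamily_lateral hg ht).continuousOn_param i)
    fun q hq => ⟨⟨hq.1.1, hq.1.2.trans hst⟩, hq.2⟩

end ChartCover

end Cover

/-! ### The energy estimate -/

/-- Gronwall's inequality in integral form. -/
theorem add_integral_le_of_le_add_integral {E : ℝ → ℝ} {t R C : ℝ} (ht : 0 ≤ t)
    (hE : ContinuousOn E (Icc 0 t))
    (h : ∀ s ∈ Icc 0 t, E s ≤ C * (R + ∫ r in (0 : ℝ)..s, E r)) :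
    R + ∫ r in (0 : ℝ)..t, E r ≤ R * Real.exp (C * t) := by
  set E' : ℝ → ℝ := IccExtend ht ((Icc 0 t).domRestrict E) with hE'
  have hE'c : Continuous E' := (continuousOn_iff_continuous_domRestrict.1 hE).Icc_extend'
  have heq : ∀ s ∈ Icc 0 t, E' s = E s := fun s hs => IccExtend_of_mem ht _ hs
  have hint : ∀ s ∈ Icc 0 t, ∫ r in (0 : ℝ)..s, E' r = ∫ r in (0 : ℝ)..s, E r := fun s hs =>
    intervalIntegral.integral_congr fun r hr => by
      rw [uIcc_of_le hs.1] at hr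
      exact heq r ⟨hr.1, hr.2.trans hs.2⟩
  have hd : ∀ s, HasDerivAt (fun s => R + ∫ r in (0 : ℝ)..s, E' r) (E' s) s := fun s =>
    (hE'c.integral_hasStrictDerivAt 0 s).hasDerivAt.const_add R
  have hg := le_gronwallBound_of_liminf_deriv_right_le (f := fun s => R + ∫ r in (0 : ℝ)..s, E' r)
    (f' := E') (δ := R) (K := C) (ε := 0) (a := 0) (b := t)
    (fun s _ => (hd s).continuousAt.continuousWithinAt)
    (fun s _ r hr => (hd s).hasDerivWithinAt.liminf_right_slope_le hr) (by simp)
    (fun s hs => by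
      have hs' : s ∈ Icc 0 t := ⟨hs.1, hs.2.le⟩
      rw [add_zero, heq s hs', hint s hs']
      exact h s hs') t ⟨ht, le_rfl⟩
  rw [gronwallBound_ε0, sub_zero, hint t ⟨ht, le_rfl⟩] at hg
  exact hg

section Energy

variable {n : ℕ} {X : Type*} [TopologicalSpace X] [ChartedSpace (EuclideanHalfSpace (n + 1)) X]
  [IsManifold (𝓡∂ (n + 1)) ∞ X] [CompactSpace X] [MeasurableSpace X] [BorelSpace X]
  {T : ℝ} {g : MetricField n X} {u τ : VectorField n X} {α : ℝ × X → ℝ} {ρ : ℝ}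

theorem exists_energy_inequality (𝒰 : ChartCover n X) (hT : 0 < T) (hg : IsSlabMetric T g)
    (hτ : IsBoundaryTimeField T g τ)
    (hα : ContMDiffOn (stModel n) 𝓘(ℝ, ℝ) ∞ α (lateral n X T))
    (hα_pos : ∀ p ∈ lateral n X T, 0 < α p) (hρ_pos : 0 < ρ) (hρ_lt : ρ < 1)
    (hu : u.SmoothOn ∞ (slab X T))
    (hu_future : ∀ p ∈ slab X T, IsFutureTimelike (n := n) (g p) (u p))
    (hu_lateral : ∀ p ∈ lateral n X T,
      u p = τ p + ((1 - ρ) * (α p / (1 + α p ^ 2))) • lateralNormal g p) :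
    ∃ C : ℝ, 0 ≤ C ∧ ∀ (F : ℝ × X → ℝ) (φ₀ π₀ : X → ℝ) (G : ℝ × X → ℝ) (V : CovectorField n X),
      IsReducedSolution T g u τ α F φ₀ π₀ G V → ∀ t ∈ Icc 0 T,
        sliceEnergy g u V t + lateralEnergy g u V t ≤
          C * (sliceEnergy g u V 0 + (∫ s in (0 : ℝ)..t, (sliceEnergy g u V s +
            ∫ x, F (s, x) ^ 2 ∂sliceVolume g s)) + ∫ p, G p ^ 2 ∂lateralVolume g t) := by
  choose C hC hest using fun m => exists_chart_estimate hT hg hτ hα hα_pos hρ_pos hρ_lt hu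
    hu_future hu_lateral (𝒰.center m) (𝒰.bump m).toContDiffBump (𝒰.outerBall_subset m)
  refine ⟨∑ m, C m, Finset.sum_nonneg fun m _ => (hC m).le, fun F φ₀ π₀ G V h t ht => ?_⟩
  set en : ℝ × X → ℝ := fun p => energyDensity (n := n) (g p) (u p) (V p) with hen
  have henc : ∀ x₀, ContinuousOn (fun z : Vec n => en (chartParam x₀ z)) (coordDomain T x₀) :=
    continuousOn_energyDensity hg hu (by exact_mod_cast le_top) h.smooth
  have henc' : ∀ x₀, ContinuousOn (fun z : Vec n => en (chartParam x₀ z))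
      (coordDomain T x₀ ∩ {z | z.2 0 = 0}) := fun x₀ => (henc x₀).mono inter_subset_left
  have hen0 : ∀ p ∈ slab X T, 0 ≤ en p := fun p hp => energyDensity_nonneg hg hu_future V hp
  have hFc : ∀ x₀, ContinuousOn (fun z : Vec n => F (chartParam x₀ z) ^ 2) (coordDomain T x₀) :=
    fun x₀ => (h.continuousOn_source hT hg x₀).pow 2
  have hsumc : ∀ x₀, ContinuousOn (fun z : Vec n => en (chartParam x₀ z) + F (chartParam x₀ z) ^ 2)
      (coordDomain T x₀) := fun x₀ => (henc x₀).add (hFc x₀)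
  have h0T : (0 : ℝ) ∈ Icc 0 T := ⟨le_rfl, hT.le⟩
  have hsplit : ∀ s ∈ Icc 0 T, ∫ x, (en (s, x) + F (s, x) ^ 2) ∂sliceVolume g s =
      sliceEnergy g u V s + ∫ x, F (s, x) ^ 2 ∂sliceVolume g s := fun s hs =>
    integral_add (𝒰.sliceIntegral hg hs henc).1
      (𝒰.sliceIntegral (H := fun p => F p ^ 2) hg hs hFc).1
  have hcont : ContinuousOn (fun s => sliceEnergy g u V s + ∫ x, F (s, x) ^ 2 ∂sliceVolume g s)
      (Icc 0 T) := (𝒰.continuousOn_sliceIntegral hg henc).add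
    (𝒰.continuousOn_sliceIntegral (H := fun p => F p ^ 2) hg hFc)
  calc _ ≤ (∑ m, ∫ y in 𝒰.innerBall m, chartEnergy g u V (𝒰.center m) 0 (t, y)) +
        ∑ m, ∫ q in 𝒰.innerLateral t m, chartEnergy g u V (𝒰.center m) 1 (lateralIncl n q) :=
      add_le_add (𝒰.sliceIntegral_le hg ht henc hen0) (𝒰.lateralIntegral_le hg ht.2 henc' hen0)
    _ = ∑ m, ((∫ y in 𝒰.innerBall m, chartEnergy g u V (𝒰.center m) 0 (t, y)) +
        ∫ q in 𝒰.innerLateral t m, chartEnergy g u V (𝒰.center m) 1 (lateralIncl n q)) :=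
      Finset.sum_add_distrib.symm
    _ ≤ ∑ m, C m * (sliceEnergy g u V 0 + (∫ s in (0 : ℝ)..t, (sliceEnergy g u V s +
            ∫ x, F (s, x) ^ 2 ∂sliceVolume g s)) + ∫ p, G p ^ 2 ∂lateralVolume g t) := by
      refine Finset.sum_le_sum fun m _ => (hest m F φ₀ π₀ G V h t ht).trans
        (mul_le_mul_of_nonneg_left (add_le_add (add_le_add ?_ ?_) ?_) (hC m).le)
      · exact 𝒰.setIntegral_outerBall_le hg h0T henc hen0 m
      · have hc2 : ContinuousOn (fun s => ∫ y in 𝒰.outerBall m,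
            (chartEnergy g u V (𝒰.center m) 0 (s, y) +
              hypersurfaceDensity g (𝒰.center m) 0 (s, y) *
                F (chartParam (𝒰.center m) (s, y)) ^ 2)) (Icc 0 T) :=
          continuousOn_setIntegral_left (f := fun z : Vec n =>
            chartEnergy g u V (𝒰.center m) 0 z + hypersurfaceDensity g (𝒰.center m) 0 z *
              F (chartParam (𝒰.center m) z) ^ 2) isCompact_Icc
            (𝒰.isCompact_outerBall m).measurableSet (𝒰.isCompact_outerBall m) subset_rfl
            (((continuousOn_chartEnergy hg hu h _ 0).add
              ((continuousOn_hypersurfaceDensity hg _ 0).mul (hFc _))).mono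
                (prod_mono_right (𝒰.outerBall_subset m)))
        refine intervalIntegral.integral_mono_on ht.1
          (hc2.mono (uIcc_subset_Icc h0T ht)).intervalIntegrable
          (hcont.mono (uIcc_subset_Icc h0T ht)).intervalIntegrable fun s hs => ?_
        have hsT : s ∈ Icc 0 T := ⟨hs.1, hs.2.trans ht.2⟩
        rw [← hsplit s hsT]
        refine Eq.trans_le ?_ (𝒰.setIntegral_outerBall_le (H := fun p => en p + F p ^ 2) hg hsT hsumc
          (fun p hp => add_nonneg (hen0 p hp) (sq_nonneg _)) m)
        refine setIntegral_congr_fun (𝒰.isCompact_outerBall m).measurableSet fun y _ => ?_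
        simp only [chartEnergy, hen]
        ring
      · exact 𝒰.setIntegral_outerLateral_le (H := fun p => G p ^ 2) hg ht.2
          (fun x₀ => (h.continuousOn_boundary_data hg hα hu hu_lateral x₀).pow 2)
          (fun p => sq_nonneg _) m
    _ = _ := (Finset.sum_mul _ _ _).symm

end Energy

end BoundaryWave

end
theorem mainTheorem4 {n : ℕ} {X : Type*} [TopologicalSpace X] [T2Space X] [CompactSpace X]
    [ChartedSpace (EuclideanHalfSpace (n + 1)) X] [IsManifold (𝓡∂ (n + 1)) ∞ X]
    [MeasurableSpace X] [BorelSpace X]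
    (T : ℝ) (hT : 0 < T)
    (g : BoundaryWave.MetricField n X) (hg : BoundaryWave.IsSlabMetric T g)
    (τ : BoundaryWave.VectorField n X) (hτ : BoundaryWave.IsBoundaryTimeField T g τ)
    (α : ℝ × X → ℝ)
    (hα : ContMDiffOn (BoundaryWave.stModel n) 𝓘(ℝ, ℝ) ∞ α (BoundaryWave.lateral n X T))
    (hα_pos : ∀ p ∈ BoundaryWave.lateral n X T, 0 < α p)
    (ρ : ℝ) (hρ_pos : 0 < ρ) (hρ_lt : ρ < 1)
    (u : BoundaryWave.VectorField n X)
    (hu : u.SmoothOn ∞ (BoundaryWave.slab X T))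
    (hu_future : ∀ p ∈ BoundaryWave.slab X T,
      BoundaryWave.IsFutureTimelike (n := n) (g p) (u p))
    (hu_lateral : ∀ p ∈ BoundaryWave.lateral n X T,
      u p = τ p + ((1 - ρ) * (α p / (1 + α p ^ 2))) • BoundaryWave.lateralNormal g p) :
    ∃ C : ℝ, 1 ≤ C ∧
      ∀ (F : ℝ × X → ℝ) (φ₀ π₀ : X → ℝ) (G : ℝ × X → ℝ) (V : BoundaryWave.CovectorField n X),
        BoundaryWave.IsReducedSolution T g u τ α F φ₀ π₀ G V →
        ∀ t ∈ Icc 0 T,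
          BoundaryWave.sliceEnergy g u V t + BoundaryWave.lateralEnergy g u V t ≤
            C * (BoundaryWave.sliceEnergy g u V 0
              + ∫ p, G p ^ 2 ∂(BoundaryWave.lateralVolume g t)
              + ∫ s in (0 : ℝ)..t, ∫ x, F (s, x) ^ 2 ∂(BoundaryWave.sliceVolume g s)) := by
  obtain ⟨𝒰⟩ := BoundaryWave.nonempty_chartCover (n := n) (X := X)
  obtain ⟨C, hC, hest⟩ := BoundaryWave.exists_energy_inequality 𝒰 hT hg hτ hα hα_pos hρ_pos hρ_lt hu
    hu_future hu_lateral
  refine ⟨max 1 (C * Real.exp (C * T)), le_max_left _ _, fun F φ₀ π₀ G V h t ht => ?_⟩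
  have h0T : (0 : ℝ) ∈ Icc 0 T := ⟨le_rfl, hT.le⟩
  have henc := BoundaryWave.continuousOn_energyDensity hg hu (by exact_mod_cast le_top) h.smooth
  have hen0 : ∀ p ∈ BoundaryWave.slab X T,
      0 ≤ BoundaryWave.energyDensity (n := n) (g p) (u p) (V p) := fun p hp =>
    BoundaryWave.energyDensity_nonneg hg hu_future V hp
  have hEc : ContinuousOn (BoundaryWave.sliceEnergy g u V) (Icc 0 T) :=
    𝒰.continuousOn_sliceIntegral
      (H := fun p => BoundaryWave.energyDensity (n := n) (g p) (u p) (V p)) hg henc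
  have hFc : ContinuousOn (fun s => ∫ x, F (s, x) ^ 2 ∂BoundaryWave.sliceVolume g s) (Icc 0 T) :=
    𝒰.continuousOn_sliceIntegral (H := fun p => F p ^ 2) hg
      fun x₀ => (h.continuousOn_source hT hg x₀).pow 2
  have hL0 : ∀ s ∈ Icc 0 T, 0 ≤ BoundaryWave.lateralEnergy g u V s := fun s hs =>
    𝒰.lateralIntegral_nonneg hg hs.2 (fun x₀ => (henc x₀).mono inter_subset_left) hen0
  have hi : ∀ {f : ℝ → ℝ}, ContinuousOn f (Icc 0 T) → ∀ s ∈ Icc 0 T,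
      IntervalIntegrable f volume 0 s := fun hf s hs =>
    (hf.mono (uIcc_subset_Icc h0T hs)).intervalIntegrable
  set E := BoundaryWave.sliceEnergy g u V with hE
  set f : ℝ → ℝ := fun s => ∫ x, F (s, x) ^ 2 ∂BoundaryWave.sliceVolume g s with hf
  set R := E 0 + ∫ p, G p ^ 2 ∂(BoundaryWave.lateralVolume g t) + ∫ s in (0 : ℝ)..t, f s with hR
  have hf0 : ∀ s, 0 ≤ f s := fun s => integral_nonneg fun x => sq_nonneg _
  have hR0 : 0 ≤ R := add_nonneg (add_nonneg
    (integral_nonneg fun x => hen0 (0, x) ⟨h0T, mem_univ _⟩) (integral_nonneg fun p => sq_nonneg _))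
    (intervalIntegral.integral_nonneg ht.1 fun s _ => hf0 s)
  have hkey : ∀ s ∈ Icc 0 t, E s + BoundaryWave.lateralEnergy g u V s ≤
      C * (R + ∫ r in (0 : ℝ)..s, E r) := fun s hs => by
    have hsT : s ∈ Icc 0 T := ⟨hs.1, hs.2.trans ht.2⟩
    refine (hest F φ₀ π₀ G V h s hsT).trans (mul_le_mul_of_nonneg_left ?_ hC)
    rw [intervalIntegral.integral_add (hi hEc s hsT) (hi hFc s hsT)]
    have h1 : ∫ p, G p ^ 2 ∂(BoundaryWave.lateralVolume g s) ≤
        ∫ p, G p ^ 2 ∂(BoundaryWave.lateralVolume g t) :=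
      𝒰.lateralIntegral_mono (H := fun p => G p ^ 2) hg hs.2 ht.2
        (fun x₀ => (h.continuousOn_boundary_data hg hα hu hu_lateral x₀).pow 2) fun p => sq_nonneg _
    have h2 : ∫ r in (0 : ℝ)..s, f r ≤ ∫ r in (0 : ℝ)..t, f r :=
      intervalIntegral.integral_mono_interval le_rfl hs.1 hs.2
        (Filter.Eventually.of_forall hf0) (hi hFc t ht)
    linarith
  have hgr := BoundaryWave.add_integral_le_of_le_add_integral ht.1
    (hEc.mono (Icc_subset_Icc_right ht.2)) fun s hs =>
      (le_add_of_nonneg_right (hL0 s ⟨hs.1, hs.2.trans ht.2⟩)).trans (hkey s hs)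
  calc _ ≤ C * (R + ∫ r in (0 : ℝ)..t, E r) := hkey t ⟨ht.1, le_rfl⟩
    _ ≤ C * (R * Real.exp (C * t)) := mul_le_mul_of_nonneg_left hgr hC
    _ = C * Real.exp (C * t) * R := by ring
    _ ≤ max 1 (C * Real.exp (C * T)) * R := by
      refine mul_le_mul_of_nonneg_right (le_trans ?_ (le_max_right _ _)) hR0
      exact mul_le_mul_of_nonneg_left
        (Real.exp_le_exp.2 (mul_le_mul_of_nonneg_left ht.2 hC)) hC
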